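/- **Notation.** $(a;b)_\infty=\prod_{j\ge 0}(1-ab^j)$. For $N:\mathbb Z\times\mathbb Z_{\ge0}\to\mathbb Z$ with $N(\cdot,n)$ finitely supported for each $n$, the $k$-th symmetrized moment of $N$ is $\sum_{m\in\mathbb Z}\binom{m+\lfloor (k-1)/2\rfloor}{k}N(m,n)$. An overpartition is a partition in which the first occurrence of each part may be overlined. For a partition or overpartition $\pi$ let $l(\pi)$ be its largest part ($0$ if $\pi$ is empty) and $\#(\pi)$ its number of parts. * $\overline\eta_k(n)$ is the $k$-th symmetrized moment of $\overline N(m,n)$, the number of overpartitions $\pi$ of $n$ with Dyson rank $l(\pi)-\#(\pi)$ equal to $m$. * $\overline{\eta 2}_k(n)$ is that of $\overline{N2}(m,n)$, the number of overpartitions $\pi$ of $n$ with $M_2$-rank $\lceil l(\pi)/2\rceil-\#(\pi)+\#(\pi_o)-\chi(\pi)$ equal to $m$, where $\#(\pi_o)$ is the number of odd non-overlined parts, and $\chi(\pi)=1$ if the largest part is odd and its first occurrence is not overlined, $\chi(\pi)=0$ otherwise. * $\eta 2_k(n)$ is that of $N2(m,n)$, the number of partitions $\pi$ of $n$ without repeated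 odd parts with $M_2$-rank $\lceil l(\pi)/2\rceil-\#(\pi)$ equal to $m$. * $\overline\mu_k(n)$, $\overline{\mu2}_k(n)$, $\mu2_k(n)$ are those of the (residual) crank functions $\overline M$, $\overline{M2}$, $M2$ defined by the formal power series in $q$ over $\mathbb Z[z,z^{-1}]$ $$\sum_{n\ge0}\sum_{m\in\mathbb Z}\overline M(m,n)z^mq^n=\frac{(-q;q)_\infty(q;q)_\infty}{(zq;q)_\infty(z^{-1}q;q)_\infty},$$ $$\sum_{n\ge0}\sum_{m\in\mathbb Z}\overline{M2}(m,n)z^mq^n=\frac{(-q;q)_\infty(q^2;q^2)_\infty}{(q;q^2)_\infty(zq^2;q^2)_\infty(z^{-1}q^2;q^2)_\infty},$$ $$\sum_{n\ge0}\sum_{m\in\mathbb Z}M2(m,n)z^mq^n=\frac{(-q;q^2)_\infty(q^2;q^2)_\infty}{(zq^2;q^2)_\infty(z^{-1}q^2;q^2)_\infty}.$$ **Theorem.** Let $k\ge1$ be an integer and let $q\in\mathbb C$ with $0<|q|<1$. All series below converge absolutely (the sums over $n\neq0$ run over the nonzero integers), and $$\sum_{n\ge1}\mu2_{2k}(n)q^n=\frac{(-q;q^2)_\infty}{(q^2;q^2)_\infty}\sum_{n\ne0}\frac{(-1)^{n+1}q^{n(n+1)+2kn}}{(1-q^{2n})^{2k}}=\frac{(-q;q^2)_\infty}{(q^2;q^2)_\infty}\sum_{n\ge1}\frac{(-1)^{n+1}q^{n(n-1)+2kn}(1+q^{2n})}{(1-q^{2n})^{2k}},$$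 $$\sum_{n\ge1}\eta2_{2k}(n)q^n=\frac{(-q;q^2)_\infty}{(q^2;q^2)_\infty}\sum_{n\ne0}\frac{(-1)^{n+1}q^{n(2n+1)+2kn}}{(1-q^{2n})^{2k}}=\frac{(-q;q^2)_\infty}{(q^2;q^2)_\infty}\sum_{n\ge1}\frac{(-1)^{n+1}q^{n(2n-1)+2kn}(1+q^{2n})}{(1-q^{2n})^{2k}},$$ $$\sum_{n\ge1}\overline\mu_{2k}(n)q^n=\frac{(-q;q)_\infty}{(q;q)_\infty}\sum_{n\ne0}\frac{(-1)^{n+1}q^{n(n+1)/2+kn}}{(1-q^{n})^{2k}}=\frac{(-q;q)_\infty}{(q;q)_\infty}\sum_{n\ge1}\frac{(-1)^{n+1}q^{n(n-1)/2+kn}(1+q^{n})}{(1-q^{n})^{2k}},$$ $$\sum_{n\ge1}\overline\eta_{2k}(n)q^n=2\frac{(-q;q)_\infty}{(q;q)_\infty}\sum_{n\ne0}\frac{(-1)^{n+1}q^{n^2+n+kn}}{(1+q^n)(1-q^{n})^{2k}}=2\frac{(-q;q)_\infty}{(q;q)_\infty}\sum_{n\ge1}\frac{(-1)^{n+1}q^{n^2+kn}}{(1-q^{n})^{2k}},$$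 $$\sum_{n\ge1}\overline{\mu2}_{2k}(n)q^n=\frac{(-q;q)_\infty}{(q;q)_\infty}\sum_{n\ne0}\frac{(-1)^{n+1}q^{n(n+1)+2kn}}{(1-q^{2n})^{2k}}=\frac{(-q;q)_\infty}{(q;q)_\infty}\sum_{n\ge1}\frac{(-1)^{n+1}q^{n(n-1)+2kn}(1+q^{2n})}{(1-q^{2n})^{2k}},$$ $$\sum_{n\ge1}\overline{\eta2}_{2k}(n)q^n=2\frac{(-q;q)_\infty}{(q;q)_\infty}\sum_{n\ne0}\frac{(-1)^{n+1}q^{n^2+2n+2kn}}{(1+q^{2n})(1-q^{2n})^{2k}}=2\frac{(-q;q)_\infty}{(q;q)_\infty}\sum_{n\ge1}\frac{(-1)^{n+1}q^{n^2+2kn}}{(1-q^{2n})^{2k}}.$$ -/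

import Mathlib

open scoped BigOperators LaurentPolynomial PowerSeries

/-! ### Partitions and overpartitions -/

/-- The largest part of a partition (`0` for the empty partition). -/
def largestPart {n : ℕ} (p : n.Partition) : ℕ := p.parts.sup

/-- An overpartition of `n`: a partition of `n` in which the first occurrence of each part size
may be overlined; it is recorded by the set of those part sizes whose first occurrence is
overlined. -/
structure Overpartition (n : ℕ) where
  toPartition : n.Partition
  overlined : Finset ℕ
  overlined_subset : overlined ⊆ toPartition.parts.toFinset

instance Overpartition.instFinite (n : ℕ) : Finite (Overpartition n) := by
  let f : Overpartition n → (Σ p : n.Partition, {s // s ∈ p.parts.toFinset.powerset}) :=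
    fun π => ⟨π.toPartition, π.overlined, Finset.mem_powerset.2 π.overlined_subset⟩
  refine Finite.of_injective f ?_
  rintro ⟨p, s, hs⟩ ⟨p', s', hs'⟩ h
  obtain ⟨h1, h2⟩ := Sigma.mk.inj_iff.1 h
  obtain rfl : p = p' := h1
  have h3 := congrArg Subtype.val (eq_of_heq h2)
  obtain rfl : s = s' := h3
  rfl

/-- The Dyson rank of an overpartition: the largest part minus the number of parts. -/
def Overpartition.dysonRank {n : ℕ} (π : Overpartition n) : ℤ :=
  (largestPart π.toPartition : ℤ) - (π.toPartition.parts.card : ℤ)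

/-- The number of odd non-overlined parts of an overpartition (all odd parts, with multiplicity,
except the overlined first occurrences). -/
def Overpartition.oddNonOverlined {n : ℕ} (π : Overpartition n) : ℕ :=
  (π.toPartition.parts - π.overlined.val).countP (fun i => Odd i)

/-- `1` if the largest part is odd and non-overlined (as the first occurrence is the one that may
be overlined, the largest part is overlined as soon as its first occurrence is), and `0`
otherwise. -/
def Overpartition.chi {n : ℕ} (π : Overpartition n) : ℕ :=
  if Odd (largestPart π.toPartition) ∧ largestPart π.toPartition ∉ π.overlined then 1 else 0

/-- The `M₂`-rank of an overpartition, `⌈l(π)/2⌉ - #(π) + #(π_o) - χ(π)`. -/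
def Overpartition.m2Rank {n : ℕ} (π : Overpartition n) : ℤ :=
  ⌈(largestPart π.toPartition : ℚ) / 2⌉ - (π.toPartition.parts.card : ℤ)
    + (π.oddNonOverlined : ℤ) - (π.chi : ℤ)

/-- Partitions of `n` without repeated odd parts. -/
def OddDistinctPartition (n : ℕ) : Type :=
  {p : n.Partition // ∀ i ∈ p.parts, Odd i → p.parts.count i = 1}

instance OddDistinctPartition.instFinite (n : ℕ) : Finite (OddDistinctPartition n) :=
  inferInstanceAs (Finite {p : n.Partition // ∀ i ∈ p.parts, Odd i → p.parts.count i = 1})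

/-- The `M₂`-rank of a partition without repeated odd parts, `⌈l(π)/2⌉ - #(π)`. -/
def OddDistinctPartition.m2Rank {n : ℕ} (p : OddDistinctPartition n) : ℤ :=
  ⌈(largestPart p.1 : ℚ) / 2⌉ - (p.1.parts.card : ℤ)

/-! ### Rank counting functions -/

/-- The number of overpartitions of `n` with Dyson rank `m`. -/
noncomputable def rankBar (m : ℤ) (n : ℕ) : ℤ :=
  (Nat.card {π : Overpartition n // π.dysonRank = m} : ℤ)

/-- The number of overpartitions of `n` with `M₂`-rank `m`. -/
noncomputable def rank2Bar (m : ℤ) (n : ℕ) : ℤ :=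
  (Nat.card {π : Overpartition n // π.m2Rank = m} : ℤ)

/-- The number of partitions of `n` without repeated odd parts with `M₂`-rank `m`. -/
noncomputable def rank2 (m : ℤ) (n : ℕ) : ℤ :=
  (Nat.card {p : OddDistinctPartition n // p.m2Rank = m} : ℤ)

/-! ### Crank counting functions, through their generating functions -/

/-- The formal infinite product `(a; b)_∞ = ∏_{j ≥ 0} (1 - a b^j)` for formal power series `a, b`
where `b` has zero constant term. The coefficients of the partial products stabilize, see
`coeff_formalQPoch`. -/
noncomputable def formalQPoch {R : Type*} [CommRing R] (a b : R⟦X⟧) : R⟦X⟧ :=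
  PowerSeries.mk fun n => PowerSeries.coeff n (∏ j ∈ Finset.range (n + 1), (1 - a * b ^ j))

/-- `formalQPoch a b` is the coefficientwise limit of the partial products. -/
theorem coeff_formalQPoch {R : Type*} [CommRing R] (a b : R⟦X⟧)
    (hb : PowerSeries.constantCoeff b = 0) {n N : ℕ} (hN : n + 1 ≤ N) :
    PowerSeries.coeff n (∏ j ∈ Finset.range N, (1 - a * b ^ j)) =
      PowerSeries.coeff n (formalQPoch a b) := by
  rw [formalQPoch, PowerSeries.coeff_mk]
  induction N, hN using Nat.le_induction with
  | base => rfl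
  | succ N hN ih =>
    rw [Finset.prod_range_succ, mul_sub, mul_one, map_sub, ih, sub_eq_self]
    have h1 : (PowerSeries.X : R⟦X⟧) ∣ b := PowerSeries.X_dvd_iff.2 hb
    have h2 : (PowerSeries.X : R⟦X⟧) ^ N ∣ (∏ j ∈ Finset.range N, (1 - a * b ^ j)) * (a * b ^ N) :=
      Dvd.dvd.mul_left (Dvd.dvd.mul_left (pow_dvd_pow_of_dvd h1 N) _) _
    exact PowerSeries.X_pow_dvd_iff.1 h2 n (by omega)

/-- The formal variable `q`, over the coefficient ring `ℤ[z, z⁻¹]`. -/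
noncomputable def fq : ℤ[T;T⁻¹]⟦X⟧ := PowerSeries.X

/-- The Laurent monomial `z`, as a constant power series in `q`. -/
noncomputable def fz : ℤ[T;T⁻¹]⟦X⟧ := PowerSeries.C (LaurentPolynomial.T 1)

/-- The Laurent monomial `z⁻¹`, as a constant power series in `q`. -/
noncomputable def fzInv : ℤ[T;T⁻¹]⟦X⟧ := PowerSeries.C (LaurentPolynomial.T (-1))

/-- The quotient of two power series, for a denominator with constant term `1`. -/
noncomputable def formalDiv {R : Type*} [CommRing R] (f g : R⟦X⟧) : R⟦X⟧ :=
  f * PowerSeries.invOfUnit g 1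

theorem formalDiv_mul_cancel {R : Type*} [CommRing R] (f g : R⟦X⟧)
    (hg : PowerSeries.constantCoeff g = 1) : formalDiv f g * g = f := by
  rw [formalDiv, mul_assoc, PowerSeries.invOfUnit_mul g 1 (by simpa using hg), mul_one]

theorem constantCoeff_formalQPoch {R : Type*} [CommRing R] (a b : R⟦X⟧)
    (ha : PowerSeries.constantCoeff a = 0) :
    PowerSeries.constantCoeff (formalQPoch a b) = 1 := by
  rw [← PowerSeries.coeff_zero_eq_constantCoeff_apply, formalQPoch, PowerSeries.coeff_mk]
  simp [ha]

/-- `(-q; q)_∞ (q; q)_∞ / ((zq; q)_∞ (z⁻¹q; q)_∞)`. -/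
noncomputable def crankBarGF : ℤ[T;T⁻¹]⟦X⟧ :=
  formalDiv (formalQPoch (-fq) fq * formalQPoch fq fq)
    (formalQPoch (fz * fq) fq * formalQPoch (fzInv * fq) fq)

/-- `(-q; q)_∞ (q²; q²)_∞ / ((q; q²)_∞ (zq²; q²)_∞ (z⁻¹q²; q²)_∞)`. -/
noncomputable def crank2BarGF : ℤ[T;T⁻¹]⟦X⟧ :=
  formalDiv (formalQPoch (-fq) fq * formalQPoch (fq ^ 2) (fq ^ 2))
    (formalQPoch fq (fq ^ 2) *
      (formalQPoch (fz * fq ^ 2) (fq ^ 2) * formalQPoch (fzInv * fq ^ 2) (fq ^ 2)))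

/-- `(-q; q²)_∞ (q²; q²)_∞ / ((zq²; q²)_∞ (z⁻¹q²; q²)_∞)`. -/
noncomputable def crank2GF : ℤ[T;T⁻¹]⟦X⟧ :=
  formalDiv (formalQPoch (-fq) (fq ^ 2) * formalQPoch (fq ^ 2) (fq ^ 2))
    (formalQPoch (fz * fq ^ 2) (fq ^ 2) * formalQPoch (fzInv * fq ^ 2) (fq ^ 2))

/-- The coefficient of `z^m q^n`. -/
noncomputable def zqCoeff (F : ℤ[T;T⁻¹]⟦X⟧) (m : ℤ) (n : ℕ) : ℤ :=
  (PowerSeries.coeff n F : ℤ[T;T⁻¹]).coeff m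

/-- The residual crank function of overpartitions. -/
noncomputable def crankBar (m : ℤ) (n : ℕ) : ℤ := zqCoeff crankBarGF m n

/-- The second residual crank function of overpartitions. -/
noncomputable def crank2Bar (m : ℤ) (n : ℕ) : ℤ := zqCoeff crank2BarGF m n

/-- The residual crank function of partitions without repeated odd parts. -/
noncomputable def crank2 (m : ℤ) (n : ℕ) : ℤ := zqCoeff crank2GF m n

/-! ### Symmetrized moments -/

/-- The `k`-th symmetrized moment `∑_{m ∈ ℤ} binom(m + ⌊(k-1)/2⌋, k) N(m, n)` of `N`
(the integer division rounds down; the sum has only finitely many nonzero terms for the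
functions `N` above). -/
noncomputable def symMoment (N : ℤ → ℕ → ℤ) (k n : ℕ) : ℤ :=
  ∑ᶠ m : ℤ, Ring.choose (m + ((k : ℤ) - 1) / 2) k * N m n

theorem finite_support_zqCoeff (F : ℤ[T;T⁻¹]⟦X⟧) (n : ℕ) :
    (Function.support fun m => zqCoeff F m n).Finite :=
  (PowerSeries.coeff n F : ℤ[T;T⁻¹]).coeff.hasFiniteSupport

theorem finite_support_card {α : Type*} [Finite α] (r : α → ℤ) :
    (Function.support fun m : ℤ => (Nat.card {a : α // r a = m} : ℤ)).Finite := by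
  refine (Set.finite_range r).subset fun m hm => ?_
  have h : Nat.card {a : α // r a = m} ≠ 0 := by
    simpa [Function.mem_support] using hm
  obtain ⟨⟨a, ha⟩⟩ := (Nat.card_ne_zero.1 h).1
  exact ⟨a, ha⟩

/-! ### Infinite products in the unit disc -/

/-- `(a; q)_∞ = ∏_{j ≥ 0} (1 - a q^j)`. -/
noncomputable def qPoch (a q : ℂ) : ℂ := ∏' j : ℕ, (1 - a * q ^ j)

theorem multipliable_qPoch (a q : ℂ) (hq : ‖q‖ < 1) :
    Multipliable fun j : ℕ => 1 - a * q ^ j := by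
  have h : Summable fun j : ℕ => ‖-(a * q ^ j)‖ := by
    simp only [norm_neg, norm_mul, norm_pow]
    exact (summable_geometric_of_lt_one (norm_nonneg q) hq).mul_left _
  simpa [sub_eq_add_neg] using multipliable_one_add_of_summable h

/-! ### `X`-adic bookkeeping for formal power series -/

section FormalTools

variable {R : Type*} [CommRing R]

/-! Let $A$ be the generating function of all the objects counted: $(-q;q)_\infty/(q;q)_\infty$ or
$(-q;q^2)_\infty/(q^2;q^2)_\infty$. Each of the six functions $N(m,n)$ is even in $m$, hence
described by its tails $U_m=\sum_n\sum_{j\ge m}N(j,n)q^n$ with $m\ge1$. Summation by parts turns the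
$2k$-th symmetrized moment into $\sum_{m\ge1}\binom{m+k-1}{2k-1}(U_m+U_{m+1})$
(`HasTails.symMoment_eq`).

The tails satisfy an equation $G_m=q^{em+b}(B-G_{m+d})$, where $G_m=U_m$ for the three cranks and
for the rank of partitions without repeated odd parts, and $G_m=U_m+U_{m+1}$ for the two
overpartition ranks. Iteration gives $G_m=B\sum_{n\ge1}(-1)^{n+1}q^{a(n)+enm}$ with $a$ quadratic
(`eq_mul_altTheta`). Summing over $m$ by $\sum_{m\ge1}\binom{m+k-1}{2k-1}x^m=x^k/(1-x)^{2k}$ at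
$x=q^{en}$ produces the one-sided sums; regrouping produces the two-sided ones.

For the cranks, Euler's expansion of $1/(zq;q)_\infty$ makes the tails explicit, and their equation
is a telescoping sum (`crankTail_eq`, `hasTails_zqCoeff`).

For the ranks, write the rank as a difference `st - nu` and let $F_l(w)$ generate the objects with
`st` at most $l$, with $w$ marking `nu`; it is a finite product. The objects of rank at most $r$
have generating function $y_r=\sum_l[w^{l-r}]F_l$. Comparing $F_{l+1}(w)$ both with $F_l(w)$ and
with $F_l(q^ew)$ gives a recursion that telescopes along these diagonals, so that
$y_r+q^{er+c}y_{r+d}$ does not depend on $r$ apart from initial values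
(`DiagonalRecursion.functional_equation`). For overpartitions this works for $(1+w)F_l$, hence the
sums of two consecutive tails. Positive and negative $r$ yield the same equation for upper and lower
tails, so the symmetry of the ranks needs no bijection.

These identities are proved modulo every $X^N$. The passage to complex $q$ rests on weighted
$\ell^1$ bounds (`hasValue_of_tendsto`) and on rearranging one absolutely convergent double series
(`hasValue_momentSeries`). -/

theorem PowerSeries.eq_zero_of_forall_X_pow_dvd {f : R⟦X⟧}
    (h : ∀ N : ℕ, (PowerSeries.X : R⟦X⟧) ^ N ∣ f) : f = 0 := by
  ext n
  exact PowerSeries.X_pow_dvd_iff.1 (h (n + 1)) n (Nat.lt_succ_self n)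

theorem PowerSeries.X_pow_dvd_sub_iff {f g : R⟦X⟧} {N : ℕ} :
    (PowerSeries.X : R⟦X⟧) ^ N ∣ f - g ↔
      ∀ n < N, PowerSeries.coeff n f = PowerSeries.coeff n g := by
  simp [PowerSeries.X_pow_dvd_iff, sub_eq_zero]

/-- The sum of a family of power series whose `i`-th member is divisible by `X ^ i`. -/
noncomputable def adicSum (g : ℕ → R⟦X⟧) : R⟦X⟧ :=
  PowerSeries.mk fun n => PowerSeries.coeff n (∑ i ∈ Finset.range (n + 1), g i)

theorem X_pow_dvd_adicSum_sub {g : ℕ → R⟦X⟧}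
    (hg : ∀ i, (PowerSeries.X : R⟦X⟧) ^ i ∣ g i) (N : ℕ) :
    (PowerSeries.X : R⟦X⟧) ^ N ∣ adicSum g - ∑ i ∈ Finset.range N, g i := by
  rw [PowerSeries.X_pow_dvd_sub_iff]
  intro n hn
  rw [adicSum, PowerSeries.coeff_mk]
  have h : Finset.range (n + 1) ⊆ Finset.range N := Finset.range_subset_range.2 hn
  rw [map_sum, map_sum]
  refine Finset.sum_subset h fun i _ hi => ?_
  exact PowerSeries.X_pow_dvd_iff.1 (hg i) n (by simpa using hi)

theorem X_pow_dvd_formalQPoch_sub (a b : R⟦X⟧) (hb : PowerSeries.constantCoeff b = 0) (N : ℕ) :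
    (PowerSeries.X : R⟦X⟧) ^ N ∣
      formalQPoch a b - ∏ j ∈ Finset.range N, (1 - a * b ^ j) := by
  rw [PowerSeries.X_pow_dvd_sub_iff]
  intro n hn
  exact (coeff_formalQPoch a b hb hn).symm

theorem map_formalQPoch {S : Type*} [CommRing S] (i : R →+* S) (a b : R⟦X⟧) :
    PowerSeries.map i (formalQPoch a b) =
      formalQPoch (PowerSeries.map i a) (PowerSeries.map i b) := by
  ext n
  simp [formalQPoch, PowerSeries.coeff_map, ← PowerSeries.coeff_map i, map_prod]

end FormalTools

/-! ### Solving the functional equation -/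

section FunctionalEquation

open PowerSeries in
/-- The alternating series `∑_{n ≥ 1} (-1)^(n+1) X^(a n + e n m)`. -/
noncomputable def altTheta (a : ℕ → ℕ) (e m : ℕ) : ℤ⟦X⟧ :=
  PowerSeries.mk fun j => ∑ n ∈ Finset.range j,
    if a (n + 1) + e * (n + 1) * m = j then (-1 : ℤ) ^ n else 0

open PowerSeries in
theorem X_pow_dvd_altTheta_sub (a : ℕ → ℕ) {e m : ℕ} (he : 1 ≤ e) (hm : 1 ≤ m) (N : ℕ) :
    (X : ℤ⟦X⟧) ^ N ∣ altTheta a e m -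
      ∑ n ∈ Finset.range N, (-1) ^ n * X ^ (a (n + 1) + e * (n + 1) * m) := by
  rw [PowerSeries.X_pow_dvd_sub_iff]
  intro j hj
  have hc : ∀ n : ℕ, coeff j ((-1 : ℤ⟦X⟧) ^ n * X ^ (a (n + 1) + e * (n + 1) * m)) =
      if a (n + 1) + e * (n + 1) * m = j then (-1 : ℤ) ^ n else 0 := by
    intro n
    have : ((-1 : ℤ⟦X⟧) ^ n) = C ((-1 : ℤ) ^ n) := by simp
    rw [this, coeff_C_mul, coeff_X_pow]
    simp only [eq_comm (a := j), mul_ite, mul_one, mul_zero]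
  rw [map_sum, Finset.sum_congr rfl fun n _ => hc n, altTheta, coeff_mk]
  -- As $e,m\ge1$, the $n$-th exponent exceeds $n$, so terms with $n\ge j$ cannot reach degree $j$.
  refine Finset.sum_subset (Finset.range_subset_range.2 hj.le) fun n _ hn => if_neg ?_
  have h1 : 1 * (n + 1) * 1 ≤ e * (n + 1) * m := by gcongr
  have h2 : j ≤ n := by simpa using hn
  omega

open PowerSeries in
/-- A sequence with `G m = X^(e m + b) (B - G (m + d))` is `B` times an alternating series. -/
theorem eq_mul_altTheta {e b d : ℕ} (he : 1 ≤ e) {B : ℤ⟦X⟧} {G : ℕ → ℤ⟦X⟧} {a : ℕ → ℕ}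
    (ha1 : a 1 = b) (ha : ∀ n, 1 ≤ n → a (n + 1) = a n + b + e * n * d)
    (hG : ∀ m, 1 ≤ m → G m = X ^ (e * m + b) * (B - G (m + d))) {m : ℕ} (hm : 1 ≤ m) :
    G m = B * altTheta a e m := by
  -- One use of `hG` splits off the first term and replaces $m$ by $m+d$; it gains a factor $X$
  -- since $em+b\ge1$.
  have key : ∀ N m, 1 ≤ m → (X : ℤ⟦X⟧) ^ N ∣ G m -
      B * ∑ n ∈ Finset.range N, (-1) ^ n * X ^ (a (n + 1) + e * (n + 1) * m) := by
    intro N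
    induction N with
    | zero => intro m _; simp
    | succ N ih =>
      intro m hm
      have h1 := ih (m + d) (by omega)
      have h2 : G m - B * ∑ n ∈ Finset.range (N + 1), (-1) ^ n * X ^ (a (n + 1) + e * (n + 1) * m)
          = -(X ^ (e * m + b) * (G (m + d) -
            B * ∑ n ∈ Finset.range N, (-1) ^ n * X ^ (a (n + 1) + e * (n + 1) * (m + d)))) := by
        rw [hG m hm, Finset.sum_range_succ']
        have h3 : ∀ n : ℕ, (-1 : ℤ⟦X⟧) ^ (n + 1) * X ^ (a (n + 1 + 1) + e * (n + 1 + 1) * m) =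
            -(X ^ (e * m + b) * ((-1) ^ n * X ^ (a (n + 1) + e * (n + 1) * (m + d)))) := by
          intro n
          have : a (n + 1 + 1) + e * (n + 1 + 1) * m =
              e * m + b + (a (n + 1) + e * (n + 1) * (m + d)) := by
            rw [ha (n + 1) (by omega)]; ring
          rw [this, pow_add X (e * m + b)]; ring
        rw [Finset.sum_congr rfl fun n _ => h3 n, Finset.sum_neg_distrib, ← Finset.mul_sum]
        have : a (0 + 1) + e * (0 + 1) * m = e * m + b := by rw [zero_add, ha1]; ring
        rw [this]; ring
      rw [h2, dvd_neg]
      have h4 : 1 ≤ e * m + b := by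
        have : 1 * 1 ≤ e * m := by gcongr
        omega
      calc (X : ℤ⟦X⟧) ^ (N + 1) = X ^ 1 * X ^ N := by ring
        _ ∣ _ := mul_dvd_mul (pow_dvd_pow _ h4) h1
  rw [← sub_eq_zero]
  refine PowerSeries.eq_zero_of_forall_X_pow_dvd fun N => ?_
  have h1 := key N m hm
  have h2 := (X_pow_dvd_altTheta_sub a he hm N).mul_left B
  have h3 := dvd_sub h1 h2
  convert h3 using 1
  ring

end FunctionalEquation

/-! ### Telescoping along diagonals -/

section DiagonalSums

open PowerSeries Finset

/-- The two-variable recursion satisfied by the coefficients `φ l s` of a `q`-hypergeometric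
term, in a form which makes its sums over the diagonals `l - s = r` telescope. -/
structure DiagonalRecursion (φ : ℕ → ℤ → ℤ⟦X⟧) (e b d : ℕ) : Prop where
  one_le : 1 ≤ e
  eq_zero : ∀ l s, s < 0 → φ l s = 0
  order : ∀ M : ℕ, ∃ S : ℤ, ∀ s, S ≤ s → ∀ l, (X : ℤ⟦X⟧) ^ M ∣ φ l s
  -- The pair `α`, `β` encodes the monomial $q^{e(l-s)+b}$, whose exponent may be negative; it is
  -- constant on each diagonal.
  step : ∀ (l : ℕ) (s : ℤ) (α β : ℕ), (α : ℤ) - β = e * (l - s) + b →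
    X ^ β * φ l s + X ^ α * (φ (l + 1) (s - d + 1) - X ^ e * φ (l + 1) (s - d)) =
      X ^ β * (φ (l + 1) s - X ^ (e * (l + 1)) * φ (l + 1) (s - 1) + X ^ (e * l) * φ l (s - 2))

/-- `y r` is the sum of `φ l s` over `l - s = r`. -/
def IsDiagonalSum (φ : ℕ → ℤ → ℤ⟦X⟧) (y : ℤ → ℤ⟦X⟧) : Prop :=
  ∀ (r : ℤ) (M : ℕ), ∃ N₀ : ℕ, ∀ N, N₀ ≤ N → (X : ℤ⟦X⟧) ^ M ∣ y r - ∑ l ∈ range N, φ l (l - r)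

variable {φ : ℕ → ℤ → ℤ⟦X⟧} {e b d : ℕ} {y : ℤ → ℤ⟦X⟧} {B : ℤ⟦X⟧}

/-- At $s=l-r$ the terms of `step` lie on the diagonals $r$, $r+1$, $r+d$, $r+d+1$, except for two
on the diagonal $r+2$, which telescope in $l$. The values `φ 0 _` correct for the shift from $l$ to
$l+1$. -/
theorem DiagonalRecursion.partial_sums (h : DiagonalRecursion φ e b d) (r : ℤ) {α β : ℕ}
    (hαβ : (α : ℤ) - β = e * r + b) (N : ℕ) :
    X ^ β * (∑ l ∈ range N, φ l (l - r) - ∑ l ∈ range N, φ l (l - (r + 1)))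
      + X ^ α * ((∑ l ∈ range (N + 1), φ l (l - (r + d)) - φ 0 (-(r + d)))
        - X ^ e * (∑ l ∈ range (N + 1), φ l (l - (r + d + 1)) - φ 0 (-(r + d + 1)))) =
    X ^ β * ((φ N (N - r - 1) - X ^ (e * N) * φ N (N - r - 2))
      - (φ 0 (-(r + 1)) - φ 0 (-(r + 2)))) := by
  induction N with
  | zero =>
    simp only [range_zero, sum_empty, zero_add, sum_range_one, Nat.cast_zero, mul_zero, pow_zero]
    ring_nf
  | succ N ih =>
    have hr := h.step N (N - r) α β (by rw [hαβ]; ring)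
    rw [sum_range_succ _ N, sum_range_succ _ N, sum_range_succ _ (N + 1),
      sum_range_succ _ (N + 1)]
    have e1 : (N : ℤ) - r - d + 1 = ((N + 1 : ℕ) : ℤ) - (r + d) := by push_cast; ring
    have e2 : (N : ℤ) - r - d = ((N + 1 : ℕ) : ℤ) - (r + d + 1) := by push_cast; ring
    have e3 : ((N + 1 : ℕ) : ℤ) - r - 1 = N - r := by push_cast; ring
    have e4 : ((N + 1 : ℕ) : ℤ) - r - 2 = N - r - 1 := by push_cast; ring
    have e5 : (N : ℤ) - (r + 1) = N - r - 1 := by ring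
    rw [e1, e2] at hr
    rw [e3, e4, e5]
    linear_combination ih + hr

/-- Letting $N\to\infty$ in the partial sums, the boundary terms disappear by `order`. What remains
says that, up to initial values, $y_r+q^{er+b}y_{r+d}$ is unchanged when $r$ becomes $r+1$. -/
theorem DiagonalRecursion.sub_succ (h : DiagonalRecursion φ e b d) (hy : IsDiagonalSum φ y)
    (r : ℤ) {α β : ℕ} (hαβ : (α : ℤ) - β = e * r + b) :
    X ^ β * (y r - y (r + 1) + φ 0 (-(r + 1)) - φ 0 (-(r + 2)))
      + X ^ α * ((y (r + d) - φ 0 (-(r + d)))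
        - X ^ e * (y (r + d + 1) - φ 0 (-(r + d + 1)))) = 0 := by
  refine PowerSeries.eq_zero_of_forall_X_pow_dvd fun M => ?_
  obtain ⟨N1, h1⟩ := hy r M
  obtain ⟨N2, h2⟩ := hy (r + 1) M
  obtain ⟨N3, h3⟩ := hy (r + d) M
  obtain ⟨N4, h4⟩ := hy (r + d + 1) M
  obtain ⟨S, hS⟩ := h.order M
  set N := N1 + N2 + N3 + N4 + (S + r + 2).toNat with hN
  have k1 := (h1 N (by omega)).mul_left (X ^ β)
  have k2 := (h2 N (by omega)).mul_left (X ^ β)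
  have k3 := (h3 (N + 1) (by omega)).mul_left (X ^ α)
  have k4 := (h4 (N + 1) (by omega)).mul_left (X ^ α * X ^ e)
  have k5 := (hS (N - r - 1) (by omega) N).mul_left (X ^ β)
  have k6 := (hS (N - r - 2) (by omega) N).mul_left (X ^ β * X ^ (e * N))
  have hp := h.partial_sums r hαβ N
  have := dvd_add (dvd_sub k1 k2) (dvd_add (dvd_sub k3 k4) (dvd_sub k5 k6))
  convert this using 1
  linear_combination hp

/-- The functional equation of the diagonal sums. -/
theorem DiagonalRecursion.functional_equation (h : DiagonalRecursion φ e b d)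
    (hy : IsDiagonalSum φ y) (hB : ∀ r : ℕ, (X : ℤ⟦X⟧) ^ r ∣ y r - B)
    (r : ℤ) {α β : ℕ} (hαβ : (α : ℤ) - β = e * r + b) :
    X ^ β * (y r + φ 0 (-(r + 1))) + X ^ α * (y (r + d) - φ 0 (-(r + d))) = X ^ β * B := by
  have he := h.one_le
  -- The left side may be moved from $r$ to $r+j$. For large $j$ its second summand is divisible by
  -- a high power of $X$ and `y (r + j)` is close to `B`.
  have step : ∀ j : ℕ,
      X ^ β * (y r + φ 0 (-(r + 1))) + X ^ α * (y (r + d) - φ 0 (-(r + d))) =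
      X ^ β * (y (r + j) + φ 0 (-(r + j + 1)))
        + X ^ (α + e * j) * (y (r + j + d) - φ 0 (-(r + j + d))) := by
    intro j
    induction j with
    | zero => simp
    | succ j ih =>
      have hs := h.sub_succ hy (r + j) (α := α + e * j) (β := β) (by push_cast; linarith)
      rw [ih]
      have e1 : r + ((j + 1 : ℕ) : ℤ) = r + j + 1 := by push_cast; ring
      have e2 : r + (j : ℤ) + 1 + d = r + j + d + 1 := by ring
      have e3 : r + (j : ℤ) + 1 + 1 = r + j + 2 := by ring
      have e4 : α + e * (j + 1) = α + e * j + e := by ring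
      rw [e1, e2, e3, e4, pow_add X (α + e * j) e]
      linear_combination hs
  rw [← sub_eq_zero]
  refine PowerSeries.eq_zero_of_forall_X_pow_dvd fun M => ?_
  obtain ⟨n, hn⟩ : ∃ n : ℕ, (n : ℤ) = r + (M + r.natAbs : ℕ) := ⟨(r + (M + r.natAbs : ℕ)).toNat,
    by omega⟩
  rw [step (M + r.natAbs)]
  have hz : φ 0 (-(r + (M + r.natAbs : ℕ) + 1)) = 0 := h.eq_zero _ _ (by omega)
  rw [hz, ← hn, add_zero]
  have k1 : (X : ℤ⟦X⟧) ^ M ∣ X ^ β * (y n - B) :=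
    ((pow_dvd_pow _ (by omega)).trans (hB n)).mul_left _
  have k2 : (X : ℤ⟦X⟧) ^ M ∣ X ^ (α + e * (M + r.natAbs)) := by
    refine pow_dvd_pow _ ?_
    have : 1 * (M + r.natAbs) ≤ e * (M + r.natAbs) := by gcongr
    omega
  have := dvd_add k1 (k2.mul_right (y (n + d) - φ 0 (-(n + d))))
  convert this using 1
  ring

end DiagonalSums

/-! ### Recursions for the three rank products -/

section BivariateSeries

open PowerSeries Finset

/-- The coefficient of `w ^ s`, for an integer exponent `s`. -/
noncomputable def zcoeff {R : Type*} [CommRing R] (F : R⟦X⟧) (s : ℤ) : R :=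
  if 0 ≤ s then coeff s.toNat F else 0

section zcoeff

variable {R : Type*} [CommRing R] (F G : R⟦X⟧) (s : ℤ)

theorem zcoeff_of_neg {s : ℤ} (hs : s < 0) : zcoeff F s = 0 := if_neg (by omega)

theorem zcoeff_natCast (n : ℕ) : zcoeff F n = coeff n F := by simp [zcoeff]

theorem zcoeff_add : zcoeff (F + G) s = zcoeff F s + zcoeff G s := by
  unfold zcoeff; split_ifs <;> simp

theorem zcoeff_sub : zcoeff (F - G) s = zcoeff F s - zcoeff G s := by
  unfold zcoeff; split_ifs <;> simp

theorem zcoeff_C_mul (a : R) : zcoeff (C a * F) s = a * zcoeff F s := by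
  unfold zcoeff; split_ifs <;> simp

theorem zcoeff_X_mul : zcoeff (X * F) s = zcoeff F (s - 1) := by
  unfold zcoeff
  by_cases h : 0 ≤ s - 1
  · obtain ⟨n, hn⟩ : ∃ n : ℕ, s = n + 1 := ⟨(s - 1).toNat, by omega⟩
    subst hn
    have h1 : ((n : ℤ) + 1).toNat = n + 1 := by omega
    have h2 : ((n : ℤ) + 1 - 1).toNat = n := by omega
    rw [if_pos (by omega), if_pos h, h1, h2, coeff_succ_X_mul]
  · rw [if_neg h]
    by_cases h0 : 0 ≤ s
    · obtain rfl : s = 0 := by omega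
      simp
    · rw [if_neg h0]

theorem zcoeff_rescale (a : R) : zcoeff (rescale a F) s = a ^ s.toNat * zcoeff F s := by
  unfold zcoeff; split_ifs <;> simp [coeff_rescale]

end zcoeff

theorem rescale_C {R : Type*} [CommRing R] (Q a : R) : rescale Q (C a) = C a := by
  ext n
  rw [coeff_rescale, coeff_C]
  split_ifs with h <;> simp [h]

/-- The substitution $w\mapsto Qw$ raises the index of each factor `m`, `n` by one, so $F_l(Qw)$ is
$F_{l+1}(w)$ without its factors of index $0$. The `c l` are free of $w$ and do not move, whence `c
l` and not `c 0`. -/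
theorem rescale_mul_eq_of_recurrence {R : Type*} [CommRing R] [IsDomain R] (Q : R)
    (F m n : ℕ → R⟦X⟧) (c : ℕ → R) (h0 : rescale Q (F 0) = F 0)
    (hF : ∀ l, F (l + 1) * (C (c l) * m l) = F l * n l)
    (hm : ∀ l, rescale Q (m l) = m (l + 1)) (hn : ∀ l, rescale Q (n l) = n (l + 1))
    (hc : ∀ l, c l ≠ 0) (hm0 : ∀ l, m l ≠ 0) (l : ℕ) :
    rescale Q (F l) * n 0 = F (l + 1) * (C (c l) * m 0) := by
  induction l with
  | zero => rw [h0, hF]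
  | succ l ih =>
    have h1 := congrArg (rescale Q) (hF l)
    rw [map_mul, map_mul, map_mul, hm, hn, rescale_C] at h1
    have h2 : C (c l) * m (l + 1) ≠ 0 :=
      mul_ne_zero (fun h => hc l (by simpa using congrArg constantCoeff h)) (hm0 _)
    refine mul_right_cancel₀ h2 ?_
    linear_combination (n 0) * h1 + n (l + 1) * ih - C (c l) * m 0 * hF (l + 1)

theorem one_sub_X_mul_C_ne_zero {R : Type*} [CommRing R] [IsDomain R] (a : R) :
    (1 - X * C a : R⟦X⟧) ≠ 0 := by
  intro h
  simpa using congrArg constantCoeff h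

theorem exists_zcoeff_order {F : ℕ → ℤ⟦X⟧⟦X⟧} (hord : ∀ l s, (X : ℤ⟦X⟧) ^ s ∣ coeff s (F l))
    (M : ℕ) {s : ℤ} (hs : (M : ℤ) ≤ s) (l : ℕ) : (X : ℤ⟦X⟧) ^ M ∣ zcoeff (F l) s := by
  obtain ⟨n, rfl⟩ : ∃ n : ℕ, s = n := ⟨s.toNat, by omega⟩
  rw [zcoeff_natCast]
  exact (pow_dvd_pow _ (by exact_mod_cast hs)).trans (hord l n)

variable {F : ℕ → ℤ⟦X⟧⟦X⟧}

/-- `hF` compares $F_{l+1}(w)$ with $F_l(w)$, and `hR` compares it with $F_l(q^2w)$. Take the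
coefficient of $w^s$ in the former and of $w^{s-1}$ in the latter, multiplied by $q^{2(l-s)+3}$: the
terms with $[w^{s-1}]F_l$ then cancel, which fixes the parameters. -/
theorem diagonalRecursion_rank2 (h0 : F 0 = 1)
    (hF : ∀ l, F (l + 1) * (1 - X * C (X ^ (2 * l + 2))) = F l * (1 + X * C (X ^ (2 * l + 1))))
    (hord : ∀ l s, (X : ℤ⟦X⟧) ^ s ∣ coeff s (F l)) :
    DiagonalRecursion (fun l s => zcoeff (F l) s) 2 3 2 := by
  have hR : ∀ l, rescale (X ^ 2 : ℤ⟦X⟧) (F l) * (1 + X * C (X ^ 1)) =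
      F (l + 1) * (1 - X * C (X ^ 2)) := by
    intro l
    have := rescale_mul_eq_of_recurrence (X ^ 2 : ℤ⟦X⟧) F
      (fun l => 1 - X * C (X ^ (2 * l + 2))) (fun l => 1 + X * C (X ^ (2 * l + 1)))
      (fun _ => 1) (by simp [h0]) (by simpa using hF)
      (by intro l; simp only [map_sub, map_one, map_mul, rescale_X, rescale_C, map_pow]; ring)
      (by intro l; simp only [map_add, map_one, map_mul, rescale_X, rescale_C, map_pow]; ring)
      (by simp) (fun l => one_sub_X_mul_C_ne_zero _) l
    simpa using this
  refine ⟨by norm_num, fun l s hs => zcoeff_of_neg _ hs,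
    fun M => ⟨M, fun s hs l => exists_zcoeff_order hord M hs l⟩, fun l s α β hαβ => ?_⟩
  have e1 : F (l + 1) - C (X ^ (2 * l + 2)) * (X * F (l + 1)) =
    F l + C (X ^ (2 * l + 1)) * (X * F l) := by linear_combination hF l
  have e2 : F (l + 1) - C (X ^ 2) * (X * F (l + 1)) = rescale (X ^ 2 : ℤ⟦X⟧) (F l)
    + C (X ^ 1) * (X * rescale (X ^ 2 : ℤ⟦X⟧) (F l)) := by linear_combination - hR l
  have c1 := congrArg (fun G => zcoeff G s) e1
  have c2 := congrArg (fun G => zcoeff G (s - 1)) e2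
  simp only [zcoeff_add, zcoeff_sub, zcoeff_C_mul, zcoeff_X_mul, zcoeff_rescale] at c1 c2
  have e3 : s - ((2 : ℕ) : ℤ) + 1 = s - 1 := by push_cast; ring
  have e4 : s - ((2 : ℕ) : ℤ) = s - 1 - 1 := by push_cast; ring
  have e5 : s - 2 = s - 1 - 1 := by ring
  rw [e3, e4, e5]
  have p1 : X ^ α * ((X ^ 2) ^ (s - 1).toNat * zcoeff (F l) (s - 1)) =
      X ^ β * X ^ (2 * l + 1) * zcoeff (F l) (s - 1) := by
    rcases lt_or_ge (s - 1) 0 with h | h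
    · simp [zcoeff_of_neg _ h]
    · rw [← pow_mul, ← mul_assoc, ← pow_add, ← pow_add]
      congr 2; push_cast at hαβ; omega
  have p2 : X ^ α * (X ^ 1 * ((X ^ 2) ^ (s - 1 - 1).toNat * zcoeff (F l) (s - 1 - 1))) =
      X ^ β * X ^ (2 * l) * zcoeff (F l) (s - 1 - 1) := by
    rcases lt_or_ge (s - 1 - 1) 0 with h | h
    · simp [zcoeff_of_neg _ h]
    · rw [← pow_mul, ← mul_assoc, ← mul_assoc, ← pow_add, ← pow_add, ← pow_add]
      congr 2; push_cast at hαβ; omega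
  have e6 : 2 * (l + 1) = 2 * l + 2 := by ring
  rw [e6]
  linear_combination X ^ α * c2 + p1 + p2 - X ^ β * c1

theorem X_pow_dvd_zcoeff_one_add_X_mul (hord : ∀ l s, (X : ℤ⟦X⟧) ^ s ∣ coeff s (F l)) (M : ℕ)
    {s : ℤ} (hs : (M : ℤ) + 1 ≤ s) (l : ℕ) : (X : ℤ⟦X⟧) ^ M ∣ zcoeff ((1 + X) * F l) s := by
  rw [add_mul, one_mul, zcoeff_add, zcoeff_X_mul]
  exact dvd_add (exists_zcoeff_order hord M (by omega) l)
    (exists_zcoeff_order hord M (by omega) l)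

/-- The relation with $F_l(qw)$ carries the factor $1+wq$. This is the rescaled $1+w$, so it is
absorbed by $\Phi_l=(1+w)F_l$: one gets $(1+w)\Phi_l(qw)=(1-wq)\Phi_{l+1}(w)$, and the terms with
$[w^{s-1}]\Phi_l$ cancel. -/
theorem diagonalRecursion_rankBar (h0 : F 0 = 1)
    (hF : ∀ l, F (l + 1) * (1 - X * C (X ^ (l + 1))) = F l * (1 + X * C (X ^ (l + 1))))
    (hord : ∀ l s, (X : ℤ⟦X⟧) ^ s ∣ coeff s (F l)) :
    DiagonalRecursion (fun l s => zcoeff ((1 + X) * F l) s) 1 2 2 := by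
  have hR : ∀ l, rescale (X : ℤ⟦X⟧) (F l) * (1 + X * C (X ^ 1)) =
      F (l + 1) * (1 - X * C (X ^ 1)) := by
    intro l
    have := rescale_mul_eq_of_recurrence (X : ℤ⟦X⟧) F
      (fun l => 1 - X * C (X ^ (l + 1))) (fun l => 1 + X * C (X ^ (l + 1)))
      (fun _ => 1) (by simp [h0]) (by simpa using hF)
      (by intro l; simp only [map_sub, map_one, map_mul, rescale_X, rescale_C, map_pow]; ring)
      (by intro l; simp only [map_add, map_one, map_mul, rescale_X, rescale_C, map_pow]; ring)
      (by simp) (fun l => one_sub_X_mul_C_ne_zero _) l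
    simpa using this
  refine ⟨le_rfl, fun l s hs => zcoeff_of_neg _ hs,
    fun M => ⟨M + 1, fun s hs l => X_pow_dvd_zcoeff_one_add_X_mul hord M hs l⟩,
    fun l s α β hαβ => ?_⟩
  have hresc : rescale (X : ℤ⟦X⟧) ((1 + X) * F l) = (1 + X * C (X ^ 1)) * rescale X (F l) := by
    simp only [map_mul, map_add, map_one, rescale_X, pow_one]; ring
  have e1 : (1 + X) * F (l + 1) - C (X ^ (l + 1)) * (X * ((1 + X) * F (l + 1))) =
    (1 + X) * F l + C (X ^ (l + 1)) * (X * ((1 + X) * F l)) := by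
    linear_combination (1 + X) * hF l
  have e2 : (1 + X) * F (l + 1) - C (X ^ 1) * (X * ((1 + X) * F (l + 1))) =
    rescale (X : ℤ⟦X⟧) ((1 + X) * F l) + X * rescale (X : ℤ⟦X⟧) ((1 + X) * F l) := by
    rw [hresc]; linear_combination - (1 + X) * hR l
  generalize (1 + X) * F l = Φ at *
  generalize (1 + X) * F (l + 1) = Φ' at *
  have c1 := congrArg (fun G => zcoeff G s) e1
  have c2 := congrArg (fun G => zcoeff G (s - 1)) e2
  simp only [zcoeff_add, zcoeff_sub, zcoeff_C_mul, zcoeff_X_mul, zcoeff_rescale] at c1 c2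
  have e3 : s - ((2 : ℕ) : ℤ) + 1 = s - 1 := by push_cast; ring
  have e4 : s - ((2 : ℕ) : ℤ) = s - 1 - 1 := by push_cast; ring
  have e5 : s - 2 = s - 1 - 1 := by ring
  rw [e3, e4, e5]
  have p1 : X ^ α * (X ^ (s - 1).toNat * zcoeff Φ (s - 1)) =
      X ^ β * X ^ (l + 1) * zcoeff Φ (s - 1) := by
    rcases lt_or_ge (s - 1) 0 with h | h
    · simp [zcoeff_of_neg _ h]
    · rw [← mul_assoc, ← pow_add, ← pow_add]
      congr 2; push_cast at hαβ; omega
  have p2 : X ^ α * (X ^ (s - 1 - 1).toNat * zcoeff Φ (s - 1 - 1)) =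
      X ^ β * X ^ l * zcoeff Φ (s - 1 - 1) := by
    rcases lt_or_ge (s - 1 - 1) 0 with h | h
    · simp [zcoeff_of_neg _ h]
    · rw [← mul_assoc, ← pow_add, ← pow_add]
      congr 2; push_cast at hαβ; omega
  rw [one_mul, one_mul]
  linear_combination X ^ α * c2 + p1 + p2 - X ^ β * c1

theorem diagonalRecursion_rank2Bar {u : ℤ⟦X⟧} (h0 : F 0 = C u)
    (hF : ∀ l, F (l + 1) * (C (1 - X ^ (2 * l + 3)) * (1 - X * C (X ^ (2 * l + 2)))) =
      F l * ((1 + X * C (X ^ (2 * l + 1))) * (1 + X * C (X ^ (2 * l + 2)))))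
    (hord : ∀ l s, (X : ℤ⟦X⟧) ^ s ∣ coeff s (F l)) :
    DiagonalRecursion (fun l s => zcoeff ((1 + X) * F l) s) 2 3 1 := by
  have hc : ∀ l : ℕ, (1 - X ^ (2 * l + 3) : ℤ⟦X⟧) ≠ 0 := by
    intro l h
    simpa using congrArg constantCoeff h
  have hR : ∀ l, rescale (X ^ 2 : ℤ⟦X⟧) (F l) * ((1 + X * C (X ^ 1)) * (1 + X * C (X ^ 2))) =
      F (l + 1) * (C (1 - X ^ (2 * l + 3)) * (1 - X * C (X ^ 2))) := by
    intro l
    exact rescale_mul_eq_of_recurrence (X ^ 2 : ℤ⟦X⟧) F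
      (fun l => 1 - X * C (X ^ (2 * l + 2)))
      (fun l => (1 + X * C (X ^ (2 * l + 1))) * (1 + X * C (X ^ (2 * l + 2))))
      (fun l => 1 - X ^ (2 * l + 3)) (by rw [h0, rescale_C]) hF
      (by intro l; simp only [map_sub, map_one, map_mul, rescale_X, rescale_C, map_pow]; ring)
      (by intro l; simp only [map_add, map_one, map_mul, rescale_X, rescale_C, map_pow]; ring)
      hc (fun l => one_sub_X_mul_C_ne_zero _) l
  refine ⟨by norm_num, fun l s hs => zcoeff_of_neg _ hs,
    fun M => ⟨M + 1, fun s hs l => X_pow_dvd_zcoeff_one_add_X_mul hord M hs l⟩,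
    fun l s α β hαβ => ?_⟩
  have hresc : rescale (X ^ 2 : ℤ⟦X⟧) ((1 + X) * F l) =
      (1 + X * C (X ^ 2)) * rescale (X ^ 2) (F l) := by
    simp only [map_mul, map_add, map_one, rescale_X, map_pow]; ring
  have e1 : C (1 - X ^ (2 * l + 3)) * ((1 + X) * F (l + 1))
      - C ((1 - X ^ (2 * l + 3)) * X ^ (2 * l + 2)) * (X * ((1 + X) * F (l + 1))) =
      (1 + X) * F l + C (X ^ (2 * l + 1) + X ^ (2 * l + 2)) * (X * ((1 + X) * F l))
      + C (X ^ (4 * l + 3)) * (X * (X * ((1 + X) * F l))) := by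
    have h4 : (X : ℤ⟦X⟧) ^ (4 * l + 3) = X ^ (2 * l + 1) * X ^ (2 * l + 2) := by
      rw [← pow_add]; congr 1; ring
    have := hF l
    rw [h4]
    simp only [map_mul, map_add] at this ⊢
    linear_combination (1 + X) * this
  have e2 : C (1 - X ^ (2 * l + 3)) * ((1 + X) * F (l + 1))
      - C ((1 - X ^ (2 * l + 3)) * X ^ 2) * (X * ((1 + X) * F (l + 1))) =
      rescale (X ^ 2 : ℤ⟦X⟧) ((1 + X) * F l)
      + C (1 + X ^ 1) * (X * rescale (X ^ 2 : ℤ⟦X⟧) ((1 + X) * F l))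
      + C (X ^ 1) * (X * (X * rescale (X ^ 2 : ℤ⟦X⟧) ((1 + X) * F l))) := by
    have := hR l
    rw [hresc]
    simp only [map_mul, map_add, map_one] at this ⊢
    linear_combination - (1 + X) * this
  generalize (1 + X) * F l = Φ at *
  generalize (1 + X) * F (l + 1) = Φ' at *
  have c1 := congrArg (fun G => zcoeff G s) e1
  have c2 := congrArg (fun G => zcoeff G s) e2
  simp only [zcoeff_add, zcoeff_sub, zcoeff_C_mul, zcoeff_X_mul, zcoeff_rescale] at c1 c2
  have e3 : s - ((1 : ℕ) : ℤ) + 1 = s := by push_cast; ring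
  have e4 : s - ((1 : ℕ) : ℤ) = s - 1 := by push_cast; ring
  have e5 : s - 2 = s - 1 - 1 := by ring
  rw [e3, e4, e5]
  have p0 : X ^ α * ((X ^ 2) ^ s.toNat * zcoeff Φ s) =
      X ^ β * X ^ (2 * l + 3) * zcoeff Φ s := by
    rcases lt_or_ge s 0 with h | h
    · simp [zcoeff_of_neg _ h]
    · rw [← pow_mul, ← mul_assoc, ← pow_add, ← pow_add]
      congr 2; push_cast at hαβ; omega
  have p1 : X ^ α * ((X ^ 2) ^ (s - 1).toNat * zcoeff Φ (s - 1)) =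
      X ^ β * X ^ (2 * l + 1) * zcoeff Φ (s - 1) := by
    rcases lt_or_ge (s - 1) 0 with h | h
    · simp [zcoeff_of_neg _ h]
    · rw [← pow_mul, ← mul_assoc, ← pow_add, ← pow_add]
      congr 2; push_cast at hαβ; omega
  have p2 : X ^ α * (X ^ 1 * ((X ^ 2) ^ (s - 1 - 1).toNat * zcoeff Φ (s - 1 - 1))) =
      X ^ β * X ^ (2 * l) * zcoeff Φ (s - 1 - 1) := by
    rcases lt_or_ge (s - 1 - 1) 0 with h | h
    · simp [zcoeff_of_neg _ h]
    · rw [← pow_mul, ← mul_assoc, ← mul_assoc, ← pow_add, ← pow_add, ← pow_add]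
      congr 2; push_cast at hαβ; omega
  have e6 : 2 * (l + 1) = 2 * l + 2 := by ring
  rw [e6]
  -- Both relations determine $\Phi_{l+1}$ only up to the factor $1-q^{2l+3}$, so the recursion is
  -- checked after multiplication by it. Here both are read at $w^s$, which accounts for $d=1$.
  refine mul_left_cancel₀ (hc l) ?_
  have q1 : (X : ℤ⟦X⟧) ^ (2 * l + 2) = X ^ (2 * l + 1) * X ^ 1 := by rw [← pow_add]
  have q2 : (X : ℤ⟦X⟧) ^ (4 * l + 3) = X ^ (2 * l) * X ^ (2 * l + 3) := by
    rw [← pow_add]; congr 1; ring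
  rw [q2] at c1
  linear_combination (norm := (ring_nf)) X ^ α * c2 + p0 + (1 + X ^ 1) * p1 + p2 - X ^ β * c1

end BivariateSeries

/-! ### Product formulas for weighted partitions -/

section GeneratingFunctions

open PowerSeries Finset Nat.Partition

open scoped PowerSeries.WithPiTopology in
-- With $x=X^{i+1}$ this is the geometric series $1+ax/(1-vx)=(1+(a-v)x)/(1-vx)$.
theorem genFun_factor_mul {R : Type*} [CommRing R] [TopologicalSpace R] [DiscreteTopology R]
    (a v : R) (i : ℕ) :
    (1 + ∑' j : ℕ, (a * v ^ j) • (X : R⟦X⟧) ^ ((i + 1) * (j + 1))) * (1 - C v * X ^ (i + 1)) =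
      1 + C (a - v) * X ^ (i + 1) := by
  have h1 : ∀ j : ℕ, (a * v ^ j) • (X : R⟦X⟧) ^ ((i + 1) * (j + 1)) =
      C a * X ^ (i + 1) * (C v * X ^ (i + 1)) ^ j := by
    intro j
    rw [smul_eq_C_mul, map_mul, map_pow, pow_mul]; ring
  have hz : constantCoeff (C v * X ^ (i + 1) : R⟦X⟧) = 0 := by simp
  have hs := WithPiTopology.summable_pow_of_constantCoeff_eq_zero hz
  have hm := WithPiTopology.tsum_pow_mul_one_sub_of_constantCoeff_eq_zero hz
  simp_rw [h1]
  rw [hs.tsum_mul_left, map_sub]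
  linear_combination C a * X ^ (i + 1) * hm

open scoped PowerSeries.WithPiTopology in
/-- The generating function of partitions with parts at most `l`, where the part `i` with
multiplicity `c` has weight `a i * v i ^ (c - 1)`. -/
theorem genFun_mul_prod {R : Type*} [CommRing R] (a v : ℕ → R) (l : ℕ)
    (ha : ∀ i, l < i → a i = 0) :
    genFun (fun i c => a i * v i ^ (c - 1)) * ∏ i ∈ range l, (1 - C (v (i + 1)) * X ^ (i + 1)) =
      ∏ i ∈ range l, (1 + C (a (i + 1) - v (i + 1)) * X ^ (i + 1)) := by
  let _ : TopologicalSpace R := ⊥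
  have : DiscreteTopology R := ⟨rfl⟩
  rw [genFun_eq_tprod, tprod_eq_prod (s := range l), ← prod_mul_distrib]
  · refine prod_congr rfl fun i _ => ?_
    simpa using genFun_factor_mul (a (i + 1)) (v (i + 1)) i
  · intro i hi
    have : a (i + 1) = 0 := ha _ (by simpa [Nat.lt_succ_iff] using hi)
    simp [this]

/-- Exchange of the two variables of a double power series. -/
noncomputable def seriesSwap {R : Type*} [CommRing R] : R⟦X⟧⟦X⟧ →+* R⟦X⟧⟦X⟧ where
  toFun F := PowerSeries.mk fun s => PowerSeries.mk fun n => coeff s (coeff n F)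
  map_one' := by
    ext s n
    simp only [coeff_mk, coeff_one]
    by_cases h : n = 0 <;> by_cases h' : s = 0 <;> simp [h, h', coeff_one]
  map_zero' := by ext; simp
  map_add' F G := by ext; simp
  map_mul' F G := by
    ext s n
    simp only [coeff_mk, coeff_mul, map_sum]
    exact sum_comm

theorem coeff_coeff_seriesSwap {R : Type*} [CommRing R] (F : R⟦X⟧⟦X⟧) (s n : ℕ) :
    coeff n (coeff s (seriesSwap F)) = coeff s (coeff n F) := by
  simp [seriesSwap]

theorem seriesSwap_X {R : Type*} [CommRing R] : seriesSwap (X : R⟦X⟧⟦X⟧) = C X := by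
  ext s n
  rw [coeff_coeff_seriesSwap, coeff_X, coeff_C]
  by_cases h : n = 1 <;> by_cases h' : s = 0 <;> simp [h, h', coeff_one, coeff_X]

theorem seriesSwap_C_X {R : Type*} [CommRing R] : seriesSwap (C X : R⟦X⟧⟦X⟧) = X := by
  ext s n
  rw [coeff_coeff_seriesSwap, coeff_X, coeff_C]
  by_cases h : n = 0 <;> by_cases h' : s = 1 <;> simp [h, h', coeff_one, coeff_X]

end GeneratingFunctions

/-! ### Distribution of a difference of two statistics -/

section RankedFamilies

open PowerSeries Finset

variable {Ob : ℕ → Type} [∀ n, Fintype (Ob n)] (st nu : ∀ n, Ob n → ℕ)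

/-- The generating function, in `q` with coefficients in `ℤ[w]`, of the objects with
`st ≤ l`, where the exponent of `w` is `nu`. -/
noncomputable def boundedGF (l : ℕ) : ℤ⟦X⟧⟦X⟧ :=
  PowerSeries.mk fun s => PowerSeries.mk fun n =>
    ∑ π : Ob n, if st n π ≤ l ∧ nu n π = s then 1 else 0

/-- The generating function of the objects of rank `st - nu` at most `r`. -/
noncomputable def rankLeGF (r : ℤ) : ℤ⟦X⟧ :=
  PowerSeries.mk fun n => ∑ π : Ob n, if (st n π : ℤ) - nu n π ≤ r then 1 else 0

variable (Ob) in
/-- The generating function of all objects. -/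
noncomputable def totalGF : ℤ⟦X⟧ := PowerSeries.mk fun n => (Fintype.card (Ob n) : ℤ)

variable {st nu}

theorem X_pow_dvd_coeff_boundedGF (hnu : ∀ n π, nu n π ≤ n) (l s : ℕ) :
    (X : ℤ⟦X⟧) ^ s ∣ coeff s (boundedGF st nu l) := by
  rw [X_pow_dvd_iff]
  intro n hn
  simp only [boundedGF, coeff_mk]
  refine sum_eq_zero fun π _ => if_neg ?_
  have := hnu n π
  omega

theorem X_pow_dvd_rankLeGF_sub_totalGF (hst : ∀ n π, st n π ≤ n) (r : ℕ) :
    (X : ℤ⟦X⟧) ^ (r + 1) ∣ rankLeGF st nu r - totalGF Ob := by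
  rw [X_pow_dvd_sub_iff]
  intro n hn
  simp only [rankLeGF, totalGF, coeff_mk]
  rw [sum_congr rfl fun π _ => if_pos (by have := hst n π; omega)]
  simp

/-- An object with `nu = s` contributes to $[w^{l-r}]F_l$ only when $l=s+r$, and then the condition
`st ≤ l` says that its rank is at most $r$. -/
theorem isDiagonalSum_rankLeGF (hnu : ∀ n π, nu n π ≤ n) :
    IsDiagonalSum (fun l s => zcoeff (boundedGF st nu l) s) (rankLeGF st nu) := by
  intro r M
  refine ⟨(M + r).toNat, fun N hN => ?_⟩
  rw [X_pow_dvd_sub_iff]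
  intro n hn
  have hz : ∀ l : ℕ, coeff n (zcoeff (boundedGF st nu l) (l - r)) =
      ∑ π : Ob n, if (st n π : ℤ) ≤ l ∧ (nu n π : ℤ) = l - r then 1 else 0 := by
    intro l
    unfold zcoeff
    split_ifs with h
    · simp only [boundedGF, coeff_mk]
      refine sum_congr rfl fun π _ => if_congr ?_ rfl rfl
      omega
    · rw [map_zero, sum_eq_zero]
      intro π _
      rw [if_neg]
      omega
  rw [map_sum, sum_congr rfl fun l _ => hz l, sum_comm, rankLeGF, coeff_mk]
  refine sum_congr rfl fun π _ => ?_
  have := hnu n π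
  by_cases h : (st n π : ℤ) - nu n π ≤ r
  · rw [if_pos h, sum_eq_single_of_mem ((nu n π + r).toNat) (by rw [mem_range]; omega), if_pos]
    · omega
    · intro b _ hb
      rw [if_neg]
      omega
  · rw [if_neg h, sum_eq_zero]
    intro l _
    rw [if_neg]
    omega

/-- Multiplication by $w$ moves the diagonal $r$ to the diagonal $r+1$. -/
theorem isDiagonalSum_one_add_X_mul_rankLeGF (hnu : ∀ n π, nu n π ≤ n) :
    IsDiagonalSum (fun l s => zcoeff ((1 + X) * boundedGF st nu l) s)
      (fun r => rankLeGF st nu r + rankLeGF st nu (r + 1)) := by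
  intro r M
  obtain ⟨N1, h1⟩ := isDiagonalSum_rankLeGF (st := st) hnu r M
  obtain ⟨N2, h2⟩ := isDiagonalSum_rankLeGF (st := st) hnu (r + 1) M
  refine ⟨N1 + N2, fun N hN => ?_⟩
  have := dvd_add (h1 N (by omega)) (h2 N (by omega))
  convert this using 1
  have h3 : ∀ l : ℕ, zcoeff ((1 + X) * boundedGF st nu l) (l - r) =
      zcoeff (boundedGF st nu l) (l - r) + zcoeff (boundedGF st nu l) (l - (r + 1)) := by
    intro l
    rw [add_mul, one_mul, zcoeff_add, zcoeff_X_mul]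
    congr 2
    ring
  simp only [h3, sum_add_distrib]
  ring

theorem natCard_rank_eq (m : ℤ) (n : ℕ) :
    (Nat.card {π : Ob n // (st n π : ℤ) - nu n π = m} : ℤ) =
      coeff n (rankLeGF st nu m) - coeff n (rankLeGF st nu (m - 1)) := by
  rw [Nat.card_eq_fintype_card, Fintype.card_subtype, rankLeGF, rankLeGF, coeff_mk, coeff_mk,
    ← sum_sub_distrib, card_filter, Nat.cast_sum]
  refine sum_congr rfl fun π _ => ?_
  push_cast
  split_ifs <;> omega

/-- `genFun` gives series in $q$ over $\mathbb Z[[w]]$, while rescaling $w$ and extracting its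
coefficients require $w$ as the outer variable. -/
theorem boundedGF_eq_seriesSwap {G : ℤ⟦X⟧⟦X⟧} {l : ℕ}
    (hG : ∀ n, coeff n G = ∑ π : Ob n, if st n π ≤ l then (X : ℤ⟦X⟧) ^ nu n π else 0) :
    boundedGF st nu l = seriesSwap G := by
  ext s n
  rw [coeff_coeff_seriesSwap, hG, map_sum, boundedGF, coeff_mk, coeff_mk]
  refine sum_congr rfl fun π _ => ?_
  by_cases h : st n π ≤ l <;> simp [h, coeff_X_pow, eq_comm]

theorem rankLeGF_eq_zero {r : ℤ} (hnu : ∀ n π, nu n π ≤ n) {n : ℕ} (hr : r + n < 0) :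
    coeff n (rankLeGF st nu r) = 0 := by
  rw [rankLeGF, coeff_mk]
  refine sum_eq_zero fun π _ => if_neg ?_
  have := hnu n π
  omega

end RankedFamilies

/-! ### Rank statistics of overpartitions and restricted partitions -/

section OverpartitionSums

open PowerSeries Finset Nat.Partition

noncomputable instance Overpartition.instFintype (n : ℕ) : Fintype (Overpartition n) :=
  Fintype.ofFinite _

noncomputable instance OddDistinctPartition.instFintype (n : ℕ) :
    Fintype (OddDistinctPartition n) :=
  Fintype.ofFinite _

theorem prod_toFinsupp {R : Type*} [CommRing R] (s : Multiset ℕ) (f : ℕ → ℕ → R) :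
    s.toFinsupp.prod f = ∏ i ∈ s.toFinset, f i (s.count i) := by
  rw [Finsupp.prod, Multiset.toFinsupp_support]
  rfl

/-- Expanding the product of `g + h` over the distinct part sizes amounts to choosing which of them
are overlined. -/
theorem sum_overpartition {R : Type*} [CommRing R] (n : ℕ) (g h : ℕ → ℕ → R) :
    ∑ π : Overpartition n, ∏ i ∈ π.toPartition.parts.toFinset,
      (if i ∈ π.overlined then g i (π.toPartition.parts.count i)
        else h i (π.toPartition.parts.count i)) =
    coeff n (genFun fun i c => g i c + h i c) := by
  classical
  rw [coeff_genFun]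
  have h1 : ∀ p : n.Partition, (p.parts.toFinsupp.prod fun i c => g i c + h i c) =
      ∑ S : {S // S ∈ p.parts.toFinset.powerset}, ∏ i ∈ p.parts.toFinset,
        (if i ∈ S.1 then g i (p.parts.count i) else h i (p.parts.count i)) := by
    intro p
    rw [prod_toFinsupp, prod_add, ← sum_coe_sort]
    refine sum_congr rfl fun S _ => ?_
    have hS : S.1 ⊆ p.parts.toFinset := mem_powerset.1 S.2
    rw [prod_ite, filter_mem_eq_inter, inter_eq_right.2 hS]
    congr 1
    refine prod_congr ?_ fun _ _ => rfl
    ext; simp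
  rw [sum_congr rfl fun p _ => h1 p, ← Fintype.sum_sigma (fun x : (p : n.Partition) ×
    {S // S ∈ p.parts.toFinset.powerset} => ∏ i ∈ x.1.parts.toFinset,
      (if i ∈ x.2.1 then g i (x.1.parts.count i) else h i (x.1.parts.count i)))]
  let e : Overpartition n ≃ (p : n.Partition) × {S // S ∈ p.parts.toFinset.powerset} :=
    { toFun := fun π => ⟨π.toPartition, π.overlined, mem_powerset.2 π.overlined_subset⟩
      invFun := fun x => ⟨x.1, x.2.1, mem_powerset.1 x.2.2⟩
      left_inv := fun _ => rfl
      right_inv := fun _ => rfl }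
  exact Fintype.sum_equiv e _ _ fun π => rfl

theorem genFun_congr {R : Type*} [CommRing R] {f g : ℕ → ℕ → R}
    (h : ∀ i c, c ≠ 0 → f i c = g i c) : genFun f = genFun g := by
  ext n
  rw [coeff_genFun, coeff_genFun]
  exact sum_congr rfl fun p _ => Finsupp.prod_congr fun i hi => h _ _ (by simpa using hi)

theorem largestPart_le_iff {n l : ℕ} (p : n.Partition) :
    largestPart p ≤ l ↔ ∀ i ∈ p.parts.toFinset, i ≤ l := by
  simp [largestPart, Multiset.sup_le]

theorem largestPart_le {n : ℕ} (p : n.Partition) : largestPart p ≤ n :=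
  Multiset.sup_le.2 fun _ hi => p.le_of_mem_parts hi

theorem card_parts_le {n : ℕ} (p : n.Partition) : p.parts.card ≤ n := by
  have h := Multiset.card_nsmul_le_sum (s := p.parts) (a := 1) fun x hx => p.parts_pos hx
  rw [p.parts_sum] at h
  simpa using h

theorem largestPart_mem {n : ℕ} (p : n.Partition) (h : largestPart p ≠ 0) :
    largestPart p ∈ p.parts := by
  have hne : p.parts ≠ 0 := by
    intro h0
    simp [largestPart, h0] at h
  obtain ⟨x, hx⟩ := Multiset.exists_max_image id hne
  have : largestPart p = x :=
    le_antisymm (Multiset.sup_le.2 hx.2) (Multiset.le_sup hx.1)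
  rw [this]
  exact hx.1

theorem prod_pow_count_toFinset {R : Type*} [CommRing R] (w : R) (s : Multiset ℕ) :
    ∏ i ∈ s.toFinset, w ^ s.count i = w ^ s.card := by
  rw [prod_pow_eq_pow_sum, Multiset.toFinset_sum_count_eq]

/-! #### Overpartitions by largest part and number of parts -/

/-- The generating function of the overpartitions with largest part at most `l`, the exponent of
`w` being the number of parts. -/
noncomputable def overGen {R : Type*} [CommRing R] (w : R) (l : ℕ) : R⟦X⟧ :=
  genFun fun i c => (if i ≤ l then 2 * w else 0) * w ^ (c - 1)

theorem coeff_overGen {R : Type*} [CommRing R] (w : R) (l n : ℕ) :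
    coeff n (overGen w l) = ∑ π : Overpartition n,
      if largestPart π.toPartition ≤ l then w ^ π.toPartition.parts.card else 0 := by
  rw [overGen, genFun_congr (g := fun i c => (if i ≤ l then w ^ c else 0) +
    (if i ≤ l then w ^ c else 0)), ← sum_overpartition]
  · refine sum_congr rfl fun π _ => ?_
    simp only [ite_self]
    rw [prod_ite_zero, prod_pow_count_toFinset]
    exact if_congr (largestPart_le_iff _).symm rfl rfl
  · intro i c hc
    obtain ⟨c, rfl⟩ := Nat.exists_eq_succ_of_ne_zero hc
    split_ifs
    · rw [Nat.succ_sub_one, pow_succ]; ring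
    · simp

theorem overGen_mul {R : Type*} [CommRing R] (w : R) (l : ℕ) :
    overGen w l * ∏ i ∈ range l, (1 - C w * X ^ (i + 1)) =
      ∏ i ∈ range l, (1 + C w * X ^ (i + 1)) := by
  have := genFun_mul_prod (fun i => if i ≤ l then 2 * w else 0) (fun _ => w) l
    (fun i hi => if_neg (by omega))
  rw [overGen, this]
  refine prod_congr rfl fun i hi => ?_
  rw [if_pos (by simpa [Nat.succ_le_iff] using hi)]
  congr 3
  ring

/-! #### Partitions without repeated odd parts -/

theorem prod_range_two_mul {M : Type*} [CommMonoid M] (f : ℕ → M) (l : ℕ) :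
    ∏ i ∈ range (2 * l), f i = ∏ j ∈ range l, (f (2 * j) * f (2 * j + 1)) := by
  induction l with
  | zero => simp
  | succ l ih => rw [mul_add, prod_range_succ, prod_range_succ, ih, prod_range_succ, mul_assoc]

/-- The generating function of the partitions without repeated odd parts with largest part at most
`2 l`, the exponent of `w` being the number of parts. -/
noncomputable def oddDistinctGen {R : Type*} [CommRing R] (w : R) (l : ℕ) : R⟦X⟧ :=
  -- For odd `i` the second factor is $0^{c-1}$, which by $0^0=1$ allows multiplicity $1$ only.
  genFun fun i c => (if i ≤ 2 * l then w else 0) * (if Even i then w else 0) ^ (c - 1)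

theorem coeff_oddDistinctGen {R : Type*} [CommRing R] (w : R) (l n : ℕ) :
    coeff n (oddDistinctGen w l) = ∑ π : OddDistinctPartition n,
      if (largestPart π.1 + 1) / 2 ≤ l then w ^ π.1.parts.card else 0 := by
  classical
  rw [oddDistinctGen, genFun_congr (g := fun i c =>
    if i ≤ 2 * l ∧ (Odd i → c = 1) then w ^ c else 0), coeff_genFun]
  · have h1 : ∀ p : n.Partition, (p.parts.toFinsupp.prod fun i c =>
        if i ≤ 2 * l ∧ (Odd i → c = 1) then w ^ c else 0) =
        if ∀ i ∈ p.parts, Odd i → p.parts.count i = 1 then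
          (if (largestPart p + 1) / 2 ≤ l then w ^ p.parts.card else 0) else 0 := by
      intro p
      rw [prod_toFinsupp, prod_ite_zero, prod_pow_count_toFinset, ← ite_and]
      refine if_congr ?_ rfl rfl
      have : (largestPart p + 1) / 2 ≤ l ↔ largestPart p ≤ 2 * l := by omega
      rw [this, largestPart_le_iff]
      simp only [Multiset.mem_toFinset, forall_and]
      tauto
    rw [sum_congr rfl fun p _ => h1 p, ← sum_filter]
    refine sum_subtype _ (p := fun p : n.Partition =>
      ∀ i ∈ p.parts, Odd i → p.parts.count i = 1) ?_ _
    simp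
  · intro i c hc
    obtain ⟨c, rfl⟩ := Nat.exists_eq_succ_of_ne_zero hc
    by_cases h : i ≤ 2 * l
    · rcases Nat.even_or_odd i with he | ho
      · have : ¬ Odd i := Nat.not_odd_iff_even.2 he
        simp [h, he, this, pow_succ']
      · have : ¬ Even i := Nat.not_even_iff_odd.2 ho
        by_cases hc0 : c = 0 <;> simp [h, this, ho, hc0]
    · simp [h]

theorem oddDistinctGen_mul {R : Type*} [CommRing R] (w : R) (l : ℕ) :
    oddDistinctGen w l * ∏ j ∈ range l, (1 - C w * X ^ (2 * j + 2)) =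
      ∏ j ∈ range l, (1 + C w * X ^ (2 * j + 1)) := by
  have := genFun_mul_prod (fun i => if i ≤ 2 * l then w else 0) (fun i => if Even i then w else 0)
    (2 * l) (fun i hi => if_neg (by omega))
  rw [prod_range_two_mul, prod_range_two_mul] at this
  have h1 : ∀ j, ¬ Even (2 * j + 1) := fun j => by simp
  have h2 : ∀ j, Even (2 * j + 1 + 1) := fun j => ⟨j + 1, by ring⟩
  simp only [h1, h2, if_true, if_false, map_zero, zero_mul, sub_zero, one_mul] at this
  rw [oddDistinctGen, this]
  refine prod_congr rfl fun i hi => ?_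
  have hi := mem_range.1 hi
  rw [if_pos (by omega), if_pos (by omega)]
  simp

/-! #### Overpartitions by the statistics of the `M₂`-rank -/

/-- `⌈l(π)/2⌉ - χ(π)`. -/
def Overpartition.halfLargest {n : ℕ} (π : Overpartition n) : ℕ :=
  if Odd (largestPart π.toPartition) ∧ largestPart π.toPartition ∉ π.overlined
  then largestPart π.toPartition / 2 else (largestPart π.toPartition + 1) / 2

/-- The number of parts which are even or overlined. -/
def Overpartition.evenOrOverlined {n : ℕ} (π : Overpartition n) : ℕ :=
  ∑ i ∈ π.toPartition.parts.toFinset,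
    if Even i then π.toPartition.parts.count i else if i ∈ π.overlined then 1 else 0

/-- The part size $2l+1$ is tolerated exactly when it is not overlined: there $\chi$ lowers $\lceil
l(\pi)/2\rceil=l+1$ to $l$. -/
theorem Overpartition.halfLargest_le_iff {n l : ℕ} (π : Overpartition n) :
    π.halfLargest ≤ l ↔ ∀ i ∈ π.toPartition.parts.toFinset,
      i ≤ 2 * l ∨ (i = 2 * l + 1 ∧ i ∉ π.overlined) := by
  have hle := fun l => largestPart_le_iff (l := l) π.toPartition
  have hmem : largestPart π.toPartition ≠ 0 →
      largestPart π.toPartition ∈ π.toPartition.parts.toFinset :=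
    fun h => Multiset.mem_toFinset.2 (largestPart_mem _ h)
  have hself := (hle _).1 le_rfl
  unfold Overpartition.halfLargest
  generalize largestPart π.toPartition = L at *
  constructor
  · intro h i hi
    have hiL := hself i hi
    split_ifs at h with hc
    · by_cases hL : i = L
      · subst hL
        by_cases h2 : i ≤ 2 * l
        · exact Or.inl h2
        · exact Or.inr ⟨by omega, hc.2⟩
      · left; omega
    · left; omega
  · intro h
    by_cases h0 : L = 0
    · subst h0; simp
    rcases h L (hmem h0) with h1 | h1
    · split_ifs <;> omega
    · rw [if_pos ⟨⟨l, h1.1⟩, h1.2⟩]; omega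

theorem Overpartition.evenOrOverlined_add_oddNonOverlined {n : ℕ} (π : Overpartition n) :
    π.evenOrOverlined + π.oddNonOverlined = π.toPartition.parts.card := by
  have hsub : π.overlined.val ≤ π.toPartition.parts := by
    rw [Multiset.le_iff_subset π.overlined.nodup]
    intro x hx
    exact Multiset.mem_toFinset.1 (π.overlined_subset hx)
  set s := π.toPartition.parts with hs
  have h1 : s.countP (fun i => Odd i) = ∑ i ∈ s.toFinset, if Odd i then s.count i else 0 := by
    rw [Multiset.countP_eq_card_filter, ← Multiset.sum_count_eq_card (s := s.toFinset)]
    · exact sum_congr rfl fun i _ => Multiset.count_filter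
    · intro a ha
      exact Multiset.mem_toFinset.2 (Multiset.mem_of_mem_filter ha)
  have h2 : π.overlined.val.countP (fun i => Odd i) =
      ∑ i ∈ s.toFinset, if Odd i then (if i ∈ π.overlined then 1 else 0) else 0 := by
    rw [Multiset.countP_eq_card_filter, ← Multiset.sum_count_eq_card (s := s.toFinset)]
    · refine sum_congr rfl fun i _ => ?_
      rw [Multiset.count_filter, Multiset.count_eq_of_nodup π.overlined.nodup]
      rfl
    · intro a ha
      exact π.overlined_subset (Multiset.mem_of_mem_filter ha)
  have h3 := Multiset.countP_le_of_le (fun i => Odd i) hsub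
  have h4 : π.evenOrOverlined + s.countP (fun i => Odd i) =
      s.card + π.overlined.val.countP (fun i => Odd i) := by
    rw [h1, h2, ← Multiset.toFinset_sum_count_eq s, Overpartition.evenOrOverlined,
      ← sum_add_distrib, ← sum_add_distrib]
    refine sum_congr rfl fun i _ => ?_
    rcases Nat.even_or_odd i with he | ho
    · have : ¬ Odd i := Nat.not_odd_iff_even.2 he
      simp [he, this, ← hs]
    · have : ¬ Even i := Nat.not_even_iff_odd.2 ho
      simp [ho, this, add_comm]
  rw [Overpartition.oddNonOverlined, ← hs, Multiset.countP_sub hsub]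
  omega

theorem ceil_natCast_div_two (L : ℕ) : ⌈(L : ℚ) / 2⌉ = (((L + 1) / 2 : ℕ) : ℤ) := by
  rw [Int.ceil_eq_iff]
  rcases Nat.even_or_odd' L with ⟨m, rfl | rfl⟩
  · have : (2 * m + 1) / 2 = m := by omega
    rw [this]; push_cast; constructor <;> linarith
  · have : (2 * m + 1 + 1) / 2 = m + 1 := by omega
    rw [this]; push_cast; constructor <;> linarith

/-- This puts the $M_2$-rank in the form `st - nu` with natural-valued statistics, as the diagonal
method requires. -/
theorem Overpartition.m2Rank_eq {n : ℕ} (π : Overpartition n) :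
    π.m2Rank = (π.halfLargest : ℤ) - π.evenOrOverlined := by
  have h := π.evenOrOverlined_add_oddNonOverlined
  have h2 : π.halfLargest + π.chi = (largestPart π.toPartition + 1) / 2 := by
    unfold Overpartition.halfLargest Overpartition.chi
    split_ifs with hc
    · obtain ⟨m, hm⟩ := hc.1
      omega
    · omega
  rw [Overpartition.m2Rank, ceil_natCast_div_two, ← h2]
  push_cast
  omega

/-- The generating function of the overpartitions with `⌈l(π)/2⌉ - χ(π) ≤ l`, the exponent of
`w` being the number of parts which are even or overlined. -/
noncomputable def over2Gen {R : Type*} [CommRing R] (w : R) (l : ℕ) : R⟦X⟧ :=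
  -- An even size weighs $w^c$ whether overlined or not; an odd one weighs $w$ if overlined and $1$
  -- if not; the size $2l+1$ may only be non-overlined.
  genFun fun i c => (if i ≤ 2 * l then (if Even i then 2 * w else 1 + w) else
    if i = 2 * l + 1 then 1 else 0) * (if Even i then w else 1) ^ (c - 1)

theorem coeff_over2Gen {R : Type*} [CommRing R] (w : R) (l n : ℕ) :
    coeff n (over2Gen w l) = ∑ π : Overpartition n,
      if π.halfLargest ≤ l then w ^ π.evenOrOverlined else 0 := by
  rw [over2Gen, genFun_congr (g := fun i c =>
    (if i ≤ 2 * l then (if Even i then w ^ c else w ^ 1) else 0) +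
    (if i ≤ 2 * l ∨ i = 2 * l + 1 then (if Even i then w ^ c else w ^ 0) else 0)),
    ← sum_overpartition]
  · refine sum_congr rfl fun π _ => ?_
    rw [prod_congr (g := fun i => if i ≤ 2 * l ∨ (i = 2 * l + 1 ∧ i ∉ π.overlined) then
      w ^ (if Even i then π.toPartition.parts.count i else if i ∈ π.overlined then 1 else 0)
      else 0) rfl, prod_ite_zero, prod_pow_eq_pow_sum]
    · exact if_congr π.halfLargest_le_iff.symm rfl rfl
    · intro i _
      by_cases h1 : i ∈ π.overlined <;> by_cases h2 : Even i <;> simp [h1, h2]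
  · intro i c hc
    obtain ⟨c, rfl⟩ := Nat.exists_eq_succ_of_ne_zero hc
    by_cases h : i ≤ 2 * l
    · by_cases he : Even i
      · simp only [h, he, if_true, true_or, Nat.succ_sub_one, pow_succ]; ring
      · simp only [h, he, if_true, if_false, true_or, one_pow]; ring
    · by_cases h2 : i = 2 * l + 1
      · have : ¬ Even i := by rw [h2]; simp
        simp [h2]
      · simp [h, h2]

theorem over2Gen_mul {R : Type*} [CommRing R] (w : R) (l : ℕ) :
    over2Gen w l * ((∏ j ∈ range l, ((1 - X ^ (2 * j + 1)) * (1 - C w * X ^ (2 * j + 2)))) *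
      (1 - X ^ (2 * l + 1))) =
      ∏ j ∈ range l, ((1 + C w * X ^ (2 * j + 1)) * (1 + C w * X ^ (2 * j + 2))) := by
  have := genFun_mul_prod (fun i => if i ≤ 2 * l then (if Even i then 2 * w else 1 + w) else
    if i = 2 * l + 1 then 1 else 0) (fun i => if Even i then w else 1)
    (2 * l + 1) (fun i hi => by rw [if_neg (by omega), if_neg (by omega)])
  rw [prod_range_succ, prod_range_succ, prod_range_two_mul, prod_range_two_mul] at this
  have h1 : ∀ j, ¬ Even (2 * j + 1) := fun j => by simp
  have h2 : ∀ j, Even (2 * j + 1 + 1) := fun j => ⟨j + 1, by ring⟩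
  have h3 : ¬ (2 * l + 1 ≤ 2 * l) := by omega
  simp only [h1, h2, h3, if_true, if_false, map_one, one_mul, sub_self, map_zero, zero_mul,
    add_zero, mul_one] at this
  rw [over2Gen, this]
  refine prod_congr rfl fun i hi => ?_
  have hi := mem_range.1 hi
  rw [if_pos (by omega), if_pos (by omega), add_sub_cancel_left,
    show 2 * w - w = w by ring]

end OverpartitionSums

/-! ### Tails and symmetry of the three ranks -/

section RankTails

open PowerSeries Finset

/-- `N` is symmetric and `U m` is the generating function of `∑_{j ≥ m} N j`, for `m ≥ 1`. -/
structure HasTails (N : ℤ → ℕ → ℤ) (U : ℕ → ℤ⟦X⟧) : Prop where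
  pos : ∀ m : ℕ, 1 ≤ m → ∀ n, N m n = coeff n (U m) - coeff n (U (m + 1))
  neg : ∀ m : ℕ, 1 ≤ m → ∀ n, N (-m) n = coeff n (U m) - coeff n (U (m + 1))
  dvd : ∀ m : ℕ, 1 ≤ m → (X : ℤ⟦X⟧) ^ m ∣ U m

theorem mul_succ_eq_of_mul_prod_eq {R : Type*} [CommRing R] [IsDomain R] {F m n : ℕ → R}
    (h : ∀ l, F l * ∏ i ∈ range l, m i = ∏ i ∈ range l, n i) (hm : ∀ i, m i ≠ 0) (l : ℕ) :
    F (l + 1) * m l = F l * n l := by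
  have h1 := h (l + 1)
  rw [prod_range_succ, prod_range_succ] at h1
  refine mul_right_cancel₀ (prod_ne_zero_iff.2 fun i _ => hm i : ∏ i ∈ range l, m i ≠ 0) ?_
  linear_combination h1 - n l * h l

variable {Ob : ℕ → Type} [∀ n, Fintype (Ob n)] {st nu : ∀ n, Ob n → ℕ}

theorem X_pow_dvd_rankLeGF_neg (hnu : ∀ n π, nu n π ≤ n) (m : ℕ) :
    (X : ℤ⟦X⟧) ^ m ∣ rankLeGF st nu (-m) := by
  rw [X_pow_dvd_iff]
  intro n hn
  exact rankLeGF_eq_zero hnu (by omega)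

/-- It suffices to identify the tails on both sides of the distribution of a rank. -/
theorem hasTails_of_rankLeGF (hst : ∀ n π, st n π ≤ n) {N : ℤ → ℕ → ℤ}
    (hN : ∀ m n, N m n = Nat.card {π : Ob n // (st n π : ℤ) - nu n π = m})
    (hsymm : ∀ m : ℕ, 1 ≤ m → totalGF Ob - rankLeGF st nu (m - 1) = rankLeGF st nu (-m)) :
    HasTails N (fun m => totalGF Ob - rankLeGF st nu (m - 1)) := by
  refine ⟨fun m hm n => ?_, fun m hm n => ?_, fun m hm => ?_⟩
  · rw [hN, natCard_rank_eq]
    push_cast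
    rw [add_sub_cancel_right, map_sub, map_sub]
    ring
  · have h1 : -(m : ℤ) - 1 = -((m + 1 : ℕ) : ℤ) := by push_cast; ring
    rw [hN, natCard_rank_eq, h1, hsymm m hm, hsymm (m + 1) (by omega)]
  · have := X_pow_dvd_rankLeGF_sub_totalGF (nu := nu) hst (m - 1)
    rw [Nat.sub_add_cancel hm, Nat.cast_sub hm, Nat.cast_one] at this
    rwa [dvd_sub_comm]

/-- With $L_r$ the series for rank at most $r$ and $y_r=L_r+L_{r+1}$, one has
$y_r+q^{er+e+1}y_{r+d}=2A$ up to initial values. For $r=m-1$ this is an equation for $2A-y_{m-1}$.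
For $r=-m-1-d$ the exponent is $-(em+1)$, because $ed=2$, and the same equation results for
$y_{-m-1}$. -/
theorem hasTails_of_diagonalRecursion_one_add_X {e d : ℕ} (hed : e * d = 2)
    (hst : ∀ n π, st n π ≤ n) (hnu : ∀ n π, nu n π ≤ n)
    (hrec : DiagonalRecursion (fun l s => zcoeff ((1 + X) * boundedGF st nu l) s) e (e + 1) d)
    (h0 : ∀ s, 2 ≤ s → zcoeff ((1 + X) * boundedGF st nu 0) s = 0) {N : ℤ → ℕ → ℤ}
    (hN : ∀ m n, N m n = Nat.card {π : Ob n // (st n π : ℤ) - nu n π = m}) :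
    ∃ U, HasTails N U ∧
      ∀ m, 1 ≤ m → U m + U (m + 1) = 2 * totalGF Ob * altTheta (fun n => n ^ 2) e m := by
  set L := rankLeGF st nu with hL
  set A := totalGF Ob with hA
  have he := hrec.one_le
  have hd : 1 ≤ d := Nat.one_le_iff_ne_zero.2 fun h => by simp [h] at hed
  have hy : IsDiagonalSum _ (fun r => L r + L (r + 1)) :=
    isDiagonalSum_one_add_X_mul_rankLeGF (st := st) hnu
  have hB : ∀ r : ℕ, (X : ℤ⟦X⟧) ^ r ∣ (fun r => L r + L (r + 1)) (r : ℤ) - 2 * A := by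
    intro r
    have h1 := X_pow_dvd_rankLeGF_sub_totalGF (nu := nu) hst r
    have h2 := X_pow_dvd_rankLeGF_sub_totalGF (nu := nu) hst (r + 1)
    have h3 := dvd_add ((pow_dvd_pow _ (by omega)).trans h1 : (X : ℤ⟦X⟧) ^ r ∣ _)
      ((pow_dvd_pow _ (by omega)).trans h2)
    convert h3 using 1
    push_cast
    ring
  have hFE := fun r α β hαβ => hrec.functional_equation hy hB r (α := α) (β := β) hαβ
  have ha : ∀ n, 1 ≤ n → (n + 1) ^ 2 = n ^ 2 + 1 + e * n * d := by
    intro n _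
    have : e * n * d = (e * d) * n := by ring
    rw [this, hed]; ring
  have hpos : ∀ m : ℕ, 1 ≤ m → (A - L ((m : ℤ) - 1)) + (A - L ((m + 1 : ℕ) - 1)) =
      2 * A * altTheta (fun n => n ^ 2) e m := by
    intro m hm
    refine eq_mul_altTheta (G := fun m : ℕ => (A - L ((m : ℤ) - 1)) + (A - L ((m + 1 : ℕ) - 1)))
      (b := 1) (d := d) he rfl ha (fun m hm => ?_) hm
    have h := hFE ((m : ℤ) - 1) (e * m + 1) 0 (by push_cast; ring)
    rw [zcoeff_of_neg _ (by omega), zcoeff_of_neg _ (by omega)] at h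
    have e1 : ((m + 1 : ℕ) : ℤ) - 1 = (m : ℤ) - 1 + 1 := by push_cast; ring
    have e2 : ((m + d : ℕ) : ℤ) - 1 = (m : ℤ) - 1 + d := by push_cast; ring
    have e3 : ((m + d + 1 : ℕ) : ℤ) - 1 = (m : ℤ) - 1 + d + 1 := by push_cast; ring
    simp only [e1, e2, e3]
    linear_combination -h
  have hneg : ∀ m : ℕ, 1 ≤ m → L (-(m : ℤ)) + L (-((m + 1 : ℕ) : ℤ)) =
      2 * A * altTheta (fun n => n ^ 2) e m := by
    intro m hm
    refine eq_mul_altTheta (G := fun m : ℕ => L (-(m : ℤ)) + L (-((m + 1 : ℕ) : ℤ)))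
      (b := 1) (d := d) he rfl ha (fun m hm => ?_) hm
    have hed' : (e : ℤ) * d = 2 := by exact_mod_cast hed
    have h := hFE (-(m : ℤ) - 1 - d) 0 (e * m + 1) (by push_cast; linear_combination hed')
    -- The initial values sit at the indices $m+d$ and $m+1$, both at least $2$.
    rw [h0 _ (by omega), h0 _ (by omega)] at h
    have e1 : -((m + 1 : ℕ) : ℤ) = -(m : ℤ) - 1 := by push_cast; ring
    have e2 : -((m + d : ℕ) : ℤ) = -(m : ℤ) - 1 - d + 1 := by push_cast; ring
    have e3 : -((m + d + 1 : ℕ) : ℤ) = -(m : ℤ) - 1 - d := by push_cast; ring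
    have e4 : -(m : ℤ) - 1 - d + d = -(m : ℤ) - 1 := by ring
    have e5 : -(m : ℤ) - 1 + 1 = -m := by ring
    simp only [e1, e2, e3]
    simp only [e4, e5] at h
    linear_combination h
  -- Sums of consecutive upper and lower tails agree, so their discrepancy changes sign when $m$
  -- becomes $m+1$. Being divisible by $X^m$, it is divisible by every power of $X$.
  have hsymm : ∀ m : ℕ, 1 ≤ m → A - L ((m : ℤ) - 1) = L (-m) := by
    have hdvd : ∀ j m : ℕ, 1 ≤ m → (X : ℤ⟦X⟧) ^ (m + j) ∣ A - L ((m : ℤ) - 1) - L (-m) := by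
      intro j
      induction j with
      | zero =>
        intro m hm
        have := X_pow_dvd_rankLeGF_sub_totalGF (nu := nu) hst (m - 1)
        rw [Nat.sub_add_cancel hm, Nat.cast_sub hm, Nat.cast_one, dvd_sub_comm] at this
        exact dvd_sub this (X_pow_dvd_rankLeGF_neg hnu m)
      | succ j ih =>
        intro m hm
        have h1 := ih (m + 1) (by omega)
        have h2 : A - L ((m : ℤ) - 1) - L (-m) =
            -(A - L (((m + 1 : ℕ) : ℤ) - 1) - L (-((m + 1 : ℕ) : ℤ))) := by
          linear_combination hpos m hm - hneg m hm
        rw [h2, dvd_neg]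
        convert h1 using 2
        ring
    intro m hm
    rw [← sub_eq_zero]
    exact eq_zero_of_forall_X_pow_dvd fun j => (pow_dvd_pow _ (by omega)).trans (hdvd j m hm)
  exact ⟨_, hasTails_of_rankLeGF hst hN hsymm, hpos⟩

/-- The equation $y_r+q^{2r+3}y_{r+2}=A$ is used at $r=m-1$ and at $r=-m-2$, where the exponents are
$2m+1$ and $-(2m+1)$; upper and lower tails therefore solve the same equation. -/
theorem hasTails_of_diagonalRecursion (hst : ∀ n π, st n π ≤ n) (hnu : ∀ n π, nu n π ≤ n)
    (hrec : DiagonalRecursion (fun l s => zcoeff (boundedGF st nu l) s) 2 3 2)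
    (h0 : ∀ s, 1 ≤ s → zcoeff (boundedGF st nu 0) s = 0) {N : ℤ → ℕ → ℤ}
    (hN : ∀ m n, N m n = Nat.card {π : Ob n // (st n π : ℤ) - nu n π = m}) :
    ∃ U, HasTails N U ∧
      ∀ m, 1 ≤ m → U m = totalGF Ob * altTheta (fun n => n * (2 * n - 1)) 2 m := by
  set L := rankLeGF st nu with hL
  set A := totalGF Ob with hA
  have hB : ∀ r : ℕ, (X : ℤ⟦X⟧) ^ r ∣ L r - A := fun r =>
    (pow_dvd_pow _ (by omega)).trans (X_pow_dvd_rankLeGF_sub_totalGF (nu := nu) hst r)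
  have hFE := fun r α β hαβ => hrec.functional_equation (isDiagonalSum_rankLeGF hnu) hB r
    (α := α) (β := β) hαβ
  have ha : ∀ n, 1 ≤ n → (n + 1) * (2 * (n + 1) - 1) = n * (2 * n - 1) + 1 + 2 * n * 2 := by
    intro n hn
    obtain ⟨k, rfl⟩ := Nat.exists_eq_add_of_le' hn
    have h1 : 2 * (k + 1) - 1 = 2 * k + 1 := by omega
    have h2 : 2 * (k + 1 + 1) - 1 = 2 * k + 3 := by omega
    rw [h1, h2]; ring
  have hpos : ∀ m : ℕ, 1 ≤ m → A - L ((m : ℤ) - 1) =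
      A * altTheta (fun n => n * (2 * n - 1)) 2 m := by
    intro m hm
    refine eq_mul_altTheta (G := fun m : ℕ => A - L ((m : ℤ) - 1)) (b := 1) (d := 2)
      (by norm_num) rfl ha (fun m hm => ?_) hm
    have h := hFE ((m : ℤ) - 1) (2 * m + 1) 0 (by push_cast; ring)
    rw [zcoeff_of_neg _ (by omega), zcoeff_of_neg _ (by omega)] at h
    have e1 : ((m + 2 : ℕ) : ℤ) - 1 = (m : ℤ) - 1 + (2 : ℕ) := by push_cast; ring
    simp only [e1]
    linear_combination -h
  have hneg : ∀ m : ℕ, 1 ≤ m → L (-(m : ℤ)) =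
      A * altTheta (fun n => n * (2 * n - 1)) 2 m := by
    intro m hm
    refine eq_mul_altTheta (G := fun m : ℕ => L (-(m : ℤ))) (b := 1) (d := 2)
      (by norm_num) rfl ha (fun m hm => ?_) hm
    have h := hFE (-(m : ℤ) - 2) 0 (2 * m + 1) (by push_cast; ring)
    rw [h0 _ (by omega), h0 _ (by push_cast; omega)] at h
    have e1 : -((m + 2 : ℕ) : ℤ) = -(m : ℤ) - 2 := by push_cast; ring
    have e2 : -(m : ℤ) - 2 + (2 : ℕ) = -m := by push_cast; ring
    simp only [e1]
    simp only [e2] at h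
    linear_combination h
  exact ⟨_, hasTails_of_rankLeGF hst hN fun m hm => (hpos m hm).trans (hneg m hm).symm, hpos⟩

theorem zcoeff_C_of_pos (u : ℤ⟦X⟧) {s : ℤ} (hs : 1 ≤ s) : zcoeff (C u) s = 0 := by
  rw [zcoeff, if_pos (by omega), coeff_C, if_neg (by omega)]

theorem zcoeff_one_add_X_mul_C (u : ℤ⟦X⟧) {s : ℤ} (hs : 2 ≤ s) :
    zcoeff ((1 + X) * C u) s = 0 := by
  rw [add_mul, one_mul, zcoeff_add, zcoeff_X_mul, zcoeff_C_of_pos _ (by omega),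
    zcoeff_C_of_pos _ (by omega), add_zero]

theorem exists_hasTails_rankBar : ∃ U, HasTails rankBar U ∧ ∀ m, 1 ≤ m →
    U m + U (m + 1) = 2 * totalGF Overpartition * altTheta (fun n => n ^ 2) 1 m := by
  set st : ∀ n, Overpartition n → ℕ := fun _ π => largestPart π.toPartition
  set nu : ∀ n, Overpartition n → ℕ := fun _ π => π.toPartition.parts.card
  have hF : ∀ l, boundedGF st nu l = seriesSwap (overGen X l) := fun l =>
    boundedGF_eq_seriesSwap fun n => coeff_overGen _ _ _
  have hprod : ∀ l, boundedGF st nu l * ∏ i ∈ range l, (1 - X * C (X ^ (i + 1))) =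
      ∏ i ∈ range l, (1 + X * C (X ^ (i + 1))) := by
    intro l
    have := congrArg seriesSwap (overGen_mul (X : ℤ⟦X⟧) l)
    simpa only [map_mul, map_prod, map_sub, map_add, map_one, map_pow, seriesSwap_X,
      seriesSwap_C_X, ← hF] using this
  have h0 : boundedGF st nu 0 = 1 := by simpa using hprod 0
  have hnu : ∀ n π, nu n π ≤ n := fun _ π => card_parts_le _
  refine hasTails_of_diagonalRecursion_one_add_X (st := st) (nu := nu) (e := 1) (d := 2) rfl
    (fun _ π => largestPart_le _) hnu ?_ ?_ fun m n => rfl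
  · exact diagonalRecursion_rankBar h0
      (mul_succ_eq_of_mul_prod_eq hprod fun i => one_sub_X_mul_C_ne_zero _)
      (X_pow_dvd_coeff_boundedGF hnu)
  · intro s hs
    rw [h0, ← map_one C]
    exact zcoeff_one_add_X_mul_C 1 hs

theorem exists_hasTails_rank2 : ∃ U, HasTails rank2 U ∧ ∀ m, 1 ≤ m →
    U m = totalGF OddDistinctPartition * altTheta (fun n => n * (2 * n - 1)) 2 m := by
  set st : ∀ n, OddDistinctPartition n → ℕ := fun _ π => (largestPart π.1 + 1) / 2
  set nu : ∀ n, OddDistinctPartition n → ℕ := fun _ π => π.1.parts.card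
  have hF : ∀ l, boundedGF st nu l = seriesSwap (oddDistinctGen X l) := fun l =>
    boundedGF_eq_seriesSwap fun n => coeff_oddDistinctGen _ _ _
  have hprod : ∀ l, boundedGF st nu l * ∏ i ∈ range l, (1 - X * C (X ^ (2 * i + 2))) =
      ∏ i ∈ range l, (1 + X * C (X ^ (2 * i + 1))) := by
    intro l
    have := congrArg seriesSwap (oddDistinctGen_mul (X : ℤ⟦X⟧) l)
    simpa only [map_mul, map_prod, map_sub, map_add, map_one, map_pow, seriesSwap_X,
      seriesSwap_C_X, ← hF] using this
  have h0 : boundedGF st nu 0 = 1 := by simpa using hprod 0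
  have hnu : ∀ n π, nu n π ≤ n := fun _ π => card_parts_le _
  refine hasTails_of_diagonalRecursion (st := st) (nu := nu)
    (fun _ π => ?_) hnu ?_ ?_ fun m n => ?_
  · have := largestPart_le π.1
    simp only [st]
    omega
  · exact diagonalRecursion_rank2 h0
      (mul_succ_eq_of_mul_prod_eq hprod fun i => one_sub_X_mul_C_ne_zero _)
      (X_pow_dvd_coeff_boundedGF hnu)
  · intro s hs
    rw [h0, ← map_one C]
    exact zcoeff_C_of_pos 1 hs
  · simp only [rank2, OddDistinctPartition.m2Rank, ceil_natCast_div_two, st, nu]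

theorem Overpartition.halfLargest_le {n : ℕ} (π : Overpartition n) : π.halfLargest ≤ n := by
  have := largestPart_le π.toPartition
  unfold Overpartition.halfLargest
  split_ifs <;> omega

theorem exists_hasTails_rank2Bar : ∃ U, HasTails rank2Bar U ∧ ∀ m, 1 ≤ m →
    U m + U (m + 1) = 2 * totalGF Overpartition * altTheta (fun n => n ^ 2) 2 m := by
  set st : ∀ n, Overpartition n → ℕ := fun _ π => π.halfLargest
  set nu : ∀ n, Overpartition n → ℕ := fun _ π => π.evenOrOverlined
  have hF : ∀ l, boundedGF st nu l = seriesSwap (over2Gen X l) := fun l =>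
    boundedGF_eq_seriesSwap fun n => coeff_over2Gen _ _ _
  have hC : ∀ l : ℕ, (1 - C X ^ l : ℤ⟦X⟧⟦X⟧) = C (1 - X ^ l) := by simp
  have hprod : ∀ l, boundedGF st nu l * C (1 - X ^ (2 * l + 1)) *
      ∏ i ∈ range l, (C (1 - X ^ (2 * i + 1)) * (1 - X * C (X ^ (2 * i + 2)))) =
      ∏ i ∈ range l, ((1 + X * C (X ^ (2 * i + 1))) * (1 + X * C (X ^ (2 * i + 2)))) := by
    intro l
    have := congrArg seriesSwap (over2Gen_mul (X : ℤ⟦X⟧) l)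
    simp only [map_mul, map_prod, map_sub, map_add, map_one, map_pow, seriesSwap_X,
      seriesSwap_C_X, ← hF] at this ⊢
    rw [← this]
    ring
  have hne : ∀ l : ℕ, (C (1 - X ^ (2 * l + 1)) : ℤ⟦X⟧⟦X⟧) ≠ 0 := by
    intro l h
    simpa using congrArg (fun f => constantCoeff (constantCoeff f)) h
  have hrec := mul_succ_eq_of_mul_prod_eq hprod fun i =>
    mul_ne_zero (hne i) (one_sub_X_mul_C_ne_zero _)
  -- For $l=0$ only non-overlined parts equal to $1$ remain; they give $1/(1-q)$, which is constant
  -- in $w$.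
  have h0 : boundedGF st nu 0 = C (invOfUnit (1 - X) 1) := by
    have h1 : boundedGF st nu 0 * C (1 - X) = 1 := by simpa using hprod 0
    have h2 : (1 - X : ℤ⟦X⟧) * invOfUnit (1 - X) 1 = 1 := mul_invOfUnit _ _ (by simp)
    calc boundedGF st nu 0 = boundedGF st nu 0 * C ((1 - X) * invOfUnit (1 - X) 1) := by
          rw [h2, map_one, mul_one]
      _ = _ := by rw [map_mul, ← mul_assoc, h1, one_mul]
  have hnu : ∀ n π, nu n π ≤ n := fun n π => by
    have h1 := π.evenOrOverlined_add_oddNonOverlined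
    have h2 := card_parts_le π.toPartition
    simp only [nu]
    omega
  refine hasTails_of_diagonalRecursion_one_add_X (st := st) (nu := nu) (e := 2) (d := 1) rfl
    (fun _ π => π.halfLargest_le) hnu ?_ ?_ fun m n => ?_
  · refine diagonalRecursion_rank2Bar h0 (fun l => ?_) (X_pow_dvd_coeff_boundedGF hnu)
    refine mul_right_cancel₀ (hne l) ?_
    have h := hrec l
    have e1 : 2 * (l + 1) + 1 = 2 * l + 3 := by ring
    rw [e1] at h
    linear_combination h
  · intro s hs
    rw [h0]
    exact zcoeff_one_add_X_mul_C _ hs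
  · simp only [rank2Bar, Overpartition.m2Rank_eq, st, nu]

end RankTails

/-! ### Generating functions of all objects -/

section Totals

open PowerSeries Finset

theorem mul_eq_of_X_pow_dvd_sub {R : Type*} [CommRing R] {A B D : R⟦X⟧} {a b d : ℕ → R⟦X⟧}
    (hA : ∀ N, X ^ N ∣ A - a N) (hB : ∀ N, X ^ N ∣ B - b N) (hD : ∀ N, X ^ N ∣ D - d N)
    (h : ∀ N, a N * b N = d N) : A * B = D := by
  rw [← sub_eq_zero]
  refine eq_zero_of_forall_X_pow_dvd fun N => ?_
  have := dvd_sub (dvd_add ((hA N).mul_right B) ((hB N).mul_left (a N))) (hD N)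
  convert this using 1
  linear_combination h N

theorem totalGF_overpartition_mul :
    totalGF Overpartition * formalQPoch X X = formalQPoch (-X) X := by
  refine mul_eq_of_X_pow_dvd_sub (a := fun N => overGen 1 N) (fun N => ?_)
    (fun N => X_pow_dvd_formalQPoch_sub X X (by simp) N)
    (fun N => X_pow_dvd_formalQPoch_sub (-X) X (by simp) N) fun N => ?_
  · rw [X_pow_dvd_sub_iff]
    intro n hn
    rw [coeff_overGen, totalGF, coeff_mk,
      sum_congr rfl fun π _ => if_pos ((largestPart_le _).trans hn.le)]
    simp
  · have := overGen_mul (1 : ℤ) N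
    simp only [map_one, one_mul] at this
    convert this using 2
    · exact prod_congr rfl fun i _ => by ring
    · ring

theorem totalGF_oddDistinctPartition_mul :
    totalGF OddDistinctPartition * formalQPoch (X ^ 2) (X ^ 2) = formalQPoch (-X) (X ^ 2) := by
  refine mul_eq_of_X_pow_dvd_sub (a := fun N => oddDistinctGen 1 N) (fun N => ?_)
    (fun N => X_pow_dvd_formalQPoch_sub (X ^ 2) (X ^ 2) (by simp) N)
    (fun N => X_pow_dvd_formalQPoch_sub (-X) (X ^ 2) (by simp) N) fun N => ?_
  · rw [X_pow_dvd_sub_iff]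
    intro n hn
    rw [coeff_oddDistinctGen, totalGF, coeff_mk, sum_congr rfl fun π _ => if_pos (by
      have := largestPart_le π.1
      omega)]
    simp
  · have := oddDistinctGen_mul (1 : ℤ) N
    simp only [map_one, one_mul] at this
    convert this using 2
    · exact prod_congr rfl fun i _ => by ring
    · ring

theorem formalQPoch_X_X_eq {R : Type*} [CommRing R] :
    formalQPoch (X : R⟦X⟧) (X ^ 2) * formalQPoch (X ^ 2) (X ^ 2) = formalQPoch (X : R⟦X⟧) X := by
  refine mul_eq_of_X_pow_dvd_sub
    (fun N => X_pow_dvd_formalQPoch_sub X (X ^ 2) (by simp) N)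
    (fun N => X_pow_dvd_formalQPoch_sub (X ^ 2) (X ^ 2) (by simp) N)
    (fun N => (pow_dvd_pow _ (by omega : N ≤ 2 * N)).trans
      (X_pow_dvd_formalQPoch_sub X X (by simp) (2 * N))) fun N => ?_
  rw [prod_range_two_mul, ← prod_mul_distrib]
  refine prod_congr rfl fun j _ => ?_
  ring

end Totals

/-! ### Tails and symmetry of the three cranks -/

section CrankTails

open PowerSeries Finset

/-- `1 / (q^e; q^e)_i`. -/
noncomputable def invPoch (e i : ℕ) : ℤ⟦X⟧ :=
  invOfUnit (∏ j ∈ range i, (1 - X ^ e * (X ^ e) ^ j)) 1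

theorem prod_mul_invPoch {e : ℕ} (he : 1 ≤ e) (i : ℕ) :
    (∏ j ∈ range i, (1 - X ^ e * (X ^ e) ^ j)) * invPoch e i = 1 := by
  refine mul_invOfUnit _ _ ?_
  simp [map_prod, zero_pow (by omega : e ≠ 0)]

theorem invPoch_zero (e : ℕ) (he : 1 ≤ e) : invPoch e 0 = 1 := by
  simpa using prod_mul_invPoch he 0

theorem invPoch_succ_mul {e : ℕ} (he : 1 ≤ e) (i : ℕ) :
    invPoch e (i + 1) * (1 - X ^ (e * (i + 1))) = invPoch e i := by
  have h1 := prod_mul_invPoch he i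
  have h2 := prod_mul_invPoch he (i + 1)
  have h3 : (X : ℤ⟦X⟧) ^ e * (X ^ e) ^ i = X ^ (e * (i + 1)) := by
    rw [← pow_mul, ← pow_add]; congr 1; ring
  rw [prod_range_succ, h3] at h2
  linear_combination invPoch e i * h2 - invPoch e (i + 1) * (1 - X ^ (e * (i + 1))) * h1

/-- The embedding of constant (in `z`) power series. -/
noncomputable def constZ : ℤ⟦X⟧ →+* ℤ[T;T⁻¹]⟦X⟧ := PowerSeries.map LaurentPolynomial.C

theorem constZ_X : constZ X = X := by simp [constZ]

theorem X_pow_dvd_constZ {N : ℕ} {f : ℤ⟦X⟧} (h : X ^ N ∣ f) : X ^ N ∣ constZ f := by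
  simpa [constZ_X] using map_dvd constZ h

/-- The power series `∑ z^(k i) q^(e i) / (q^e; q^e)_i`. -/
noncomputable def eulerSeries (e : ℕ) (k : ℤ) : ℤ[T;T⁻¹]⟦X⟧ :=
  adicSum fun i => C (LaurentPolynomial.T (i * k)) * constZ (X ^ (e * i) * invPoch e i)

theorem X_pow_dvd_eulerSeries_sub {e : ℕ} (he : 1 ≤ e) (k : ℤ) (N : ℕ) :
    X ^ N ∣ eulerSeries e k - ∑ i ∈ range N,
      C (LaurentPolynomial.T (i * k)) * constZ (X ^ (e * i) * invPoch e i) :=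
  X_pow_dvd_adicSum_sub (fun i => Dvd.dvd.mul_left (X_pow_dvd_constZ
    (Dvd.dvd.mul_right (pow_dvd_pow _ (Nat.le_mul_of_pos_left i he)) _)) _) N

/-- Euler's expansion of `1 / (z q; q)_∞`. -/
theorem eulerSeries_mul_formalQPoch {e : ℕ} (he : 1 ≤ e) (k : ℤ) :
    eulerSeries e k * formalQPoch (C (LaurentPolynomial.T k) * X ^ e) (X ^ e) = 1 := by
  set z : ℤ[T;T⁻¹]⟦X⟧ := C (LaurentPolynomial.T k) with hz
  have hzi : ∀ i : ℕ, C (LaurentPolynomial.T (i * k)) = z ^ i := fun i => by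
    rw [hz, ← map_pow, LaurentPolynomial.T_pow]
  -- Row `j` is Euler's series with $z$ replaced by $zq^{ej}$. Multiplication by $1-zq^{e(j+1)}$
  -- carries row $j$ to row $j+1$, up to the terms of index $N$.
  set a : ℕ → ℕ → ℤ[T;T⁻¹]⟦X⟧ := fun j i => z ^ i * constZ (X ^ (e * i * (j + 1)) * invPoch e i)
    with ha
  have hdvd : ∀ j i, (X : ℤ[T;T⁻¹]⟦X⟧) ^ i ∣ a j i := by
    intro j i
    refine Dvd.dvd.mul_left (X_pow_dvd_constZ (Dvd.dvd.mul_right (pow_dvd_pow _ ?_) _)) _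
    calc i = 1 * i * 1 := by ring
      _ ≤ e * i * (j + 1) := by gcongr; omega
  have hstep : ∀ j i, a j i * (z * X ^ e * (X ^ e) ^ j) = a j (i + 1) - a (j + 1) (i + 1) := by
    intro j i
    have h := congrArg constZ (invPoch_succ_mul he i)
    simp only [ha, map_mul, map_sub, map_one, map_pow, constZ_X] at h ⊢
    rw [← h]
    ring
  have ha0 : ∀ j, a j 0 = 1 := fun j => by simp [ha, invPoch_zero e he]
  have hS : ∀ N j, X ^ N ∣ (∑ i ∈ range N, a 0 i) * ∏ i ∈ range j, (1 - z * X ^ e * (X ^ e) ^ i)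
      - ∑ i ∈ range N, a j i := by
    intro N j
    induction j with
    | zero => simp
    | succ j ih =>
      have h1 : (∑ i ∈ range N, a j i) * (1 - z * X ^ e * (X ^ e) ^ j) - ∑ i ∈ range N, a (j + 1) i
          = a (j + 1) N - a j N := by
        have t1 := sum_range_sub (fun i => a j i) N
        have t2 := sum_range_sub (fun i => a (j + 1) i) N
        have t3 : (∑ i ∈ range N, a j i) * (z * X ^ e * (X ^ e) ^ j) =
            ∑ i ∈ range N, a j (i + 1) - ∑ i ∈ range N, a (j + 1) (i + 1) := by
          rw [sum_mul, ← sum_sub_distrib]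
          exact sum_congr rfl fun i _ => hstep j i
        rw [sum_sub_distrib] at t1 t2
        rw [ha0] at t1 t2
        linear_combination t2 - t1 - t3
      have h2 := dvd_add (ih.mul_right (1 - z * X ^ e * (X ^ e) ^ j))
        (dvd_sub (hdvd (j + 1) N) (hdvd j N))
      rw [← h1] at h2
      rw [prod_range_succ]
      convert h2 using 1
      ring
  rw [← sub_eq_zero]
  refine eq_zero_of_forall_X_pow_dvd fun N => ?_
  rcases Nat.eq_zero_or_pos N with rfl | hN
  · simp
  have h1 : X ^ N ∣ eulerSeries e k - ∑ i ∈ range N, a 0 i := by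
    have := X_pow_dvd_eulerSeries_sub he k N
    simpa only [hzi, ha, zero_add, mul_one] using this
  have h2 := X_pow_dvd_formalQPoch_sub (z * X ^ e) (X ^ e)
    (by simp [zero_pow (by omega : e ≠ 0)]) N
  -- In row $N$ every term but the one at $i=0$ is divisible by $X^N$.
  have h3 : X ^ N ∣ ∑ i ∈ range N, a N i - 1 := by
    obtain ⟨M, rfl⟩ := Nat.exists_eq_add_of_le' hN
    rw [sum_range_succ', ha0, add_sub_cancel_right]
    refine dvd_sum fun i _ => Dvd.dvd.mul_left (X_pow_dvd_constZ
      (Dvd.dvd.mul_right (pow_dvd_pow _ ?_) _)) _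
    calc M + 1 ≤ 1 * 1 * (M + 1 + 1) := by omega
      _ ≤ e * (i + 1) * (M + 1 + 1) := by gcongr; omega
  have h4 := dvd_add (dvd_add (h1.mul_right (formalQPoch (z * X ^ e) (X ^ e)))
    (h2.mul_left (∑ i ∈ range N, a 0 i))) (dvd_add (hS N N) h3)
  convert h4 using 1
  ring

/-- The generating function in `q` of the coefficients of `z ^ m`. -/
noncomputable def zRow (m : ℤ) : ℤ[T;T⁻¹]⟦X⟧ →+ ℤ⟦X⟧ where
  toFun F := PowerSeries.mk fun n => zqCoeff F m n
  map_zero' := by ext; simp [zqCoeff]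
  map_add' F G := by ext; simp [zqCoeff]

theorem coeff_zRow (F : ℤ[T;T⁻¹]⟦X⟧) (m : ℤ) (n : ℕ) : coeff n (zRow m F) = zqCoeff F m n := by
  simp [zRow]

theorem X_pow_dvd_zRow {N : ℕ} {F : ℤ[T;T⁻¹]⟦X⟧} (h : X ^ N ∣ F) (m : ℤ) : X ^ N ∣ zRow m F := by
  rw [X_pow_dvd_iff] at h ⊢
  intro n hn
  rw [coeff_zRow, zqCoeff, h n hn]
  simp

theorem zRow_constZ_mul_C_T (a : ℤ⟦X⟧) (k m : ℤ) :
    zRow m (constZ a * C (LaurentPolynomial.T k)) = if k = m then a else 0 := by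
  ext n
  rw [coeff_zRow, zqCoeff, coeff_mul_C, constZ, coeff_map, ← LaurentPolynomial.single_eq_C_mul_T,
    AddMonoidAlgebra.coeff_single, Finsupp.single_apply]
  split_ifs <;> simp

theorem X_pow_dvd_zRow_mul_eulerSeries_sub {e : ℕ} (he : 1 ≤ e) (D : ℤ⟦X⟧) (m : ℤ) (N : ℕ) :
    X ^ N ∣ zRow m (constZ D * (eulerSeries e 1 * eulerSeries e (-1))) -
      ∑ i ∈ range N, ∑ j ∈ range N, if (i : ℤ) - j = m then
        D * ((X ^ (e * i) * invPoch e i) * (X ^ (e * j) * invPoch e j)) else 0 := by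
  have h1 := X_pow_dvd_eulerSeries_sub he 1 N
  have h2 := X_pow_dvd_eulerSeries_sub he (-1) N
  have h5 : zRow m (constZ D * ((∑ i ∈ range N, C (LaurentPolynomial.T (i * 1)) *
      constZ (X ^ (e * i) * invPoch e i)) * ∑ j ∈ range N, C (LaurentPolynomial.T (j * (-1))) *
      constZ (X ^ (e * j) * invPoch e j))) = ∑ i ∈ range N, ∑ j ∈ range N,
      if (i : ℤ) - j = m then D * ((X ^ (e * i) * invPoch e i) * (X ^ (e * j) * invPoch e j))
        else 0 := by
    rw [sum_mul_sum, mul_sum, map_sum]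
    refine sum_congr rfl fun i _ => ?_
    rw [mul_sum, map_sum]
    refine sum_congr rfl fun j _ => ?_
    have h6 : (LaurentPolynomial.T ((i : ℤ) - j) : ℤ[T;T⁻¹]) =
        LaurentPolynomial.T (i * 1) * LaurentPolynomial.T (j * (-1)) := by
      rw [← LaurentPolynomial.T_add]; congr 1; ring
    have h7 := zRow_constZ_mul_C_T
      (D * ((X ^ (e * i) * invPoch e i) * (X ^ (e * j) * invPoch e j))) ((i : ℤ) - j) m
    rw [← h7, h6, map_mul C, map_mul constZ D, map_mul constZ (X ^ (e * i) * invPoch e i)]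
    generalize constZ (X ^ (e * i) * invPoch e i) = u
    generalize constZ (X ^ (e * j) * invPoch e j) = v
    generalize C (LaurentPolynomial.T ((i : ℤ) * 1) : ℤ[T;T⁻¹]) = s
    generalize C (LaurentPolynomial.T ((j : ℤ) * (-1)) : ℤ[T;T⁻¹]) = t
    generalize constZ D = d
    exact congrArg (zRow m) (by ring)
  rw [← h5, ← map_sub]
  refine X_pow_dvd_zRow ?_ m
  generalize eulerSeries e 1 = E1 at *
  generalize eulerSeries e (-1) = E2 at *
  generalize (∑ i ∈ range N, C (LaurentPolynomial.T (i * 1)) *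
      constZ (X ^ (e * i) * invPoch e i)) = S1 at *
  generalize (∑ i ∈ range N, C (LaurentPolynomial.T (i * (-1))) *
      constZ (X ^ (e * i) * invPoch e i)) = S2 at *
  have h3 := (dvd_add (h1.mul_right E2) (h2.mul_left S1)).mul_left (constZ D)
  have h4 : constZ D * (E1 * E2) - constZ D * (S1 * S2) =
      constZ D * ((E1 - S1) * E2 + S1 * (E2 - S2)) := by ring
  rwa [h4]

/-- The tails of the crank. -/
noncomputable def crankTail (e : ℕ) (A : ℤ⟦X⟧) (m : ℕ) : ℤ⟦X⟧ :=
  A * formalQPoch (X ^ e) (X ^ e) ^ 2 *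
    adicSum fun i => X ^ (e * (i + m)) * invPoch e (i + m) * invPoch e i

theorem X_pow_dvd_crankTail_sub {e : ℕ} (he : 1 ≤ e) (A : ℤ⟦X⟧) (m N : ℕ) :
    X ^ N ∣ crankTail e A m - A * formalQPoch (X ^ e) (X ^ e) ^ 2 *
      ∑ i ∈ range N, X ^ (e * (i + m)) * invPoch e (i + m) * invPoch e i := by
  rw [crankTail, ← mul_sub]
  refine Dvd.dvd.mul_left (X_pow_dvd_adicSum_sub (fun i => Dvd.dvd.mul_right
    (Dvd.dvd.mul_right (pow_dvd_pow _ ?_) _) _) N) _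
  calc i ≤ i + m := by omega
    _ ≤ e * (i + m) := Nat.le_mul_of_pos_left _ he

theorem X_pow_dvd_invPoch_mul_sub_one {e : ℕ} (he : 1 ≤ e) (i : ℕ) :
    X ^ i ∣ invPoch e i * formalQPoch (X ^ e) (X ^ e) - 1 := by
  have h1 := X_pow_dvd_formalQPoch_sub (X ^ e : ℤ⟦X⟧) (X ^ e)
    (by simp [zero_pow (by omega : e ≠ 0)]) i
  have h2 := h1.mul_left (invPoch e i)
  rwa [mul_sub, mul_comm (invPoch e i) (∏ j ∈ range i, _), prod_mul_invPoch he] at h2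

/-- The two sums combine into $q^{em}$ times the increments of
$(1-q^{ei})/((q^e;q^e)_{i+m}(q^e;q^e)_i)$. This vanishes at $i=0$ and tends to
$1/(q^e;q^e)_\infty^2$, which the prefactor of `crankTail` cancels. -/
theorem crankTail_eq {e : ℕ} (he : 1 ≤ e) (A : ℤ⟦X⟧) (m : ℕ) :
    crankTail e A m = X ^ (e * m) * (A - crankTail e A (m + 1)) := by
  set P : ℤ⟦X⟧ := formalQPoch (X ^ e) (X ^ e) with hP
  rw [← sub_eq_zero]
  refine eq_zero_of_forall_X_pow_dvd fun N => ?_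
  have h1 := X_pow_dvd_crankTail_sub he A m N
  have h2 := (X_pow_dvd_crankTail_sub he A (m + 1) N).mul_left (X ^ (e * m))
  have h3 := X_pow_dvd_invPoch_mul_sub_one he N
  have h4 := (pow_dvd_pow X (by omega : N ≤ N + m)).trans (X_pow_dvd_invPoch_mul_sub_one he (N + m))
  have h5 : (X : ℤ⟦X⟧) ^ N ∣ X ^ (e * N) := pow_dvd_pow _ (Nat.le_mul_of_pos_left N he)
  have tel : ∑ i ∈ range N, X ^ (e * (i + m)) * invPoch e (i + m) * invPoch e i
      + X ^ (e * m) * ∑ i ∈ range N, X ^ (e * (i + (m + 1))) * invPoch e (i + (m + 1)) * invPoch e i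
      = X ^ (e * m) * (invPoch e (N + m) * (invPoch e N * (1 - X ^ (e * N)))) := by
    have := sum_range_sub (fun i => invPoch e (i + m) * (invPoch e i * (1 - X ^ (e * i)))) N
    simp only [mul_zero, pow_zero, sub_self, mul_zero, sub_zero] at this
    rw [← this, mul_sum, mul_sum, ← sum_add_distrib]
    refine sum_congr rfl fun i _ => ?_
    rw [invPoch_succ_mul he i, ← add_assoc, add_right_comm i 1 m,
      ← invPoch_succ_mul he (i + m)]
    have e1 : (X : ℤ⟦X⟧) ^ (e * (i + m)) = X ^ (e * i) * X ^ (e * m) := by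
      rw [← pow_add, mul_add]
    have e2 : (X : ℤ⟦X⟧) ^ (e * (i + m + 1)) = X ^ (e * i) * X ^ (e * m) * X ^ e := by
      rw [← pow_add, ← pow_add]; congr 1; ring
    rw [e1, e2]
    ring
  have h6 := dvd_sub (((h4.mul_right (invPoch e N * P)).add h3)) (h5.mul_left
    (invPoch e (N + m) * P * (invPoch e N * P)))
  have h7 := dvd_add (dvd_add h1 h2) (h6.mul_left (A * X ^ (e * m)))
  convert h7 using 1
  linear_combination A * P ^ 2 * tel

/-- Symmetry and tails of the coefficients of `A (q)_∞² / ((z q)_∞ (z⁻¹ q)_∞)`. -/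
theorem hasTails_zqCoeff {e : ℕ} (he : 1 ≤ e) {A : ℤ⟦X⟧} {F : ℤ[T;T⁻¹]⟦X⟧}
    (hF : F * (formalQPoch (fz * fq ^ e) (fq ^ e) * formalQPoch (fzInv * fq ^ e) (fq ^ e)) =
      constZ (A * formalQPoch (X ^ e) (X ^ e) ^ 2)) :
    ∃ U, HasTails (zqCoeff F) U ∧
      ∀ m, 1 ≤ m → U m = A * altTheta (fun n => e * n.choose 2) e m := by
  set D := A * formalQPoch (X ^ e) (X ^ e) ^ 2 with hD
  have hFE : F = constZ D * (eulerSeries e 1 * eulerSeries e (-1)) := by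
    have h1 := eulerSeries_mul_formalQPoch he 1
    have h2 := eulerSeries_mul_formalQPoch he (-1)
    rw [fz, fzInv, fq] at hF
    linear_combination (eulerSeries e 1 * eulerSeries e (-1)) * hF - F * eulerSeries e (-1) *
      formalQPoch (C (LaurentPolynomial.T (-1)) * X ^ e) (X ^ e) * h1 - F * h2
  set c : ℕ → ℤ⟦X⟧ := fun i => X ^ (e * i) * invPoch e i with hc
  have hcd : ∀ i, X ^ i ∣ c i := fun i =>
    Dvd.dvd.mul_right (pow_dvd_pow _ (Nat.le_mul_of_pos_left i he)) _
  have hrow : ∀ (m : ℤ) (N : ℕ), X ^ N ∣ zRow m F - ∑ i ∈ range N, ∑ j ∈ range N,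
      if (i : ℤ) - j = m then D * (c i * c j) else 0 := by
    intro m N
    rw [hFE]
    exact X_pow_dvd_zRow_mul_eulerSeries_sub he D m N
  have hdiff : ∀ m N : ℕ, X ^ N ∣ crankTail e A m - crankTail e A (m + 1) -
      D * ∑ j ∈ range N, c (j + m) * c j := by
    intro m N
    have h1 := X_pow_dvd_crankTail_sub he A m N
    have h2 := X_pow_dvd_crankTail_sub he A (m + 1) N
    -- The factor $1-q^{ei}$ turns $1/(q^e;q^e)_i$ into $1/(q^e;q^e)_{i-1}$, so the shifted tail
    -- telescopes against the original one, leaving $\sum_j c_{j+m}c_j$.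
    have tel : ∑ i ∈ range N, X ^ (e * (i + m)) * invPoch e (i + m) * invPoch e i
        - ∑ i ∈ range N, X ^ (e * (i + (m + 1))) * invPoch e (i + (m + 1)) * invPoch e i
        - ∑ j ∈ range N, c (j + m) * c j = - (c (N + m) * (invPoch e N * (1 - X ^ (e * N)))) := by
      have := sum_range_sub (fun i => c (i + m) * (invPoch e i * (1 - X ^ (e * i)))) N
      simp only [mul_zero, pow_zero, sub_self, mul_zero, sub_zero] at this
      rw [← this, ← sum_sub_distrib, ← sum_sub_distrib, ← sum_neg_distrib]
      refine sum_congr rfl fun i _ => ?_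
      rw [invPoch_succ_mul he i, ← add_assoc, add_right_comm i 1 m]
      simp only [hc]
      ring
    have h3 : X ^ N ∣ c (N + m) := (pow_dvd_pow _ (by omega)).trans (hcd _)
    have h4 := dvd_sub (dvd_sub h1 h2)
      ((h3.mul_right (invPoch e N * (1 - X ^ (e * N)))).mul_left D)
    convert h4 using 1
    rw [hD] at *
    linear_combination A * formalQPoch (X ^ e) (X ^ e) ^ 2 * tel
  have hsum : ∀ m N : ℕ, X ^ N ∣ (∑ i ∈ range N, ∑ j ∈ range N,
      if (i : ℤ) - j = m then D * (c i * c j) else 0) - D * ∑ j ∈ range N, c (j + m) * c j := by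
    intro m N
    rw [sum_comm, mul_sum, ← sum_sub_distrib]
    refine dvd_sum fun j _ => ?_
    have h1 : ∀ i : ℕ, ((i : ℤ) - j = m) ↔ i = j + m := fun i => by omega
    simp only [h1, sum_ite_eq', mem_range]
    split_ifs with h
    · simp
    · rw [zero_sub, dvd_neg]
      exact Dvd.dvd.mul_left (Dvd.dvd.mul_right ((pow_dvd_pow _ (by omega)).trans (hcd _)) _) _
  have hpos : ∀ m : ℕ, zRow m F = crankTail e A m - crankTail e A (m + 1) := by
    intro m
    rw [← sub_eq_zero]
    refine eq_zero_of_forall_X_pow_dvd fun N => ?_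
    have := dvd_sub (dvd_add (hrow m N) (hsum m N)) (hdiff m N)
    convert this using 1
    ring
  have hneg : ∀ m : ℕ, zRow (-m) F = crankTail e A m - crankTail e A (m + 1) := by
    intro m
    rw [← sub_eq_zero]
    refine eq_zero_of_forall_X_pow_dvd fun N => ?_
    have h1 := hrow (-m) N
    have h2 : (∑ i ∈ range N, ∑ j ∈ range N, if (i : ℤ) - j = -m then D * (c i * c j) else 0) =
        ∑ i ∈ range N, ∑ j ∈ range N, if (i : ℤ) - j = m then D * (c i * c j) else 0 := by
      rw [sum_comm]
      refine sum_congr rfl fun i _ => sum_congr rfl fun j _ => ?_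
      exact if_congr (by omega) (by ring) rfl
    rw [h2] at h1
    have := dvd_sub (dvd_add h1 (hsum m N)) (hdiff m N)
    convert this using 1
    ring
  refine ⟨crankTail e A, ⟨fun m _ n => ?_, fun m _ n => ?_, fun m _ => ?_⟩, fun m hm => ?_⟩
  · rw [← coeff_zRow, hpos, map_sub]
  · rw [← coeff_zRow, hneg, map_sub]
  · rw [crankTail_eq he]
    exact Dvd.dvd.mul_right (pow_dvd_pow _ (Nat.le_mul_of_pos_left m he)) _
  · refine eq_mul_altTheta (b := 0) (d := 1) he (by simp) (fun n _ => ?_)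
      (fun m _ => crankTail_eq he A m) hm
    rw [Nat.choose_succ_succ', Nat.choose_one_right]; ring

theorem constZ_formalQPoch (a b : ℤ⟦X⟧) :
    constZ (formalQPoch a b) = formalQPoch (constZ a) (constZ b) :=
  map_formalQPoch _ _ _

theorem exists_hasTails_crankBar : ∃ U, HasTails crankBar U ∧ ∀ m, 1 ≤ m →
    U m = totalGF Overpartition * altTheta (fun n => 1 * n.choose 2) 1 m := by
  refine hasTails_zqCoeff le_rfl ?_
  simp only [pow_one]
  have h1 := congrArg constZ totalGF_overpartition_mul
  rw [crankBarGF, formalDiv_mul_cancel]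
  · simp only [map_mul, map_pow, constZ_formalQPoch, map_neg, constZ_X] at h1 ⊢
    rw [fq]
    linear_combination - formalQPoch X X * h1
  · rw [map_mul, constantCoeff_formalQPoch _ _ (by simp [fq]),
      constantCoeff_formalQPoch _ _ (by simp [fq]), one_mul]

/-- By $(q;q)_\infty=(q;q^2)_\infty(q^2;q^2)_\infty$, the numerator divided by $(q;q^2)_\infty$ is
$A(q^2;q^2)_\infty^2$, the shape needed in `hasTails_zqCoeff`. -/
theorem exists_hasTails_crank2Bar : ∃ U, HasTails crank2Bar U ∧ ∀ m, 1 ≤ m →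
    U m = totalGF Overpartition * altTheta (fun n => 2 * n.choose 2) 2 m := by
  refine hasTails_zqCoeff (by norm_num) ?_
  have h1 := congrArg constZ totalGF_overpartition_mul
  have h2 := formalDiv_mul_cancel (formalQPoch (-fq) fq * formalQPoch (fq ^ 2) (fq ^ 2))
    (formalQPoch fq (fq ^ 2) *
      (formalQPoch (fz * fq ^ 2) (fq ^ 2) * formalQPoch (fzInv * fq ^ 2) (fq ^ 2))) (by
      rw [map_mul, map_mul, constantCoeff_formalQPoch _ _ (by simp [fq]),
        constantCoeff_formalQPoch _ _ (by simp [fq]), constantCoeff_formalQPoch _ _ (by simp [fq]),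
        one_mul, one_mul])
  have h3 := formalQPoch_X_X_eq (R := ℤ[T;T⁻¹])
  have h4 : formalQPoch (fq : ℤ[T;T⁻¹]⟦X⟧) (fq ^ 2) * invOfUnit (formalQPoch fq (fq ^ 2)) 1 = 1 :=
    mul_invOfUnit _ _ (by simp [constantCoeff_formalQPoch, fq])
  simp only [map_mul, map_pow, constZ_formalQPoch, map_neg, constZ_X] at h1 ⊢
  rw [crank2BarGF]
  simp only [fq] at h2 h4 ⊢
  rw [← h3] at h1
  linear_combination invOfUnit (formalQPoch X (X ^ 2)) 1 * h2
    - invOfUnit (formalQPoch X (X ^ 2)) 1 * formalQPoch (X ^ 2) (X ^ 2) * h1 +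
    (constZ (totalGF Overpartition) * formalQPoch (X ^ 2) (X ^ 2) ^ 2
      - formalDiv (formalQPoch (-X) X * formalQPoch (X ^ 2) (X ^ 2)) (formalQPoch X (X ^ 2) *
      (formalQPoch (fz * X ^ 2) (X ^ 2) * formalQPoch (fzInv * X ^ 2) (X ^ 2))) *
      (formalQPoch (fz * X ^ 2) (X ^ 2) * formalQPoch (fzInv * X ^ 2) (X ^ 2))) * h4

theorem exists_hasTails_crank2 : ∃ U, HasTails crank2 U ∧ ∀ m, 1 ≤ m →
    U m = totalGF OddDistinctPartition * altTheta (fun n => 2 * n.choose 2) 2 m := by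
  refine hasTails_zqCoeff (by norm_num) ?_
  have h1 := congrArg constZ totalGF_oddDistinctPartition_mul
  rw [crank2GF, formalDiv_mul_cancel]
  · simp only [map_mul, map_pow, constZ_formalQPoch, map_neg, constZ_X] at h1 ⊢
    rw [fq]
    linear_combination - formalQPoch (X ^ 2) (X ^ 2) * h1
  · rw [map_mul, constantCoeff_formalQPoch _ _ (by simp [fq]),
      constantCoeff_formalQPoch _ _ (by simp [fq]), one_mul]

end CrankTails

/-! ### Symmetrized moments by summation by parts -/

section Moments

open PowerSeries Finset

theorem ring_choose_of_pos {k : ℕ} (hk : 1 ≤ k) (m : ℕ) :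
    Ring.choose ((m : ℤ) + (((2 * k : ℕ) : ℤ) - 1) / 2) (2 * k) =
      ((m + k - 1).choose (2 * k) : ℤ) := by
  have : (m : ℤ) + (((2 * k : ℕ) : ℤ) - 1) / 2 = ((m + k - 1 : ℕ) : ℤ) := by omega
  rw [this, Ring.choose_natCast]

/-- Here $\lfloor(2k-1)/2\rfloor=k-1$, and $\binom{-x}{2k}=\binom{x+2k-1}{2k}$ carries no sign since
$2k$ is even. -/
theorem ring_choose_of_neg (k m : ℕ) :
    Ring.choose (-(m : ℤ) + (((2 * k : ℕ) : ℤ) - 1) / 2) (2 * k) =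
      ((m + k).choose (2 * k) : ℤ) := by
  have h1 : -(m : ℤ) + (((2 * k : ℕ) : ℤ) - 1) / 2 = -((m : ℤ) - k + 1) := by omega
  have h2 : (m : ℤ) - k + 1 + (2 * k : ℕ) - 1 = ((m + k : ℕ) : ℤ) := by push_cast; ring
  rw [h1, Ring.choose_neg, h2, Ring.choose_natCast]
  simp [Int.negOnePow_even]

theorem sum_Icc_neg_natCast (f : ℤ → ℤ) (n : ℕ) :
    ∑ m ∈ Icc (-(n : ℤ)) n, f m =
      f 0 + ∑ i ∈ range n, (f ((i + 1 : ℕ) : ℤ) + f (-((i + 1 : ℕ) : ℤ))) := by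
  induction n with
  | zero => simp
  | succ n ih =>
    have : Icc (-((n + 1 : ℕ) : ℤ)) ((n + 1 : ℕ) : ℤ) =
        insert ((n + 1 : ℕ) : ℤ) (insert (-((n + 1 : ℕ) : ℤ)) (Icc (-(n : ℤ)) n)) := by
      ext x
      simp only [mem_Icc, mem_insert]
      omega
    rw [this, sum_insert, sum_insert, ih, sum_range_succ]
    · ring
    · simp only [mem_Icc]; omega
    · simp only [mem_Icc, mem_insert]; omega

/-- The symmetrized moments in terms of the tails. -/
theorem HasTails.symMoment_eq {N : ℤ → ℕ → ℤ} {U : ℕ → ℤ⟦X⟧} (h : HasTails N U) {k : ℕ}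
    (hk : 1 ≤ k) (n : ℕ) :
    symMoment N (2 * k) n =
      ∑ i ∈ range n, ((i + k).choose (2 * k - 1) : ℤ) * coeff n (U (i + 1) + U (i + 2)) := by
  have hz : ∀ m : ℕ, n < m → coeff n (U m) = 0 := fun m hm =>
    X_pow_dvd_iff.1 (h.dvd m (by omega)) n hm
  have hsupp : (Function.support fun m : ℤ =>
      Ring.choose (m + (((2 * k : ℕ) : ℤ) - 1) / 2) (2 * k) * N m n) ⊆
      ((Icc (-(n : ℤ)) n : Finset ℤ) : Set ℤ) := by
    intro m hm
    by_contra hc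
    refine hm ?_
    have hc : ¬ (-(n : ℤ) ≤ m ∧ m ≤ n) := by simpa using hc
    have hN : N m n = 0 := by
      rcases le_or_gt 0 m with h0 | h0
      · obtain ⟨j, rfl⟩ := Int.eq_ofNat_of_zero_le h0
        rw [h.pos j (by omega), hz _ (by omega), hz _ (by omega), sub_zero]
      · obtain ⟨j, hj⟩ : ∃ j : ℕ, m = -(j : ℤ) := ⟨m.natAbs, by omega⟩
        rw [hj, h.neg j (by omega), hz _ (by omega), hz _ (by omega), sub_zero]
    simp [hN]
  rw [symMoment, finsum_eq_sum_of_support_subset _ hsupp, sum_Icc_neg_natCast]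
  have h0 : Ring.choose ((0 : ℤ) + (((2 * k : ℕ) : ℤ) - 1) / 2) (2 * k) = 0 := by
    have := ring_choose_of_pos hk 0
    rw [Nat.cast_zero] at this
    rw [this, Nat.choose_eq_zero_of_lt (by omega), Nat.cast_zero]
  rw [h0, zero_mul, zero_add]
  -- The values at $\pm(i+1)$ have total weight
  -- $\binom{i+k}{2k}+\binom{i+k+1}{2k}=2\binom{i+k}{2k}+\binom{i+k}{2k-1}$. Telescoping
  -- $2\binom{i+k}{2k}U_{i+1}$ leaves only the last binomial.
  have tel := sum_range_sub
    (fun i => 2 * ((i + k).choose (2 * k) : ℤ) * coeff n (U (i + 1))) n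
  rw [hz (n + 1) (by omega), zero_add, Nat.choose_eq_zero_of_lt (by omega : k < 2 * k),
    Nat.cast_zero, mul_zero, mul_zero, zero_mul, sub_zero] at tel
  rw [← sub_eq_zero, ← sum_sub_distrib, ← neg_eq_zero, ← tel, ← sum_neg_distrib]
  refine sum_congr rfl fun i _ => ?_
  rw [ring_choose_of_pos hk, ring_choose_of_neg, h.pos (i + 1) (by omega),
    h.neg (i + 1) (by omega), map_add]
  have e1 : i + 1 + k - 1 = i + k := by omega
  have e2 : (i + 1 + k).choose (2 * k) = (i + k).choose (2 * k - 1) + (i + k).choose (2 * k) := by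
    have : 2 * k = 2 * k - 1 + 1 := by omega
    rw [this, add_right_comm i 1 k, Nat.choose_succ_succ', Nat.add_sub_cancel]
  rw [e1, e2]
  push_cast
  ring

/-- The series `∑_{n, m ≥ 1} (-1)^(n+1) binom(m+k-1, 2k-1) q^(a n + e n m)`. -/
noncomputable def momentSeries (a : ℕ → ℕ) (e k : ℕ) : ℤ⟦X⟧ :=
  PowerSeries.mk fun j => ∑ i ∈ range j,
    ((i + k).choose (2 * k - 1) : ℤ) * coeff j (altTheta a e (i + 1))

theorem coeff_altTheta_eq_zero {a : ℕ → ℕ} {e m j : ℕ} (he : 1 ≤ e) (h : j < m) :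
    coeff j (altTheta a e m) = 0 := by
  rw [altTheta, coeff_mk]
  refine sum_eq_zero fun n _ => if_neg ?_
  have : 1 * 1 * m ≤ e * (n + 1) * m := by gcongr; omega
  omega

theorem sum_choose_mul_coeff_mul_altTheta {a : ℕ → ℕ} {e : ℕ} (he : 1 ≤ e) (k : ℕ) (B : ℤ⟦X⟧)
    (n : ℕ) :
    ∑ i ∈ range n, ((i + k).choose (2 * k - 1) : ℤ) * coeff n (B * altTheta a e (i + 1)) =
      coeff n (B * momentSeries a e k) := by
  simp only [coeff_mul, mul_sum]
  rw [sum_comm]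
  refine sum_congr rfl fun p hp => ?_
  have hp2 : p.2 ≤ n := by have := mem_antidiagonal.1 hp; omega
  rw [momentSeries, coeff_mk, mul_sum]
  refine (sum_subset (range_subset_range.2 hp2) fun i _ hi => ?_).symm.trans ?_
  · have : p.2 ≤ i := by simpa using hi
    rw [coeff_altTheta_eq_zero he (by omega)]
    ring
  · exact sum_congr rfl fun i _ => by ring

/-- Passing from $U_m$ to $U_{m+1}$ multiplies the $n$-th term by $q^{en}$; this is the origin of
the factor $1+q^{en}$ in the one-sided sums. -/
theorem altTheta_succ (a : ℕ → ℕ) (e m : ℕ) :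
    altTheta a e (m + 1) = altTheta (fun n => a n + e * n) e m := by
  ext j
  rw [altTheta, altTheta, coeff_mk, coeff_mk]
  exact sum_congr rfl fun n _ => if_congr (by constructor <;> intro h <;> rw [← h] <;> ring) rfl rfl

theorem HasTails.symMoment_eq_of_add {N : ℤ → ℕ → ℤ} {U : ℕ → ℤ⟦X⟧} (h : HasTails N U) {k : ℕ}
    (hk : 1 ≤ k) {B : ℤ⟦X⟧} {a : ℕ → ℕ} {e : ℕ} (he : 1 ≤ e)
    (hU : ∀ m, 1 ≤ m → U m + U (m + 1) = B * altTheta a e m) (n : ℕ) :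
    symMoment N (2 * k) n = coeff n (B * momentSeries a e k) := by
  rw [h.symMoment_eq hk, ← sum_choose_mul_coeff_mul_altTheta he]
  exact sum_congr rfl fun i _ => by rw [← hU (i + 1) (by omega)]

theorem HasTails.symMoment_eq_of_eq {N : ℤ → ℕ → ℤ} {U : ℕ → ℤ⟦X⟧} (h : HasTails N U) {k : ℕ}
    (hk : 1 ≤ k) {B : ℤ⟦X⟧} {a : ℕ → ℕ} {e : ℕ} (he : 1 ≤ e)
    (hU : ∀ m, 1 ≤ m → U m = B * altTheta a e m) (n : ℕ) :
    symMoment N (2 * k) n =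
      coeff n (B * (momentSeries a e k + momentSeries (fun n => a n + e * n) e k)) := by
  rw [h.symMoment_eq hk, mul_add, map_add, ← sum_choose_mul_coeff_mul_altTheta he,
    ← sum_choose_mul_coeff_mul_altTheta he, ← sum_add_distrib]
  refine sum_congr rfl fun i _ => ?_
  rw [hU (i + 1) (by omega), hU (i + 2) (by omega), altTheta_succ a e (i + 1), map_add, mul_add]

end Moments

/-! ### Evaluating integral power series in the unit disc -/

section Evaluation

open PowerSeries Finset Filter Topology

/-- The integral power series `f` converges absolutely at `q`, with value `v`. -/
def HasValue (f : ℤ⟦X⟧) (q v : ℂ) : Prop :=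
  HasSum (fun n => ((coeff n f : ℤ) : ℂ) * q ^ n) v

theorem HasValue.unique {f : ℤ⟦X⟧} {q u v : ℂ} (hu : HasValue f q u) (hv : HasValue f q v) :
    u = v := HasSum.unique hu hv

theorem HasValue.add {f g : ℤ⟦X⟧} {q u v : ℂ} (hf : HasValue f q u) (hg : HasValue g q v) :
    HasValue (f + g) q (u + v) := by
  have := HasSum.add hf hg
  simpa only [HasValue, map_add, Int.cast_add, add_mul] using this

theorem hasValue_C_mul_X_pow (c : ℤ) (s : ℕ) (q : ℂ) : HasValue (C c * X ^ s) q (c * q ^ s) := by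
  have : (fun n => ((coeff n (C c * X ^ s : ℤ⟦X⟧) : ℤ) : ℂ) * q ^ n) =
      fun n => if n = s then (c : ℂ) * q ^ s else 0 := by
    funext n
    rw [coeff_C_mul, coeff_X_pow]
    split_ifs with h <;> simp [h]
  rw [HasValue, this]
  exact hasSum_ite_eq s _

theorem hasValue_one (q : ℂ) : HasValue 1 q 1 := by
  simpa using hasValue_C_mul_X_pow 1 0 q

theorem HasValue.mul {f g : ℤ⟦X⟧} {q u v : ℂ} (hf : HasValue f q u) (hg : HasValue g q v) :
    HasValue (f * g) q (u * v) := by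
  have h1 := HasSum.summable hf |>.norm
  have h2 := HasSum.summable hg |>.norm
  have h3 : (fun n => ((coeff n (f * g) : ℤ) : ℂ) * q ^ n) = fun n => ∑ p ∈ antidiagonal n,
      (((coeff p.1 f : ℤ) : ℂ) * q ^ p.1) * (((coeff p.2 g : ℤ) : ℂ) * q ^ p.2) := by
    funext n
    rw [coeff_mul, Int.cast_sum, sum_mul]
    refine sum_congr rfl fun p hp => ?_
    rw [← mem_antidiagonal.1 hp, pow_add]
    push_cast
    ring
  rw [HasValue, h3, ← HasSum.tsum_eq hf, ← HasSum.tsum_eq hg,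
    tsum_mul_tsum_eq_tsum_sum_antidiagonal_of_summable_norm h1 h2]
  exact (summable_norm_sum_mul_antidiagonal_of_summable_norm h1 h2).of_norm.hasSum

theorem hasValue_prod {f : ℕ → ℤ⟦X⟧} {q : ℂ} {v : ℕ → ℂ} (h : ∀ j, HasValue (f j) q (v j))
    (N : ℕ) : HasValue (∏ j ∈ range N, f j) q (∏ j ∈ range N, v j) := by
  induction N with
  | zero => simpa using hasValue_one q
  | succ N ih =>
    rw [prod_range_succ, prod_range_succ]
    exact ih.mul (h N)

/-- The weighted `ℓ¹` norm of the truncation of a power series. -/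
noncomputable def truncNorm (ρ : ℝ) (K : ℕ) (f : ℤ⟦X⟧) : ℝ :=
  ∑ n ∈ range K, |((coeff n f : ℤ) : ℝ)| * ρ ^ n

theorem truncNorm_nonneg {ρ : ℝ} (hρ : 0 ≤ ρ) (K : ℕ) (f : ℤ⟦X⟧) : 0 ≤ truncNorm ρ K f :=
  sum_nonneg fun _ _ => by positivity

theorem truncNorm_add_le {ρ : ℝ} (hρ : 0 ≤ ρ) (K : ℕ) (f g : ℤ⟦X⟧) :
    truncNorm ρ K (f + g) ≤ truncNorm ρ K f + truncNorm ρ K g := by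
  rw [truncNorm, truncNorm, truncNorm, ← sum_add_distrib]
  refine sum_le_sum fun n _ => ?_
  rw [← add_mul, map_add, Int.cast_add]
  gcongr
  exact abs_add_le _ _

theorem truncNorm_C_mul_X_pow_le {ρ : ℝ} (hρ : 0 ≤ ρ) (K : ℕ) (c : ℤ) (s : ℕ) :
    truncNorm ρ K (C c * X ^ s) ≤ |(c : ℝ)| * ρ ^ s := by
  have : ∀ n ∈ range K, |((coeff n (C c * X ^ s : ℤ⟦X⟧) : ℤ) : ℝ)| * ρ ^ n =
      if s = n then |(c : ℝ)| * ρ ^ s else 0 := by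
    intro n _
    rw [coeff_C_mul, coeff_X_pow]
    rcases eq_or_ne s n with h | h
    · simp [h]
    · simp [h, h.symm]
  rw [truncNorm, sum_congr rfl this, sum_ite_eq]
  split_ifs
  · exact le_rfl
  · positivity

theorem truncNorm_mul_le {ρ : ℝ} (hρ : 0 ≤ ρ) (K : ℕ) (f g : ℤ⟦X⟧) :
    truncNorm ρ K (f * g) ≤ truncNorm ρ K f * truncNorm ρ K g := by
  set u : ℕ → ℝ := fun n => |((coeff n f : ℤ) : ℝ)| * ρ ^ n with hu
  set v : ℕ → ℝ := fun n => |((coeff n g : ℤ) : ℝ)| * ρ ^ n with hv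
  have h1 : ∀ n, |((coeff n (f * g) : ℤ) : ℝ)| * ρ ^ n ≤ ∑ p ∈ antidiagonal n, u p.1 * v p.2 := by
    intro n
    have : ∑ p ∈ antidiagonal n, u p.1 * v p.2 =
        (∑ p ∈ antidiagonal n, |((coeff p.1 f : ℤ) : ℝ) * ((coeff p.2 g : ℤ) : ℝ)|) * ρ ^ n := by
      rw [sum_mul]
      refine sum_congr rfl fun p hp => ?_
      rw [← mem_antidiagonal.1 hp, pow_add, abs_mul, hu, hv]
      ring
    rw [this, coeff_mul, Int.cast_sum]
    gcongr
    push_cast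
    exact abs_sum_le_sum_abs _ _
  have h2 : truncNorm ρ K f * truncNorm ρ K g = ∑ p ∈ range K ×ˢ range K, u p.1 * v p.2 := by
    rw [truncNorm, truncNorm, sum_mul_sum, sum_product]
  have h3 : ∑ n ∈ range K, ∑ p ∈ antidiagonal n, u p.1 * v p.2 =
      ∑ p ∈ (range K).biUnion antidiagonal, u p.1 * v p.2 := by
    refine (sum_biUnion fun i _ j _ hij => disjoint_left.2 fun p hp hq => hij ?_).symm
    rw [← mem_antidiagonal.1 hp, mem_antidiagonal.1 hq]
  refine (sum_le_sum fun n _ => h1 n).trans ?_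
  rw [h2, h3]
  refine sum_le_sum_of_subset_of_nonneg (fun p hp => ?_) fun p _ _ => by positivity
  obtain ⟨n, hn, hp⟩ := mem_biUnion.1 hp
  have := mem_antidiagonal.1 hp
  have := mem_range.1 hn
  simp only [mem_product, mem_range]
  omega

theorem abs_coeff_le_of_truncNorm_le {ρ M : ℝ} (hρ : 0 < ρ) {f : ℤ⟦X⟧}
    (h : ∀ K, truncNorm ρ K f ≤ M) (n : ℕ) : |((coeff n f : ℤ) : ℝ)| ≤ M / ρ ^ n := by
  rw [le_div_iff₀ (pow_pos hρ n)]
  exact (single_le_sum (f := fun n => |((coeff n f : ℤ) : ℝ)| * ρ ^ n) (fun i _ => by positivity)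
    (self_mem_range_succ n)).trans (h (n + 1))

theorem norm_coeff_mul_pow_le {ρ M : ℝ} (hρ : 0 < ρ) {f : ℤ⟦X⟧} {q : ℂ} {n : ℕ}
    (h : |((coeff n f : ℤ) : ℝ)| ≤ M / ρ ^ n) :
    ‖((coeff n f : ℤ) : ℂ) * q ^ n‖ ≤ M * (‖q‖ / ρ) ^ n := by
  rw [norm_mul, norm_pow, Complex.norm_intCast, div_pow, ← mul_div_assoc, mul_div_right_comm]
  gcongr

theorem summable_bound {ρ M : ℝ} {q : ℂ} (hq : ‖q‖ < ρ) :
    Summable fun n => M * (‖q‖ / ρ) ^ n := by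
  have hρ : 0 < ρ := (norm_nonneg q).trans_lt hq
  exact (summable_geometric_of_lt_one (by positivity) ((div_lt_one hρ).2 hq)).mul_left M

/-- Values pass to `X`-adic limits of uniformly bounded power series. -/
theorem hasValue_of_tendsto {ρ M : ℝ} {q v : ℂ} (hq : ‖q‖ < ρ) {f : ℤ⟦X⟧} {g : ℕ → ℤ⟦X⟧}
    {w : ℕ → ℂ} (hdvd : ∀ N, X ^ N ∣ f - g N) (hM : ∀ N K, truncNorm ρ K (g N) ≤ M)
    (hg : ∀ N, HasValue (g N) q (w N)) (hw : Tendsto w atTop (𝓝 v)) : HasValue f q v := by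
  have hρ : 0 < ρ := (norm_nonneg q).trans_lt hq
  have hco : ∀ n N, n < N → coeff n f = coeff n (g N) := fun n N h =>
    X_pow_dvd_sub_iff.1 (hdvd N) n h
  have hsum : Summable fun n => ((coeff n f : ℤ) : ℂ) * q ^ n :=
    Summable.of_norm_bounded (summable_bound (M := M) hq) fun n => norm_coeff_mul_pow_le hρ (by
      rw [hco n (n + 1) (by omega)]
      exact abs_coeff_le_of_truncNorm_le hρ (hM (n + 1)) n)
  have hlim : Tendsto (fun N => ∑' n, ((coeff n (g N) : ℤ) : ℂ) * q ^ n) atTop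
      (𝓝 (∑' n, ((coeff n f : ℤ) : ℂ) * q ^ n)) := by
    refine tendsto_tsum_of_dominated_convergence (summable_bound (M := M) hq) (fun n => ?_)
      (Eventually.of_forall fun N n =>
        norm_coeff_mul_pow_le hρ (abs_coeff_le_of_truncNorm_le hρ (hM N) n))
    refine tendsto_const_nhds.congr' ?_
    filter_upwards [eventually_gt_atTop n] with N hN
    rw [hco n N hN]
  have hv : v = ∑' n, ((coeff n f : ℤ) : ℂ) * q ^ n :=
    tendsto_nhds_unique hw (hlim.congr fun N => (hg N).tsum_eq)
  rw [HasValue, hv]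
  exact hsum.hasSum

theorem prod_le_exp {ρ c : ℝ} (hρ : 0 ≤ ρ) (hρ1 : ρ < 1) (hc : 0 ≤ c) {e b : ℕ} (he : 1 ≤ e)
    (N : ℕ) :
    ∏ j ∈ range N, (1 + c * ρ ^ (b + e * j)) ≤ Real.exp (c * (1 - ρ)⁻¹) := by
  calc ∏ j ∈ range N, (1 + c * ρ ^ (b + e * j)) ≤ ∏ j ∈ range N, Real.exp (c * ρ ^ j) := by
        refine prod_le_prod (fun j _ => by positivity) fun j _ => ?_
        refine (add_comm _ _).trans_le ((add_le_add_left ?_ 1).trans (Real.add_one_le_exp _))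
        refine mul_le_mul_of_nonneg_left (pow_le_pow_of_le_one hρ hρ1.le ?_) hc
        have := Nat.le_mul_of_pos_left j he
        omega
    _ = Real.exp (c * ∑ j ∈ range N, ρ ^ j) := by rw [← Real.exp_sum, mul_sum]
    _ ≤ _ := by
        rw [← tsum_geometric_of_lt_one hρ hρ1]
        gcongr
        exact (summable_geometric_of_lt_one hρ hρ1).sum_le_tsum _ fun _ _ => by positivity

theorem truncNorm_prod_le {ρ : ℝ} (hρ : 0 ≤ ρ) (K : ℕ) {f : ℕ → ℤ⟦X⟧} {c : ℕ → ℝ}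
    (h : ∀ j, truncNorm ρ K (f j) ≤ c j) (N : ℕ) :
    truncNorm ρ K (∏ j ∈ range N, f j) ≤ ∏ j ∈ range N, c j := by
  induction N with
  | zero => simpa using truncNorm_C_mul_X_pow_le hρ K 1 0
  | succ N ih =>
    rw [prod_range_succ, prod_range_succ]
    refine (truncNorm_mul_le hρ K _ _).trans ?_
    exact mul_le_mul ih (h N) (truncNorm_nonneg hρ K _) ((truncNorm_nonneg hρ K _).trans ih)

theorem hasValue_formalQPoch {q : ℂ} (hq : ‖q‖ < 1) (c : ℤ) (hc : |c| = 1) (b : ℕ) {e : ℕ}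
    (he : 1 ≤ e) :
    HasValue (formalQPoch (C c * X ^ b) (X ^ e)) q (qPoch (c * q ^ b) (q ^ e)) := by
  obtain ⟨ρ, hqρ, hρ1⟩ := exists_between hq
  have hρ : 0 ≤ ρ := (norm_nonneg q).trans hqρ.le
  have hfac : ∀ j, (1 : ℤ⟦X⟧) - C c * X ^ b * (X ^ e) ^ j =
      C 1 * X ^ 0 + C (-c) * X ^ (b + e * j) := fun j => by
    rw [map_neg, map_one, pow_add, pow_mul]; ring
  have hqe : ‖q ^ e‖ < 1 := by
    rw [norm_pow]; exact pow_lt_one₀ (norm_nonneg q) hq (by omega)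
  refine hasValue_of_tendsto (M := Real.exp (1 * (1 - ρ)⁻¹)) hqρ
    (fun N => X_pow_dvd_formalQPoch_sub _ _ (by simp [zero_pow (by omega : e ≠ 0)]) N)
    (fun N K => (truncNorm_prod_le hρ K (fun j => ?_) N).trans
      (prod_le_exp (b := b) hρ hρ1 zero_le_one he N))
    (fun N => hasValue_prod (fun j => ?_) N)
    (multipliable_qPoch _ _ hqe).hasProd.tendsto_prod_nat
  · rw [hfac]
    refine (truncNorm_add_le hρ K _ _).trans (add_le_add
      ((truncNorm_C_mul_X_pow_le hρ K 1 0).trans (by simp))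
      ((truncNorm_C_mul_X_pow_le hρ K _ _).trans_eq ?_))
    rw [← Int.cast_abs, abs_neg, hc, Int.cast_one]
  · rw [hfac]
    convert (hasValue_C_mul_X_pow 1 0 q).add (hasValue_C_mul_X_pow (-c) (b + e * j) q) using 1
    push_cast
    rw [pow_add, pow_mul]
    ring

/-- With $g=1/(q^e;q^e)_{N+1}$ and $x=\rho^{e(N+1)}$, the recursion bounds $(1-x)\|g\|$ by the norm
of the previous inverse, and $1/(1-x)\le1+x/(1-\rho)$ because $x\le\rho$. Truncation keeps the norms
finite, so subtracting $x\|g\|$ is legitimate. -/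
theorem truncNorm_invPoch_le {ρ : ℝ} (hρ : 0 ≤ ρ) (hρ1 : ρ < 1) {e : ℕ} (he : 1 ≤ e) (N K : ℕ) :
    truncNorm ρ K (invPoch e N) ≤ ∏ j ∈ range N, (1 + (1 - ρ)⁻¹ * ρ ^ (e + e * j)) := by
  have h0 : 0 < 1 - ρ := by linarith
  induction N with
  | zero => simpa [invPoch_zero e he] using truncNorm_C_mul_X_pow_le hρ K 1 0
  | succ N ih =>
    set g := invPoch e (N + 1) with hg
    have h1 : g = invPoch e N + C 1 * X ^ (e + e * N) * g := by
      have := invPoch_succ_mul he N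
      rw [map_one, one_mul, ← this, ← hg, Nat.mul_succ, add_comm e]
      ring
    have h2 : truncNorm ρ K g ≤ truncNorm ρ K (invPoch e N) +
        ρ ^ (e + e * N) * truncNorm ρ K g := by
      conv_lhs => rw [h1]
      refine (truncNorm_add_le hρ K _ _).trans ?_
      gcongr
      refine (truncNorm_mul_le hρ K _ _).trans ?_
      have := truncNorm_C_mul_X_pow_le hρ K 1 (e + e * N)
      rw [Int.cast_one, abs_one, one_mul] at this
      exact mul_le_mul_of_nonneg_right this (truncNorm_nonneg hρ K _)
    set x := ρ ^ (e + e * N) with hx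
    have hx0 : 0 ≤ x := by positivity
    have hxρ : x ≤ ρ := pow_le_of_le_one hρ hρ1.le (by omega)
    have h3 : (1 : ℝ) ≤ (1 + (1 - ρ)⁻¹ * x) * (1 - x) := by
      have : (1 + (1 - ρ)⁻¹ * x) * (1 - x) = 1 + x * (1 - ρ)⁻¹ * (ρ - x) := by
        field_simp
        ring
      rw [this]
      have : 0 ≤ x * (1 - ρ)⁻¹ * (ρ - x) := mul_nonneg (by positivity) (by linarith)
      linarith
    rw [prod_range_succ]
    have hT := truncNorm_nonneg hρ K g
    calc truncNorm ρ K g ≤ truncNorm ρ K g * ((1 + (1 - ρ)⁻¹ * x) * (1 - x)) :=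
          le_mul_of_one_le_right hT h3
      _ = (truncNorm ρ K g * (1 - x)) * (1 + (1 - ρ)⁻¹ * x) := by ring
      _ ≤ _ := by
          refine mul_le_mul_of_nonneg_right (le_trans ?_ ih) (by positivity)
          linarith

/-- The $n$-th coefficient of the inverse product is that of `invPoch e (n + 1)`, whose norms are
uniformly bounded; hence the inverse series converges. Its value times the infinite product is $1$,
which also shows that the latter is nonzero. -/
theorem HasValue.div_formalQPoch {q u : ℂ} (hq : ‖q‖ < 1) {e : ℕ} (he : 1 ≤ e) {T P : ℤ⟦X⟧}
    (hT : T * formalQPoch (X ^ e) (X ^ e) = P) (hP : HasValue P q u) :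
    HasValue T q (u / qPoch (q ^ e) (q ^ e)) := by
  obtain ⟨ρ, hqρ, hρ1⟩ := exists_between hq
  have hρ : 0 < ρ := (norm_nonneg q).trans_lt hqρ
  have hD : HasValue (formalQPoch (X ^ e) (X ^ e)) q (qPoch (q ^ e) (q ^ e)) := by
    simpa using hasValue_formalQPoch hq 1 (by simp) e he
  set I : ℤ⟦X⟧ := invOfUnit (formalQPoch (X ^ e) (X ^ e)) 1 with hI
  have hDI : formalQPoch (X ^ e) (X ^ e) * I = 1 :=
    mul_invOfUnit _ _ (by simp [constantCoeff_formalQPoch, zero_pow (by omega : e ≠ 0)])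
  have hco : ∀ n, coeff n I = coeff n (invPoch e (n + 1)) := fun n => by
    refine (X_pow_dvd_sub_iff.1 ?_ n n.lt_succ_self).symm
    have := (X_pow_dvd_invPoch_mul_sub_one he (n + 1)).mul_right I
    rwa [sub_mul, one_mul, mul_assoc, hDI, mul_one] at this
  have hsum : Summable fun n => ((coeff n I : ℤ) : ℂ) * q ^ n :=
    Summable.of_norm_bounded (summable_bound hqρ) fun n => norm_coeff_mul_pow_le hρ (by
      rw [hco]
      exact abs_coeff_le_of_truncNorm_le hρ (fun K => (truncNorm_invPoch_le hρ.le hρ1 he _ K).trans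
        (prod_le_exp hρ.le hρ1 (inv_nonneg.2 (by linarith)) he _)) n)
  have hIv : HasValue I q _ := hsum.hasSum
  have h1 := (hD.mul hIv).unique (by rw [hDI]; exact hasValue_one q)
  rw [div_eq_mul_inv, ← eq_inv_of_mul_eq_one_right h1]
  have : T = P * I := by rw [← hT, mul_assoc, hDI, mul_one]
  rw [this]
  exact hP.mul hIv

theorem hasValue_totalGF_overpartition {q : ℂ} (hq : ‖q‖ < 1) :
    HasValue (totalGF Overpartition) q (qPoch (-q) q / qPoch q q) := by
  have h1 := hasValue_formalQPoch hq (-1) (by simp) 1 le_rfl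
  have h2 := totalGF_overpartition_mul
  simp only [pow_one, map_neg, map_one, neg_mul, one_mul, Int.cast_neg, Int.cast_one] at h1
  simpa using HasValue.div_formalQPoch hq le_rfl (by simpa using h2) h1

theorem hasValue_totalGF_oddDistinctPartition {q : ℂ} (hq : ‖q‖ < 1) :
    HasValue (totalGF OddDistinctPartition) q (qPoch (-q) (q ^ 2) / qPoch (q ^ 2) (q ^ 2)) := by
  have h1 := hasValue_formalQPoch hq (-1) (by simp) 1 one_le_two
  simp only [pow_one, map_neg, map_one, neg_mul, one_mul, Int.cast_neg, Int.cast_one] at h1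
  exact HasValue.div_formalQPoch hq one_le_two totalGF_oddDistinctPartition_mul h1

end Evaluation

/-! ### Lambert-type sums for the moments -/

section MomentValues

open PowerSeries Finset

/-- The binomials vanish for $i<k-1$; after a shift by $k-1$ this is $x^k$ times the negative
binomial series. -/
theorem hasSum_choose_mul_pow {𝕜 : Type*} [NormedField 𝕜] [CompleteSpace 𝕜] {k : ℕ} (hk : 1 ≤ k)
    {x : 𝕜} (hx : ‖x‖ < 1) :
    HasSum (fun i : ℕ => ((i + k).choose (2 * k - 1) : 𝕜) * x ^ (i + 1))
      (x ^ k / (1 - x) ^ (2 * k)) := by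
  have h1 := (hasSum_choose_mul_geometric_of_norm_lt_one (2 * k - 1) hx).mul_left (x ^ k)
  rw [mul_one_div, Nat.sub_add_cancel (by omega)] at h1
  rw [← hasSum_nat_add_iff' (k - 1), sum_eq_zero, sub_zero]
  · refine HasSum.congr_fun h1 fun n => Eq.symm ?_
    have e1 : n + (k - 1) + k = n + (2 * k - 1) := by omega
    have e2 : n + (k - 1) + 1 = n + k := by omega
    rw [e1, e2, pow_add]
    ring
  · intro i hi
    have := mem_range.1 hi
    rw [Nat.choose_eq_zero_of_lt (by omega), Nat.cast_zero, zero_mul]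

/-- The `n`-th term of the Lambert type series attached to `momentSeries a e k`. -/
noncomputable def momentTerm (q : ℂ) (a : ℕ → ℕ) (e k n : ℕ) : ℂ :=
  (-1) ^ (n + 1) * q ^ (a n + e * k * n) / (1 - q ^ (e * n)) ^ (2 * k)

theorem add_le_exponent (a : ℕ → ℕ) {e : ℕ} (he : 1 ≤ e) (p : ℕ × ℕ) :
    p.1 + (p.2 + 1) ≤ a (p.1 + 1) + e * (p.1 + 1) * (p.2 + 1) := by
  have h1 : 1 * (p.1 + 1) * (p.2 + 1) ≤ e * (p.1 + 1) * (p.2 + 1) := by gcongr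
  nlinarith [Nat.zero_le (p.1 * p.2), Nat.zero_le (a (p.1 + 1))]

/-- Both sides rearrange one absolutely convergent double series: grouping by `n` gives the
Lambert-type terms, and grouping by the exponent `ψ` gives the power series. -/
theorem hasValue_momentSeries {q : ℂ} (hq : ‖q‖ < 1) (a : ℕ → ℕ) {e k : ℕ} (he : 1 ≤ e)
    (hk : 1 ≤ k) :
    ∃ S, HasSum (fun n => momentTerm q a e k (n + 1)) S ∧ HasValue (momentSeries a e k) q S := by
  set ψ : ℕ × ℕ → ℕ := fun p => a (p.1 + 1) + e * (p.1 + 1) * (p.2 + 1) with hψ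
  set g : ℕ × ℕ → ℂ := fun p =>
    ((p.2 + k).choose (2 * k - 1) : ℂ) * (-1) ^ p.1 * q ^ ψ p with hg
  have hψle : ∀ p, p.1 + (p.2 + 1) ≤ ψ p := add_le_exponent a he
  have hsum : Summable g := by
    have h1 := summable_geometric_of_lt_one (norm_nonneg q) hq
    have h2 := (hasSum_choose_mul_pow hk
      (by rwa [Real.norm_of_nonneg (norm_nonneg q)] : ‖(‖q‖ : ℝ)‖ < 1)).summable
    refine Summable.of_norm_bounded (h1.mul_of_nonneg h2 (fun n => by positivity)
      (fun n => by positivity)) fun p => ?_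
    simp only [hg, norm_mul, norm_pow, norm_neg, norm_one, one_pow, mul_one, Complex.norm_natCast]
    rw [mul_left_comm, ← pow_add]
    gcongr 1
    exact pow_le_pow_of_le_one (norm_nonneg q) hq.le (hψle p)
  obtain ⟨S, hS⟩ := hsum
  refine ⟨S, hS.prod_fiberwise fun n => ?_, ?_⟩
  · have hx : ‖q ^ (e * (n + 1))‖ < 1 := by
      rw [norm_pow]
      exact pow_lt_one₀ (norm_nonneg q) hq (Nat.mul_ne_zero (by omega) (by omega))
    have h1 := (hasSum_choose_mul_pow hk hx).mul_left ((-1) ^ n * q ^ a (n + 1))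
    have h2 : momentTerm q a e k (n + 1) = (-1) ^ n * q ^ a (n + 1) *
        ((q ^ (e * (n + 1))) ^ k / (1 - q ^ (e * (n + 1))) ^ (2 * k)) := by
      have h3 : e * k * (n + 1) = e * (n + 1) * k := by ring
      rw [momentTerm, pow_add q, ← pow_mul, h3, mul_div_assoc', pow_add _ n 2]
      ring
    rw [h2]
    refine HasSum.congr_fun h1 fun i => Eq.symm ?_
    simp only [hg, hψ, pow_add, pow_mul]
    ring
  · have h1 := hS.tsum_fiberwise ψ
    rw [HasValue]
    refine HasSum.congr_fun h1 fun j => Eq.symm ?_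
    rw [tsum_subtype (ψ ⁻¹' {j}) g, tsum_eq_sum (s := range j ×ˢ range j)]
    · rw [momentSeries, coeff_mk, sum_product_right, Int.cast_sum, sum_mul]
      refine sum_congr rfl fun i _ => ?_
      rw [altTheta, coeff_mk, mul_sum, Int.cast_sum, sum_mul]
      refine sum_congr rfl fun n _ => ?_
      by_cases h : ψ (n, i) = j
      · rw [Set.indicator_of_mem (by exact h), if_pos h, hg]
        simp only [h]
        push_cast
        ring
      · rw [Set.indicator_of_notMem (by exact h), if_neg h]
        simp
    · intro p hp
      refine Set.indicator_of_notMem (fun hj => hp ?_) _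
      have h2 : ψ p = j := hj
      have := hψle p
      simp only [mem_product, mem_range]
      omega

end MomentValues

/-! ### Two-sided and one-sided sums -/

section Assembly

open PowerSeries Finset

theorem hasSum_one_le {F : ℕ → ℂ} {S : ℂ} (h : HasSum (fun n => F (n + 1)) S) :
    HasSum (fun n : {n : ℕ // 1 ≤ n} => F n) S := by
  refine (hasSum_subtype_iff_indicator (s := {n : ℕ | 1 ≤ n})).2 ?_
  rw [← hasSum_nat_add_iff' 1, sum_range_one, Set.indicator_of_notMem (by simp), sub_zero]
  exact h.congr_fun fun n =>
    Set.indicator_of_mem (by simp only [Set.mem_ofPred_eq]; omega) F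

theorem hasSum_ne_zero {F : ℤ → ℂ} {S T : ℂ} (h1 : HasSum (fun n : ℕ => F ((n + 1 : ℕ) : ℤ)) S)
    (h2 : HasSum (fun n : ℕ => F (-((n + 1 : ℕ) : ℤ))) T) :
    HasSum (fun n : {n : ℤ // n ≠ 0} => F n) (S + T) := by
  refine (hasSum_subtype_iff_indicator (s := {n : ℤ | n ≠ 0})).2 (HasSum.of_nat_of_neg_add_one ?_ ?_)
  · rw [← hasSum_nat_add_iff' 1]
    rw [sum_range_one, Set.indicator_of_notMem (by simp), sub_zero]
    refine HasSum.congr_fun h1 fun n => Eq.symm ?_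
    exact (Set.indicator_of_mem (by simp only [Set.mem_ofPred_eq]; omega) F).symm
  · refine HasSum.congr_fun h2 fun n => Eq.symm ?_
    have : -((n + 1 : ℕ) : ℤ) = -((n : ℤ) + 1) := by push_cast; rfl
    rw [Set.indicator_of_mem (by simp only [Set.mem_ofPred_eq]; omega), this]

theorem HasValue.hasSum_symMoment {N : ℤ → ℕ → ℤ} {k : ℕ} {f : ℤ⟦X⟧} {q v : ℂ}
    (h : HasValue f q v) (hf : ∀ n, symMoment N (2 * k) n = coeff n f) (h0 : coeff 0 f = 0) :
    HasSum (fun n : {n : ℕ // 1 ≤ n} => (symMoment N (2 * k) n : ℂ) * q ^ (n : ℕ)) v := by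
  simp only [hf]
  refine hasSum_one_le (F := fun n => ((coeff n f : ℤ) : ℂ) * q ^ n) ?_
  rw [HasValue, ← hasSum_nat_add_iff' 1] at h
  simpa only [range_one, sum_singleton, h0, Int.cast_zero, zero_mul, sub_zero] using h

theorem coeff_zero_mul_momentSeries (B : ℤ⟦X⟧) (a : ℕ → ℕ) (e k : ℕ) :
    coeff 0 (B * momentSeries a e k) = 0 := by
  rw [coeff_mul]
  simp [momentSeries]

/-- Negative indices account for the exponents $a(n)$ coming from $U_m$, positive ones for $a(n)+en$
coming from $U_{m+1}$; the pair at $\pm n$ adds up to the one-sided term. -/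
theorem HasTails.hasSum_of_eq {N : ℤ → ℕ → ℤ} {U : ℕ → ℤ⟦X⟧} (h : HasTails N U) {k : ℕ}
    (hk : 1 ≤ k) {B : ℤ⟦X⟧} {a : ℕ → ℕ} {e : ℕ} (he : 1 ≤ e)
    (hU : ∀ m, 1 ≤ m → U m = B * altTheta a e m) {q b : ℂ} (hq : ‖q‖ < 1) (hB : HasValue B q b)
    {F : ℤ → ℂ} {G : ℕ → ℂ}
    (hF : ∀ n : ℕ, 1 ≤ n → F n = momentTerm q (fun n => a n + e * n) e k n)
    (hF' : ∀ n : ℕ, 1 ≤ n → F (-n) = momentTerm q a e k n)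
    (hG : ∀ n : ℕ, 1 ≤ n → G n =
      (-1) ^ (n + 1) * q ^ (a n + e * k * n) * (1 + q ^ (e * n)) / (1 - q ^ (e * n)) ^ (2 * k)) :
    ∃ S : ℂ, HasSum (fun n : {n : ℤ // n ≠ 0} => F n) S ∧
      HasSum (fun n : {n : ℕ // 1 ≤ n} => G n) S ∧
      HasSum (fun n : {n : ℕ // 1 ≤ n} => (symMoment N (2 * k) n : ℂ) * q ^ (n : ℕ)) (b * S) := by
  obtain ⟨S, hS, hSv⟩ := hasValue_momentSeries hq a he hk
  obtain ⟨T, hT, hTv⟩ := hasValue_momentSeries hq (fun n => a n + e * n) he hk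
  refine ⟨T + S, hasSum_ne_zero ?_ ?_, hasSum_one_le ?_, ?_⟩
  · simpa only [hF _ (Nat.le_add_left 1 _)] using hT
  · simpa only [hF' _ (Nat.le_add_left 1 _)] using hS
  · refine HasSum.congr_fun (hT.add hS) fun n => Eq.symm ?_
    rw [hG _ (Nat.le_add_left 1 n), momentTerm, momentTerm, ← add_div]
    ring
  · rw [add_comm T]
    refine (hB.mul (hSv.add hTv)).hasSum_symMoment (h.symMoment_eq_of_eq hk he hU) ?_
    rw [mul_add, map_add, coeff_zero_mul_momentSeries, coeff_zero_mul_momentSeries, add_zero]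

/-- The terms at $n$ and $-n$ split the one-sided term in the proportions $q^{en}/(1+q^{en})$ and
$1/(1+q^{en})$, whose sum is $1$. Each half converges since $|1+q^{en}|\ge1-|q|$. -/
theorem HasTails.hasSum_of_add {N : ℤ → ℕ → ℤ} {U : ℕ → ℤ⟦X⟧} (h : HasTails N U) {k : ℕ}
    (hk : 1 ≤ k) {B : ℤ⟦X⟧} {a : ℕ → ℕ} {e : ℕ} (he : 1 ≤ e)
    (hU : ∀ m, 1 ≤ m → U m + U (m + 1) = B * altTheta a e m) {q b : ℂ} (hq : ‖q‖ < 1)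
    (hB : HasValue B q b) {F : ℤ → ℂ} {G : ℕ → ℂ}
    (hF : ∀ n : ℕ, 1 ≤ n → F n = momentTerm q a e k n * (q ^ (e * n) / (1 + q ^ (e * n))))
    (hF' : ∀ n : ℕ, 1 ≤ n → F (-n) = momentTerm q a e k n * (1 / (1 + q ^ (e * n))))
    (hG : ∀ n : ℕ, 1 ≤ n → G n = momentTerm q a e k n) :
    ∃ S : ℂ, HasSum (fun n : {n : ℤ // n ≠ 0} => F n) S ∧
      HasSum (fun n : {n : ℕ // 1 ≤ n} => G n) S ∧
      HasSum (fun n : {n : ℕ // 1 ≤ n} => (symMoment N (2 * k) n : ℂ) * q ^ (n : ℕ)) (b * S) := by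
  obtain ⟨S, hS, hSv⟩ := hasValue_momentSeries hq a he hk
  have hx : ∀ n : ℕ, ‖q ^ (e * (n + 1))‖ ≤ ‖q‖ := fun n => by
    rw [norm_pow]
    exact pow_le_of_le_one (norm_nonneg q) hq.le (Nat.mul_ne_zero (by omega) (by omega))
  have hd : ∀ n : ℕ, 1 - ‖q‖ ≤ ‖1 + q ^ (e * (n + 1))‖ := fun n => by
    have h1 := norm_sub_le (1 + q ^ (e * (n + 1))) (q ^ (e * (n + 1)))
    rw [add_sub_cancel_right, norm_one] at h1
    linarith [hx n]
  have h0 : 0 < 1 - ‖q‖ := by linarith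
  have hs : Summable fun n : ℕ => momentTerm q a e k (n + 1) * (1 / (1 + q ^ (e * (n + 1)))) := by
    refine Summable.of_norm_bounded (hS.summable.norm.mul_right (1 / (1 - ‖q‖))) fun n => ?_
    rw [norm_mul, norm_div, norm_one]
    gcongr
    exact hd n
  have hne : ∀ n : ℕ, 1 + q ^ (e * (n + 1)) ≠ 0 := fun n =>
    norm_pos_iff.1 (h0.trans_le (hd n))
  have ht : HasSum (fun n : ℕ => momentTerm q a e k (n + 1) *
      (q ^ (e * (n + 1)) / (1 + q ^ (e * (n + 1))))) (S - ∑' n, momentTerm q a e k (n + 1) *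
      (1 / (1 + q ^ (e * (n + 1))))) := by
    refine HasSum.congr_fun (hS.sub hs.hasSum) fun n => Eq.symm ?_
    have := hne n
    field_simp
    ring
  have hfin := (hB.mul hSv).hasSum_symMoment (h.symMoment_eq_of_add hk he hU)
    (coeff_zero_mul_momentSeries _ _ _ _)
  refine ⟨S, ?_, hasSum_one_le ?_, hfin⟩
  · rw [← sub_add_cancel S (∑' n, momentTerm q a e k (n + 1) * (1 / (1 + q ^ (e * (n + 1)))))]
    refine hasSum_ne_zero ?_ ?_
    · simpa only [hF _ (Nat.le_add_left 1 _)] using ht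
    · simpa only [hF' _ (Nat.le_add_left 1 _)] using hs.hasSum
  · simpa only [hG _ (Nat.le_add_left 1 _)] using hS

theorem neg_one_zpow_neg_add_one (n : ℕ) : (-1 : ℂ) ^ (-(n : ℤ) + 1) = (-1) ^ (n + 1) := by
  rw [zpow_add₀ (by norm_num), zpow_neg, zpow_natCast, zpow_one, pow_succ,
    inv_eq_of_mul_eq_one_right]
  rw [← mul_pow]
  norm_num

theorem bilateralTerm_pos (q : ℂ) {E t : ℤ} {n s k D : ℕ} (hE : E = D) (ht : t = s) :
    (-1) ^ ((n : ℤ) + 1) * q ^ E / (1 - q ^ t) ^ (2 * k) =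
      (-1) ^ (n + 1) * q ^ D / (1 - q ^ s) ^ (2 * k) := by
  rw [hE, ht, zpow_natCast, zpow_natCast, ← zpow_natCast (-1 : ℂ) (n + 1), Nat.cast_succ]

/-- From $1-q^{-s}=-(1-q^s)/q^s$, raised to the even power $2k$, the sign disappears and $q^{2ks}$
moves to the numerator. -/
theorem bilateralTerm_neg {q : ℂ} (hq : q ≠ 0) {E t : ℤ} {n s k D : ℕ} (hE : E + 2 * k * s = D)
    (ht : t = -s) :
    (-1) ^ (-(n : ℤ) + 1) * q ^ E / (1 - q ^ t) ^ (2 * k) =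
      (-1) ^ (n + 1) * q ^ D / (1 - q ^ s) ^ (2 * k) := by
  have hs : q ^ s ≠ 0 := pow_ne_zero _ hq
  have h1 : 1 - q ^ (-(s : ℤ)) = -(1 - q ^ s) / q ^ s := by
    rw [zpow_neg, zpow_natCast]
    field_simp
    ring
  have h2 : q ^ D = q ^ E * (q ^ s) ^ (2 * k) := by
    rw [← zpow_natCast q D, ← hE, zpow_add₀ hq, ← pow_mul, ← zpow_natCast]
    congr 2
    push_cast
    ring
  rw [neg_one_zpow_neg_add_one, ht, h1, div_pow, (even_two_mul k).neg_pow, h2,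
    div_div_eq_mul_div, mul_assoc]

theorem bilateralTerm_pos' {q : ℂ} (hq : q ≠ 0) {E t : ℤ} {n s k D : ℕ} (hE : E = D + s)
    (ht : t = s) :
    (-1) ^ ((n : ℤ) + 1) * q ^ E / ((1 + q ^ t) * (1 - q ^ t) ^ (2 * k)) =
      (-1) ^ (n + 1) * q ^ D / (1 - q ^ s) ^ (2 * k) * (q ^ s / (1 + q ^ s)) := by
  rw [← bilateralTerm_pos q (rfl : (D : ℤ) = D) ht, hE, zpow_add₀ hq, ht, zpow_natCast q s,
    div_mul_div_comm]
  congr 1 <;> ring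

/-- The additional `s` in `hE` comes from $1+q^{-s}=(1+q^s)/q^s$. -/
theorem bilateralTerm_neg' {q : ℂ} (hq : q ≠ 0) {E t : ℤ} {n s k D : ℕ}
    (hE : E + s + 2 * k * s = D) (ht : t = -s) :
    (-1) ^ (-(n : ℤ) + 1) * q ^ E / ((1 + q ^ t) * (1 - q ^ t) ^ (2 * k)) =
      (-1) ^ (n + 1) * q ^ D / (1 - q ^ s) ^ (2 * k) * (1 / (1 + q ^ s)) := by
  have hs : q ^ s ≠ 0 := pow_ne_zero _ hq
  have h1 : 1 + q ^ t = (1 + q ^ s) / q ^ s := by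
    rw [ht, zpow_neg, zpow_natCast]
    field_simp
    ring
  rw [← bilateralTerm_neg hq hE ht, h1, zpow_add₀ hq, zpow_natCast q s, div_mul_eq_mul_div,
    div_div_eq_mul_div, div_mul_div_comm]
  congr 1 <;> ring

theorem hasValue_two_mul {B : ℤ⟦X⟧} {q b : ℂ} (h : HasValue B q b) : HasValue (2 * B) q (2 * b) := by
  rw [two_mul, two_mul]
  exact h.add h

theorem int_mul_succ_ediv_two (n : ℕ) : (n : ℤ) * (n + 1) / 2 = (n.choose 2 + n : ℕ) := by
  have h := Nat.choose_two_right (n + 1)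
  rw [Nat.choose_succ_succ' n 1, Nat.choose_one_right, Nat.add_sub_cancel, one_add_one_eq_two] at h
  rw [Nat.add_comm _ n, h]
  push_cast
  rw [mul_comm]

theorem two_mul_choose_two (n : ℕ) : 2 * n.choose 2 = n * (n - 1) := by
  rw [Nat.choose_two_right, Nat.mul_div_cancel' (Nat.even_mul_pred_self n).two_dvd]

theorem neg_mul_neg_succ_ediv_two {n : ℕ} (hn : 1 ≤ n) :
    -(n : ℤ) * (-(n : ℤ) + 1) / 2 = (n.choose 2 : ℕ) := by
  obtain ⟨m, rfl⟩ := Nat.exists_eq_add_of_le' hn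
  have h := int_mul_succ_ediv_two m
  have h2 := Nat.choose_succ_succ' m 1
  rw [Nat.choose_one_right, one_add_one_eq_two, Nat.add_comm m (m.choose 2)] at h2
  rw [h2, ← h]
  congr 1
  push_cast
  ring

end Assembly

theorem mainTheorem5 (k : ℕ) (hk : 1 ≤ k) (q : ℂ) (hq0 : q ≠ 0) (hq1 : ‖q‖ < 1) :
    (∃ S : ℂ,
      HasSum (fun n : {n : ℤ // n ≠ 0} =>
        (-1) ^ ((n : ℤ) + 1) * q ^ ((n : ℤ) * (n + 1) + 2 * k * n)
          / (1 - q ^ (2 * (n : ℤ))) ^ (2 * k)) S ∧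
      HasSum (fun n : {n : ℕ // 1 ≤ n} =>
        (-1) ^ ((n : ℕ) + 1) * q ^ ((n : ℕ) * (n - 1) + 2 * k * n) * (1 + q ^ (2 * (n : ℕ)))
          / (1 - q ^ (2 * (n : ℕ))) ^ (2 * k)) S ∧
      HasSum (fun n : {n : ℕ // 1 ≤ n} => (symMoment crank2 (2 * k) n : ℂ) * q ^ (n : ℕ))
        (qPoch (-q) (q ^ 2) / qPoch (q ^ 2) (q ^ 2) * S)) ∧
    (∃ S : ℂ,
      HasSum (fun n : {n : ℤ // n ≠ 0} =>
        (-1) ^ ((n : ℤ) + 1) * q ^ ((n : ℤ) * (2 * n + 1) + 2 * k * n)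
          / (1 - q ^ (2 * (n : ℤ))) ^ (2 * k)) S ∧
      HasSum (fun n : {n : ℕ // 1 ≤ n} =>
        (-1) ^ ((n : ℕ) + 1) * q ^ ((n : ℕ) * (2 * n - 1) + 2 * k * n) * (1 + q ^ (2 * (n : ℕ)))
          / (1 - q ^ (2 * (n : ℕ))) ^ (2 * k)) S ∧
      HasSum (fun n : {n : ℕ // 1 ≤ n} => (symMoment rank2 (2 * k) n : ℂ) * q ^ (n : ℕ))
        (qPoch (-q) (q ^ 2) / qPoch (q ^ 2) (q ^ 2) * S)) ∧
    (∃ S : ℂ,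
      HasSum (fun n : {n : ℤ // n ≠ 0} =>
        (-1) ^ ((n : ℤ) + 1) * q ^ ((n : ℤ) * (n + 1) / 2 + k * n)
          / (1 - q ^ (n : ℤ)) ^ (2 * k)) S ∧
      HasSum (fun n : {n : ℕ // 1 ≤ n} =>
        (-1) ^ ((n : ℕ) + 1) * q ^ ((n : ℕ) * (n - 1) / 2 + k * n) * (1 + q ^ (n : ℕ))
          / (1 - q ^ (n : ℕ)) ^ (2 * k)) S ∧
      HasSum (fun n : {n : ℕ // 1 ≤ n} => (symMoment crankBar (2 * k) n : ℂ) * q ^ (n : ℕ))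
        (qPoch (-q) q / qPoch q q * S)) ∧
    (∃ S : ℂ,
      HasSum (fun n : {n : ℤ // n ≠ 0} =>
        (-1) ^ ((n : ℤ) + 1) * q ^ ((n : ℤ) ^ 2 + n + k * n)
          / ((1 + q ^ (n : ℤ)) * (1 - q ^ (n : ℤ)) ^ (2 * k))) S ∧
      HasSum (fun n : {n : ℕ // 1 ≤ n} =>
        (-1) ^ ((n : ℕ) + 1) * q ^ ((n : ℕ) ^ 2 + k * n)
          / (1 - q ^ (n : ℕ)) ^ (2 * k)) S ∧
      HasSum (fun n : {n : ℕ // 1 ≤ n} => (symMoment rankBar (2 * k) n : ℂ) * q ^ (n : ℕ))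
        (2 * (qPoch (-q) q / qPoch q q) * S)) ∧
    (∃ S : ℂ,
      HasSum (fun n : {n : ℤ // n ≠ 0} =>
        (-1) ^ ((n : ℤ) + 1) * q ^ ((n : ℤ) * (n + 1) + 2 * k * n)
          / (1 - q ^ (2 * (n : ℤ))) ^ (2 * k)) S ∧
      HasSum (fun n : {n : ℕ // 1 ≤ n} =>
        (-1) ^ ((n : ℕ) + 1) * q ^ ((n : ℕ) * (n - 1) + 2 * k * n) * (1 + q ^ (2 * (n : ℕ)))
          / (1 - q ^ (2 * (n : ℕ))) ^ (2 * k)) S ∧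
      HasSum (fun n : {n : ℕ // 1 ≤ n} => (symMoment crank2Bar (2 * k) n : ℂ) * q ^ (n : ℕ))
        (qPoch (-q) q / qPoch q q * S)) ∧
    (∃ S : ℂ,
      HasSum (fun n : {n : ℤ // n ≠ 0} =>
        (-1) ^ ((n : ℤ) + 1) * q ^ ((n : ℤ) ^ 2 + 2 * n + 2 * k * n)
          / ((1 + q ^ (2 * (n : ℤ))) * (1 - q ^ (2 * (n : ℤ))) ^ (2 * k))) S ∧
      HasSum (fun n : {n : ℕ // 1 ≤ n} =>
        (-1) ^ ((n : ℕ) + 1) * q ^ ((n : ℕ) ^ 2 + 2 * k * n)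
          / (1 - q ^ (2 * (n : ℕ))) ^ (2 * k)) S ∧
      HasSum (fun n : {n : ℕ // 1 ≤ n} => (symMoment rank2Bar (2 * k) n : ℂ) * q ^ (n : ℕ))
        (2 * (qPoch (-q) q / qPoch q q) * S)) := by
  have hA := hasValue_totalGF_overpartition hq1
  have hB := hasValue_totalGF_oddDistinctPartition hq1
  refine ⟨?_, ?_, ?_, ?_, ?_, ?_⟩
  · obtain ⟨U, h, hU⟩ := exists_hasTails_crank2
    refine h.hasSum_of_eq hk one_le_two hU hq1 hB (F := fun n =>
        (-1) ^ (n + 1) * q ^ (n * (n + 1) + 2 * k * n) / (1 - q ^ (2 * n)) ^ (2 * k))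
      (G := fun n => (-1) ^ (n + 1) * q ^ (n * (n - 1) + 2 * k * n) * (1 + q ^ (2 * n))
          / (1 - q ^ (2 * n)) ^ (2 * k)) (fun n hn => ?_) (fun n hn => ?_) (fun n hn => ?_)
    -- The bound `hn` makes the truncated subtraction $n-1$ exact under the cast to the integers.
    · exact bilateralTerm_pos q (by
        simp only [two_mul_choose_two]; push_cast [hn]; ring) (by push_cast; rfl)
    · exact bilateralTerm_neg hq0 (by
        simp only [two_mul_choose_two]; push_cast [hn]; ring) (by push_cast; ring)
    · rw [two_mul_choose_two]
  · obtain ⟨U, h, hU⟩ := exists_hasTails_rank2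
    refine h.hasSum_of_eq hk one_le_two hU hq1 hB (F := fun n =>
        (-1) ^ (n + 1) * q ^ (n * (2 * n + 1) + 2 * k * n) / (1 - q ^ (2 * n)) ^ (2 * k))
      (G := fun n => (-1) ^ (n + 1) * q ^ (n * (2 * n - 1) + 2 * k * n) * (1 + q ^ (2 * n))
          / (1 - q ^ (2 * n)) ^ (2 * k)) (fun n hn => ?_) (fun n hn => ?_) (fun n hn => rfl)
    · exact bilateralTerm_pos q (by
        push_cast [(by omega : 1 ≤ 2 * n)]; ring) (by push_cast; rfl)
    · exact bilateralTerm_neg hq0 (by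
        push_cast [(by omega : 1 ≤ 2 * n)]; ring) (by push_cast; ring)
  · obtain ⟨U, h, hU⟩ := exists_hasTails_crankBar
    refine h.hasSum_of_eq hk le_rfl hU hq1 hA (F := fun n =>
        (-1) ^ (n + 1) * q ^ (n * (n + 1) / 2 + k * n) / (1 - q ^ n) ^ (2 * k))
      (G := fun n => (-1) ^ (n + 1) * q ^ (n * (n - 1) / 2 + k * n) * (1 + q ^ n)
          / (1 - q ^ n) ^ (2 * k)) (fun n hn => ?_) (fun n hn => ?_) (fun n hn => ?_)
    · exact bilateralTerm_pos q (by
        rw [int_mul_succ_ediv_two]; push_cast; ring) (by rw [one_mul])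
    -- The integer division by $2$ is exact; at $-n$ the exponent $n(n+1)/2$ becomes $\binom n2$.
    · exact bilateralTerm_neg hq0 (by
        rw [neg_mul_neg_succ_ediv_two hn]; push_cast; ring) (by rw [one_mul])
    · simp only [one_mul, Nat.choose_two_right]
  · obtain ⟨U, h, hU⟩ := exists_hasTails_rankBar
    refine h.hasSum_of_add hk le_rfl hU hq1 (hasValue_two_mul hA) (F := fun n =>
        (-1) ^ (n + 1) * q ^ (n ^ 2 + n + k * n) / ((1 + q ^ n) * (1 - q ^ n) ^ (2 * k)))
      (G := fun n => (-1) ^ (n + 1) * q ^ (n ^ 2 + k * n) / (1 - q ^ n) ^ (2 * k))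
      (fun n hn => ?_) (fun n hn => ?_) (fun n hn => ?_)
    · exact bilateralTerm_pos' hq0 (by push_cast; ring) (by rw [one_mul])
    · exact bilateralTerm_neg' hq0 (by push_cast; ring) (by rw [one_mul])
    · simp only [momentTerm, one_mul]
  · obtain ⟨U, h, hU⟩ := exists_hasTails_crank2Bar
    refine h.hasSum_of_eq hk one_le_two hU hq1 hA (F := fun n =>
        (-1) ^ (n + 1) * q ^ (n * (n + 1) + 2 * k * n) / (1 - q ^ (2 * n)) ^ (2 * k))
      (G := fun n => (-1) ^ (n + 1) * q ^ (n * (n - 1) + 2 * k * n) * (1 + q ^ (2 * n))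
          / (1 - q ^ (2 * n)) ^ (2 * k)) (fun n hn => ?_) (fun n hn => ?_) (fun n hn => ?_)
    · exact bilateralTerm_pos q (by
        simp only [two_mul_choose_two]; push_cast [hn]; ring) (by push_cast; rfl)
    · exact bilateralTerm_neg hq0 (by
        simp only [two_mul_choose_two]; push_cast [hn]; ring) (by push_cast; ring)
    · rw [two_mul_choose_two]
  · obtain ⟨U, h, hU⟩ := exists_hasTails_rank2Bar
    refine h.hasSum_of_add hk one_le_two hU hq1 (hasValue_two_mul hA) (F := fun n =>
        (-1) ^ (n + 1) * q ^ (n ^ 2 + 2 * n + 2 * k * n)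
          / ((1 + q ^ (2 * n)) * (1 - q ^ (2 * n)) ^ (2 * k)))
      (G := fun n => (-1) ^ (n + 1) * q ^ (n ^ 2 + 2 * k * n) / (1 - q ^ (2 * n)) ^ (2 * k))
      (fun n hn => ?_) (fun n hn => ?_) (fun n hn => rfl)
    · exact bilateralTerm_pos' hq0 (by push_cast; ring) (by push_cast; rfl)
    · exact bilateralTerm_neg' hq0 (by push_cast; ring) (by push_cast; ring)
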